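/- **Theorem 1 (Lower Bound).** Let $D\ge 1$ and let $r\in\mathbb N$. Fix an $r$-regular multiresolution approximation $(V_j)_{j\in\mathbb Z}$ of $L^2(\mathbb R^D)$ with real father wavelet $\phi$ and mother wavelets $\psi_\epsilon$, $\epsilon\in E=\{0,1\}^D\setminus\{0\}$, all supported in $[-A,A]^D$: $(V_j)$ is an increasing sequence of closed subspaces with $\bigcap_j V_j=\{0\}$ and $\overline{\bigcup_j V_j}=L^2(\mathbb R^D)$; $f\in V_0\Leftrightarrow f(\cdot-k)\in V_0$ for $k\in\mathbb Z^D$ and $f\in V_j\Leftrightarrow f(2\,\cdot)\in V_{j+1}$; $\{\phi(\cdot-k)\}_{k\in\mathbb Z^D}$ is an orthonormal basis of $V_0$; for every $j$ the functions $2^{Dj/2}\phi(2^jx-k)$ and $2^{Dj/2}\psi_\epsilon(2^jx-k)$ ($k\in\mathbb Z^D$, $\epsilon\in E$) together form an orthonormal basis of $V_{j+1}$; and $\phi$ is $C^r$, with all derivatives of order at most $r$ bounded and decaying faster than any polynomial. For $0\le\sigma<r$, $p,q\in[1,\infty]$ and a locally integrable $f:\mathbb R^D\to\mathbb R$ put $\alpha_k=\int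 f(x)\phi(x-k)\,dx$, $\beta_{j,k,\epsilon}=\int f(x)\,2^{Dj/2}\psi_\epsilon(2^jx-k)\,dx$ and $$\|f\|_{B^\sigma_{p,q}}=\|(\alpha_k)_{k}\|_{\ell^p}+\Big\|\Big(2^{j(\sigma+D(1/2-1/p))}\|(\beta_{j,k,\epsilon})_{k,\epsilon}\|_{\ell^p}\Big)_{j\ge0}\Big\|_{\ell^q},$$ and let $B^\sigma_{p,q}(L)=\{f:\|f\|_{B^\sigma_{p,q}}\le L\}$. Let $p_g,q_g,p_d,q_d\in[1,\infty]$, $r>\sigma_g\ge D/p_g$, $0\le\sigma_d<r$, $L_d>0$, and let $\mathcal X\subseteq\mathbb R^D$ be a sample space with nonempty interior (for example $[-T,T]^D$ or $\mathbb R^D$). For $L>0$ let $\mathcal F_g(L)$ be the set of probability densities on $\mathbb R^D$ that vanish outside $\mathcal X$ and lie in $B^{\sigma_g}_{p_g,q_g}(L)$, and let $L_g$ be a radius such that $\mathcal F_g(L')\ne\emptyset$ for some $L'<L_g$. Let $\mathcal F_d$ be the set of bounded measurable functions in $B^{\sigma_d}_{p_d,q_d}(L_d)$, and for a density $p$ and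 a finite signed measure $\nu$ let $d_{\mathcal F_d}(p,\nu)=\sup_{f\in\mathcal F_d}\left|\int f p\,dx-\int f\,d\nu\right|$. Let $$M_n=\inf_{\hat p}\ \sup_{p\in\mathcal F_g(L_g)}\ \mathbb E_{X_1,\dots,X_n\overset{\mathrm{iid}}{\sim}p}\big[d_{\mathcal F_d}(p,\hat p(X_1,\dots,X_n))\big],$$ where the infimum is over all estimators, i.e. all measurable maps from the data to finite signed measures on $\mathbb R^D$ (in particular, all measurable density estimates). Then there are $c>0$ and $N$, not depending on $n$, such that for all $n\ge N$ $$M_n\ \ge\ c\,\max\left(n^{-\frac{\sigma_g+\sigma_d}{2\sigma_g+D}},\ \left(\frac{\log n}{n}\right)^{\frac{\sigma_g+\sigma_d+D-D/p_g-D/p_d}{2\sigma_g+D-2D/p_g}}\right).$$ -/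

import Mathlib

open MeasureTheory Filter
open scoped ENNReal

noncomputable section

namespace BesovIPM

/-- Euclidean space `ℝ^D`. -/
abbrev E (D : ℕ) : Type := EuclideanSpace ℝ (Fin D)

/-- The lattice point of `ℝ^D` with integer coordinates `k`. -/
def latt {D : ℕ} (k : Fin D → ℤ) : E D := WithLp.toLp 2 (fun i => (k i : ℝ))

/-- The set `{0,1}^D \ {(0,…,0)}` that indexes the mother wavelets. -/
abbrev Eps (D : ℕ) : Type := {e : Fin D → Fin 2 // e ≠ 0}

/-- The rescaled translate `x ↦ 2^{Dj/2} g(2^j x - k)`. -/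
def scaled {D : ℕ} (j : ℤ) (k : Fin D → ℤ) (g : E D → ℝ) : E D → ℝ :=
  fun x => (2 : ℝ) ^ ((D : ℝ) * (j : ℝ) / 2) * g ((2 : ℝ) ^ j • x - latt k)

/-- The functions `e i` belong to `L²(ℝ^D)` and their classes form an orthonormal (Hilbert) basis
of the closed subspace `W`. -/
def IsOrthonormalBasisOf {D : ℕ} {ι : Type} (e : ι → E D → ℝ)
    (W : Submodule ℝ (Lp ℝ 2 (volume : Measure (E D)))) : Prop :=
  ∃ u : ι → Lp ℝ 2 (volume : Measure (E D)),
    (∀ i, u i =ᵐ[volume] e i) ∧ Orthonormal ℝ u ∧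
      (Submodule.span ℝ (Set.range u)).topologicalClosure = W

/-- An `r`-regular multiresolution approximation of `L²(ℝ^D)` with father wavelet `φ` and mother
wavelets `ψ ε`, all of them supported in a cube `[-A, A]^D`. -/
structure WaveletMRA (D r : ℕ) where
  V : ℤ → Submodule ℝ (Lp ℝ 2 (volume : Measure (E D)))
  φ : E D → ℝ
  ψ : Eps D → E D → ℝ
  A : ℝ
  isClosed : ∀ j, IsClosed (V j : Set (Lp ℝ 2 (volume : Measure (E D))))
  mono : Monotone V
  iInf_eq : ⨅ j, V j = ⊥
  iSup_eq : (⨆ j, V j).topologicalClosure = ⊤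
  translate : ∀ (k : Fin D → ℤ) (f g : Lp ℝ 2 (volume : Measure (E D))),
    (g =ᵐ[volume] fun x => f (x - latt k)) → (f ∈ V 0 ↔ g ∈ V 0)
  dilate : ∀ (j : ℤ) (f g : Lp ℝ 2 (volume : Measure (E D))),
    (g =ᵐ[volume] fun x => f ((2 : ℝ) • x)) → (f ∈ V j ↔ g ∈ V (j + 1))
  father : IsOrthonormalBasisOf (fun (k : Fin D → ℤ) x => φ (x - latt k)) (V 0)
  mother : ∀ j : ℤ, IsOrthonormalBasisOf
    (Sum.elim (fun k : Fin D → ℤ => scaled j k φ)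
      (fun ek : Eps D × (Fin D → ℤ) => scaled j ek.2 (ψ ek.1))) (V (j + 1))
  smooth : ContDiff ℝ r φ
  decay : ∀ i ≤ r, ∀ m : ℕ, ∃ C : ℝ, ∀ x, ‖iteratedFDeriv ℝ i φ x‖ ≤ C * ((1 + ‖x‖) ^ m)⁻¹
  support_father : ∀ x, φ x ≠ 0 → ∀ i, |x i| ≤ A
  support_mother : ∀ e x, ψ e x ≠ 0 → ∀ i, |x i| ≤ A

/-- The `ℓ^p` norm, `p ∈ [1, ∞]`, of a family of nonnegative extended reals. -/
def seqNorm {ι : Type} (p : ℝ≥0∞) (a : ι → ℝ≥0∞) : ℝ≥0∞ :=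
  if p = ∞ then ⨆ i, a i else (∑' i, a i ^ p.toReal) ^ p.toReal⁻¹

variable {D r : ℕ}

/-- The coefficient `α_k = ∫ f(x) φ(x - k) dx`. -/
def coeffFather (W : WaveletMRA D r) (f : E D → ℝ) (k : Fin D → ℤ) : ℝ :=
  ∫ x, f x * W.φ (x - latt k)

/-- The coefficient `β_λ = ∫ f(x) ψ_λ(x) dx`, where `λ = 2^{-j} k + 2^{-j-1} ε` is recorded by
its level `j` and the pair `(ε, k)`. -/
def coeffMother (W : WaveletMRA D r) (f : E D → ℝ) (j : ℕ) (ek : Eps D × (Fin D → ℤ)) : ℝ :=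
  ∫ x, f x * scaled (j : ℤ) ek.2 (W.ψ ek.1) x

/-- The Besov norm of `B^σ_{p,q}(ℝ^D)`, with values in `[0, ∞]`. -/
def besovNorm (W : WaveletMRA D r) (σ : ℝ) (p q : ℝ≥0∞) (f : E D → ℝ) : ℝ≥0∞ :=
  seqNorm p (fun k => ‖coeffFather W f k‖ₑ) +
    seqNorm q (fun j : ℕ =>
      (2 : ℝ≥0∞) ^ ((j : ℝ) * (σ + (D : ℝ) * (1 / 2 - (p⁻¹).toReal))) *
        seqNorm p (fun ek => ‖coeffMother W f j ek‖ₑ))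

/-- The closed Besov ball `B^σ_{p,q}(L)`; local integrability makes all the coefficients
meaningful. -/
def besovBall (W : WaveletMRA D r) (σ : ℝ) (p q : ℝ≥0∞) (L : ℝ) : Set (E D → ℝ) :=
  {f | LocallyIntegrable f volume ∧ besovNorm W σ p q f ≤ ENNReal.ofReal L}

/-- The discriminator class: bounded, measurable functions in the Besov ball. -/
def discriminators (W : WaveletMRA D r) (σ : ℝ) (p q : ℝ≥0∞) (L : ℝ) : Set (E D → ℝ) :=
  {f | f ∈ besovBall W σ p q L ∧ Measurable f ∧ ∃ M : ℝ, ∀ x, |f x| ≤ M}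

/-- The probability densities on the sample space `X ⊆ ℝ^D` that lie in the Besov ball. -/
def densities (W : WaveletMRA D r) (X : Set (E D)) (σ : ℝ) (p q : ℝ≥0∞) (L : ℝ) :
    Set (E D → ℝ) :=
  {g | g ∈ besovBall W σ p q L ∧ (∀ x, 0 ≤ g x) ∧ (∀ x, x ∉ X → g x = 0) ∧
    Integrable g volume ∧ ∫ x, g x = 1}

/-- The probability distribution with density `g`. -/
def law (g : E D → ℝ) : Measure (E D) :=
  volume.withDensity (fun x => ENNReal.ofReal (g x))

/-- The integral probability metric `sup_{f ∈ F} |∫ f g - ∫ f dν|` between the distribution with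
density `g` and the finite signed measure `ν`. -/
def ipm (F : Set (E D → ℝ)) (g : E D → ℝ) (ν : SignedMeasure (E D)) : ℝ≥0∞ :=
  ⨆ f ∈ F, ENNReal.ofReal
    |(∫ x, f x * g x) - VectorMeasure.integral ν f (ContinuousLinearMap.lsmul ℝ ℝ)|

/-- The estimators based on `n` observations: measurable maps from the data to the finite signed
measures (in particular, measurable density estimates and the empirical distribution). -/
def estimators (D n : ℕ) : Set ((Fin n → E D) → SignedMeasure (E D)) :=
  {T | ∀ B : Set (E D), MeasurableSet B → Measurable (fun x => T x B)}

/-- The minimax risk, over the densities in `G`, of estimation from `n` i.i.d. observations under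
the loss given by the discriminator class `F`. -/
def minimaxRisk (F G : Set (E D → ℝ)) (n : ℕ) : ℝ≥0∞ :=
  ⨅ T ∈ estimators D n, ⨆ g ∈ G,
    ∫⁻ x, ipm F g (T x) ∂(Measure.pi fun _ : Fin n => law g)

end BesovIPM

end

open MeasureTheory Filter
open scoped ENNReal

noncomputable section

namespace BesovIPM

open scoped Topology

/-! Both rates come from perturbing a base density `g₀` by mother wavelets of a single level `J`.
After `g₀` is mixed with a small bump, it lies strictly inside the Besov ball and is at least `k₀ >
0` on some ball of the sample space. In that ball one finds about `2^{JD}` wavelets of level `J`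
with pairwise disjoint supports. Adding a combination with coefficients `a` keeps a density as long
as the combination is bounded by `k₀`, because the wavelets have mean zero. Wavelet combinations are
also discriminators. By orthonormality, testing with `∑ u_m ψ_m` gives the loss `|∑ u_m (a_m -
â_m)|`, where `â_m` is the centred coefficient of the estimate (`le_ipm`). Estimation of the density
is thus reduced to estimation of `a`.

Dense case (`dense_level_bound`): all signs `a_m = ±γ` are used at once. Flipping one sign changes
the likelihood by a chi-square amount of order `nγ²/k₀`, so no sign can be recovered, and `assouad`
adds the losses of all coordinates. The Besov constraints give `γ ~ 2^{-J(σg+D/2)}` and `γ' ~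
2^{-J(σd+D/2)}`. The level is chosen by `2^{J(2σg+D)} ~ n`.

Sparse case (`sparse_level_bound`): a single coefficient equals `γ`, so `γ` may be larger by the
factor `2^{JD/pg}`, and `γ'` by `2^{JD/pd}`. The uniform mixture over positions is compared with
`g₀`. Disjoint supports make the cross terms of its second moment trivial, so it is
indistinguishable from `g₀` while `exp(nγ²/k₀)` is at most a small multiple of `2^{JD}`. This yields
the logarithm. The condition `σg ≥ D/pg` keeps these larger perturbations bounded.

Both comparisons go through `mixture_bound`, which rests on the second-moment inequality
`half_le_of_second_moment`.

The wavelet facts have to be extracted from the multiresolution axioms. Compact support gives a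
finite refinement equation, hence continuous versions of the mother wavelets. Density of the spaces
`V_j` forces `∫ φ ≠ 0`. Orthogonality of `φ` to fine wavelets at dyadic centres gives vanishing
moments against derivatives of `φ`, and then against every smooth function
(`taylorMoment_motherRep`). This supplies mean zero for the perturbations and a finite Besov norm
for the bump. -/

/-! ### Integration against signed measures, and densities of product measures. -/

theorem isFiniteMeasure_variation {α : Type*} [MeasurableSpace α] (ν : SignedMeasure α) :
    IsFiniteMeasure (VectorMeasure.variation ν) := by
  rw [← SignedMeasure.totalVariation_eq_variation]; infer_instance

theorem integrable_signed {α : Type*} [MeasurableSpace α] (ν : SignedMeasure α) {f : α → ℝ}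
    (hf : Measurable f) {M : ℝ} (hM : ∀ x, |f x| ≤ M) : VectorMeasure.Integrable ν f := by
  have := isFiniteMeasure_variation ν
  exact Integrable.of_bound hf.aestronglyMeasurable M (Eventually.of_forall hM)

/-- Estimators are measurable only set by set. Simple functions reduce to that case, and bounded
simple approximations pass to the limit by dominated convergence for each fixed signed measure. This
makes the estimated wavelet coefficients measurable in the data. -/
theorem measurable_signed_integral {Ω α : Type*} [MeasurableSpace Ω] [MeasurableSpace α]
    {T : Ω → SignedMeasure α}
    (hT : ∀ B : Set α, MeasurableSet B → Measurable (fun x => T x B)) {f : α → ℝ}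
    (hf : Measurable f) {M : ℝ} (hM : ∀ x, |f x| ≤ M) :
    Measurable fun x => VectorMeasure.integral (T x) f (ContinuousLinearMap.lsmul ℝ ℝ) := by
  have simp_case : ∀ g : SimpleFunc α ℝ,
      Measurable fun x => VectorMeasure.integral (T x) g (ContinuousLinearMap.lsmul ℝ ℝ) := by
    intro g
    induction g using SimpleFunc.induction with
    | const c hs =>
      rename_i s
      have : ∀ x, VectorMeasure.integral (T x) (SimpleFunc.piecewise s hs (SimpleFunc.const α c)
          (SimpleFunc.const α 0)) (ContinuousLinearMap.lsmul ℝ ℝ) = c * T x s := by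
        intro x
        have := isFiniteMeasure_variation (T x)
        have h1 : (SimpleFunc.piecewise s hs (SimpleFunc.const α c)
          (SimpleFunc.const α 0) : α → ℝ) = s.indicator (fun _ => c) := by
          ext y; simp [Set.indicator, Set.piecewise]
        rw [h1, VectorMeasure.integral_indicator hs, VectorMeasure.integral_const]
        simp [VectorMeasure.restrict_apply, hs]
      simp_rw [this]
      exact (hT s hs).const_mul c
    | @add f g _ hf hg =>
      have : ∀ x, VectorMeasure.integral (T x) (f + g : SimpleFunc α ℝ)
          (ContinuousLinearMap.lsmul ℝ ℝ) =
          VectorMeasure.integral (T x) f (ContinuousLinearMap.lsmul ℝ ℝ) +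
          VectorMeasure.integral (T x) g (ContinuousLinearMap.lsmul ℝ ℝ) := by
        intro x
        have := isFiniteMeasure_variation (T x)
        rw [SimpleFunc.coe_add]
        exact VectorMeasure.integral_add (f.integrable_of_isFiniteMeasure)
          (g.integrable_of_isFiniteMeasure)
      simp_rw [this]
      exact hf.add hg
  have hs := hf.stronglyMeasurable
  refine measurable_of_tendsto_metrizable (fun n => simp_case (hs.approxBounded M n)) ?_
  rw [tendsto_pi_nhds]
  intro x
  have := isFiniteMeasure_variation (T x)
  refine VectorMeasure.tendsto_integral_filter_of_norm_le_const
    (Eventually.of_forall fun n => (SimpleFunc.measurable _).aestronglyMeasurable)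
    ⟨M, Eventually.of_forall fun n => Eventually.of_forall fun a =>
      hs.norm_approxBounded_le ((abs_nonneg _).trans (hM a)) n a⟩
    (Eventually.of_forall fun a => hs.tendsto_approxBounded_of_norm_le (hM a))

/-- The indicator of a box times the product density is a product over independent coordinates, so
its integral factors. It expresses the law of a perturbed sample through its likelihood ratio. -/
theorem pi_withDensity {α : Type*} [MeasurableSpace α] (μ : Measure α) [IsProbabilityMeasure μ]
    {f : α → ℝ≥0∞} (hf : Measurable f) (n : ℕ) [SigmaFinite (μ.withDensity f)] :
    Measure.pi (fun _ : Fin n => μ.withDensity f) =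
      (Measure.pi fun _ : Fin n => μ).withDensity fun x => ∏ i, f (x i) := by
  refine Measure.pi_eq fun s hs => ?_
  rw [withDensity_apply _ (MeasurableSet.univ_pi hs),
      ← lintegral_indicator (MeasurableSet.univ_pi hs)]
  have h1 : ∀ x : Fin n → α, (Set.univ.pi s).indicator (fun x => ∏ i, f (x i)) x =
      ∏ i, (s i).indicator f (x i) := by
    intro x
    by_cases hx : x ∈ Set.univ.pi s
    · rw [Set.indicator_of_mem hx]
      exact Finset.prod_congr rfl fun i _ => (Set.indicator_of_mem (hx i trivial) f).symm
    · rw [Set.indicator_of_notMem hx]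
      simp only [Set.mem_pi, Set.mem_univ, true_implies, not_forall] at hx
      obtain ⟨i, hi⟩ := hx
      exact (Finset.prod_eq_zero (Finset.mem_univ i) (Set.indicator_of_notMem hi f)).symm
  simp_rw [h1]
  have hind := ProbabilityTheory.iIndepFun_pi (μ := fun _ : Fin n => μ)
    (X := fun i => (s i).indicator f) (fun i => (hf.indicator (hs i)).aemeasurable)
  rw [ProbabilityTheory.lintegral_prod_eq_prod_lintegral_of_indepFun Finset.univ _ hind
    (fun i => (hf.indicator (hs i)).comp (measurable_pi_apply i))]
  refine Finset.prod_congr rfl fun i _ => ?_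
  rw [withDensity_apply _ (hs i), ← lintegral_indicator (hs i)]
  exact (measurePreserving_eval (fun _ : Fin n => μ) i).lintegral_comp (hf.indicator (hs i))

/-! ### Testing inequalities: second moments, Assouad's cube, mixtures. -/

section

/-- `Z` plays the role of a likelihood ratio. A second moment close to `1` keeps `∫ min 1 Z`, the
affinity of the two laws, at least `1/2`. Since `δ ≤ a + b`, the two risks together cannot fall
below `δ` times this affinity. -/
theorem half_le_of_second_moment {Ω : Type*} [MeasurableSpace Ω] (P : Measure Ω)
    [IsProbabilityMeasure P] {Z : Ω → ℝ} (hZm : Measurable Z) (hZ0 : ∀ x, 0 ≤ Z x) {C : ℝ}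
    (hZC : ∀ x, Z x ≤ C) (hZ1 : ∫ x, Z x ∂P = 1) (hZ2 : ∫ x, Z x ^ 2 ∂P ≤ 5 / 4)
    {a b : Ω → ℝ≥0∞} (ha : Measurable a) {δ : ℝ≥0∞}
    (hδ : ∀ x, δ ≤ a x + b x) :
    δ / 2 ≤ ∫⁻ x, a x ∂P + ∫⁻ x, ENNReal.ofReal (Z x) * b x ∂P := by
  have hZi : Integrable Z P := Integrable.of_bound hZm.aestronglyMeasurable C
    (Eventually.of_forall fun x => by rw [Real.norm_of_nonneg (hZ0 x)]; exact hZC x)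
  have hZ2i : Integrable (fun x => Z x ^ 2) P :=
    Integrable.of_bound (hZm.pow_const 2).aestronglyMeasurable (C ^ 2)
    (Eventually.of_forall fun x => by
      rw [Real.norm_of_nonneg (by positivity)]; exact pow_le_pow_left₀ (hZ0 x) (hZC x) 2)
  have hmin : Integrable (fun x => min 1 (Z x)) P :=
    (integrable_const 1).inf hZi
  have h1 : (1 / 2 : ℝ) ≤ ∫ x, min 1 (Z x) ∂P := by
    -- The quadratic lies below both branches: `1` exceeds it by `(Z - 3/2)²` and `Z` exceeds it by
    -- `(Z - 1)² + 1/4`. Its mean is at least `3 - 5/4 - 5/4 = 1/2`.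
    have : ∫ x, (3 * Z x - Z x ^ 2 - 5 / 4) ∂P ≤ ∫ x, min 1 (Z x) ∂P := by
      refine integral_mono (((hZi.const_mul 3).sub hZ2i).sub (integrable_const _)) hmin ?_
      intro x
      refine le_min ?_ ?_
      · dsimp only; nlinarith [sq_nonneg (Z x - 3 / 2)]
      · dsimp only; nlinarith [sq_nonneg (Z x - 1)]
    have e : ∫ x, (3 * Z x - Z x ^ 2 - 5 / 4) ∂P = 3 - ∫ x, Z x ^ 2 ∂P - 5 / 4 := by
      have h : Integrable (fun x => 3 * Z x - Z x ^ 2) P := (hZi.const_mul 3).sub hZ2i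
      rw [integral_sub h (integrable_const _), integral_sub (hZi.const_mul 3) hZ2i,
          integral_const_mul, hZ1]
      simp
    linarith
  calc δ / 2 = δ * ENNReal.ofReal (1 / 2) := by
        rw [ENNReal.ofReal_div_of_pos two_pos, ENNReal.ofReal_one, ENNReal.ofReal_ofNat,
          ENNReal.div_eq_inv_mul, mul_comm, one_div]
    _ ≤ δ * ENNReal.ofReal (∫ x, min 1 (Z x) ∂P) := by gcongr
    _ = δ * ∫⁻ x, ENNReal.ofReal (min 1 (Z x)) ∂P := by
        rw [ofReal_integral_eq_lintegral_ofReal hmin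
          (Eventually.of_forall fun x => le_min zero_le_one (hZ0 x))]
    _ = ∫⁻ x, δ * ENNReal.ofReal (min 1 (Z x)) ∂P := by
        rw [lintegral_const_mul _ (by fun_prop)]
    _ ≤ ∫⁻ x, a x + ENNReal.ofReal (Z x) * b x ∂P := by
        refine lintegral_mono fun x => ?_
        calc δ * ENNReal.ofReal (min 1 (Z x)) ≤ (a x + b x) * ENNReal.ofReal (min 1 (Z x)) := by
              gcongr; exact hδ x
          _ = a x * ENNReal.ofReal (min 1 (Z x)) + ENNReal.ofReal (min 1 (Z x)) * b x := by ring
          _ ≤ a x * 1 + ENNReal.ofReal (Z x) * b x := by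
              gcongr
              · exact ENNReal.ofReal_le_one.2 (min_le_left _ _)
              · exact min_le_right _ _
          _ = _ := by rw [mul_one]
    _ = _ := lintegral_add_left ha _

/-- Flipping coordinate `k` is an involution of the cube, so summing the pairwise bound over all
vertices counts each coordinate risk twice. Averaging over vertices then bounds the worst total risk
by the sum over coordinates. -/
theorem assouad {Ω K : Type*} [MeasurableSpace Ω] [Fintype K] [DecidableEq K]
    (P : (K → Bool) → Measure Ω) (a : K → Bool → Ω → ℝ≥0∞) (ham : ∀ k b, Measurable (a k b))
    {δ R : ℝ≥0∞}
    (hpair : ∀ s k, δ / 2 ≤ ∫⁻ x, a k (s k) x ∂(P s) +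
      ∫⁻ x, a k (!(s k)) x ∂(P (Function.update s k (!(s k)))))
    (hR : ∀ s, ∫⁻ x, ∑ k, a k (s k) x ∂(P s) ≤ R) :
    Fintype.card K * δ / 4 ≤ R := by
  have hflip : ∀ k, Function.Involutive (fun s : K → Bool => Function.update s k (!(s k))) := by
    intro k s
    simp
  have h1 : ∀ k, ∑ s : K → Bool, δ / 2 ≤ 2 * ∑ s : K → Bool, ∫⁻ x, a k (s k) x ∂(P s) := by
    intro k
    rw [two_mul]
    -- One of the two copies is reindexed by the flip, which lines up its terms with the second law
    -- in `hpair`.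
    nth_rw 2 [← Equiv.sum_comp (hflip k).toPerm]
    rw [← Finset.sum_add_distrib]
    refine Finset.sum_le_sum fun s _ => (hpair s k).trans (le_of_eq ?_)
    rw [add_comm]
    simp
  have h2 : ∑ s : K → Bool, ∑ k, ∫⁻ x, a k (s k) x ∂(P s) ≤ ∑ _s : K → Bool, R := by
    refine Finset.sum_le_sum fun s _ => ?_
    rw [← lintegral_finsetSum _ (fun k _ => ham k _)]
    exact hR s
  have h3 : ∑ _k : K, ∑ _s : K → Bool, δ / 2 ≤ 2 * ∑ _s : K → Bool, R := by
    calc _ ≤ ∑ k : K, 2 * ∑ s : K → Bool, ∫⁻ x, a k (s k) x ∂(P s) :=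
          Finset.sum_le_sum fun k _ => h1 k
      _ = 2 * ∑ s : K → Bool, ∑ k, ∫⁻ x, a k (s k) x ∂(P s) := by
          rw [← Finset.mul_sum, Finset.sum_comm]
      _ ≤ _ := by gcongr
  simp only [Finset.sum_const, Finset.card_univ, nsmul_eq_mul] at h3
  set N : ℝ≥0∞ := ((Fintype.card (K → Bool) : ℕ) : ℝ≥0∞) with hN
  have hN0 : N ≠ 0 := by
    rw [hN]; exact_mod_cast Fintype.card_ne_zero
  have hNt : N ≠ ∞ := ENNReal.natCast_ne_top _
  have h4 : N * (Fintype.card K * (δ / 2)) ≤ N * (2 * R) := by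
    calc _ = (Fintype.card K : ℝ≥0∞) * (N * (δ / 2)) := by ring
      _ ≤ 2 * (N * R) := h3
      _ = _ := by ring
  have h5 : (Fintype.card K * (δ / 2) : ℝ≥0∞) ≤ 2 * R :=
    (ENNReal.mul_le_mul_iff_right hN0 hNt).1 h4
  rw [ENNReal.div_le_iff (by norm_num) (by norm_num)]
  calc (Fintype.card K * δ : ℝ≥0∞) = 2 * (Fintype.card K * (δ / 2)) := by
        rw [mul_left_comm, ENNReal.mul_div_cancel (by norm_num) (by norm_num)]
    _ ≤ 2 * (2 * R) := by gcongr
    _ = R * 4 := by ring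

variable {D : ℕ}

/-- The density ratio machinery: perturbations `v` of a density `p` supported where `p ≥ κ`. -/
theorem exists_ratio {p : E D → ℝ} (hp : Integrable p) (hp0 : ∀ x, 0 ≤ p x) {κ : ℝ} (hκ : 0 < κ) :
    ∃ q : E D → ℝ, Measurable q ∧ (∀ x, κ ≤ q x) ∧
      ∀ v : E D → ℝ, Measurable v → (∀ x, v x ≠ 0 → κ ≤ p x) →
        ((∀ x, |v x| ≤ κ) → law (fun x => p x + v x) =
          (law p).withDensity fun x => ENNReal.ofReal (1 + v x / q x)) ∧
        ∀ w : E D → ℝ, ∫ x, v x / q x * w x ∂(law p) = ∫ x, v x * w x := by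
  have hpm := hp.aestronglyMeasurable.aemeasurable
  -- The density `p` is only a.e. measurable and may vanish. A measurable version truncated below at
  -- `κ` is a safe denominator, and it agrees a.e. with `p` wherever `v` is nonzero.
  refine ⟨fun x => max (hpm.mk p x) κ, hpm.measurable_mk.max measurable_const,
    fun x => le_max_right _ _, fun v hv hvp => ?_⟩
  have key : ∀ᵐ x, p x * (v x / max (hpm.mk p x) κ) = v x := by
    filter_upwards [hpm.ae_eq_mk] with x hx
    rw [← hx]
    by_cases h : v x = 0
    · simp [h]
    · have := hvp x h
      rw [max_eq_left this, mul_div_cancel₀ _ (by linarith)]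
  refine ⟨fun hvκ => ?_, fun w => ?_⟩
  · rw [law, law, ← withDensity_mul₀ hpm.ennreal_ofReal
      (by have := hpm.measurable_mk; fun_prop)]
    refine withDensity_congr_ae ?_
    filter_upwards [key] with x hx
    rw [Pi.mul_apply, ← ENNReal.ofReal_mul (hp0 x), mul_add, mul_one, hx]
  · rw [law, integral_withDensity_eq_integral_toReal_smul₀ hpm.ennreal_ofReal (by simp)]
    refine integral_congr_ae ?_
    filter_upwards [key] with x hx
    rw [ENNReal.toReal_ofReal (hp0 x), smul_eq_mul, ← mul_assoc, hx]

theorem isProbabilityMeasure_law {p : E D → ℝ} (hp : Integrable p) (hp0 : ∀ x, 0 ≤ p x)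
    (hp1 : ∫ x, p x = 1) : IsProbabilityMeasure (law p) := by
  constructor
  rw [law, withDensity_apply _ MeasurableSet.univ, Measure.restrict_univ,
    ← ofReal_integral_eq_lintegral_ofReal hp (Eventually.of_forall hp0), hp1, ENNReal.ofReal_one]

/-- Two-point bound between a density and a uniform mixture of perturbations of it that have
pairwise disjoint supports. -/
theorem mixture_bound {p : E D → ℝ} (hp : Integrable p) (hp0 : ∀ x, 0 ≤ p x)
    (hp1 : ∫ x, p x = 1) {κ : ℝ} (hκ : 0 < κ) {K : Type*} [Fintype K] [Nonempty K]
    {v : K → E D → ℝ} (hv : ∀ k, Measurable (v k)) (hvp : ∀ k x, v k x ≠ 0 → κ ≤ p x)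
    (hvκ : ∀ k x, |v k x| ≤ κ) (hvi : ∀ k, Integrable (v k)) (hv0 : ∀ k, ∫ x, v k x = 0)
    (hdisj : ∀ k l, k ≠ l → ∀ x, v k x * v l x = 0) {U : ℝ} (hv2 : ∀ k, ∫ x, v k x ^ 2 ≤ U)
    {n : ℕ} (hU : (1 + U / κ) ^ n ≤ 1 + Fintype.card K / 4)
    {a : (Fin n → E D) → ℝ≥0∞} {b : (Fin n → E D) → ℝ≥0∞} (ha : Measurable a) (hb : Measurable b)
    {δ : ℝ≥0∞} (hδ : ∀ x, δ ≤ a x + b x) {R : ℝ≥0∞}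
    (hRb : ∀ k, ∫⁻ x, b x ∂(Measure.pi fun _ : Fin n => law fun y => p y + v k y) ≤ R) :
    δ / 2 ≤ ∫⁻ x, a x ∂(Measure.pi fun _ : Fin n => law p) + R := by
  have := isProbabilityMeasure_law hp hp0 hp1
  obtain ⟨q, hqm, hqκ, hq⟩ := exists_ratio hp hp0 hκ
  have hq0 : ∀ x, 0 < q x := fun x => hκ.trans_le (hqκ x)
  have hu1 : ∀ k x, |v k x / q x| ≤ 1 := fun k x => by
    rw [abs_div, abs_of_pos (hq0 x), div_le_one (hq0 x)]
    exact (hvκ k x).trans (hqκ x)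
  have hum : ∀ k, Measurable fun x => v k x / q x := fun k => (hv k).div hqm
  have hui : ∀ k, Integrable (fun x => v k x / q x) (law p) := fun k =>
    Integrable.of_bound (hum k).aestronglyMeasurable 1 (Eventually.of_forall (hu1 k))
  have huui : ∀ k l, Integrable (fun x => v k x / q x * (v l x / q x)) (law p) := fun k l =>
    Integrable.of_bound ((hum k).mul (hum l)).aestronglyMeasurable 1
      (Eventually.of_forall fun x => by
        rw [norm_mul]
        exact mul_le_one₀ (hu1 k x) (norm_nonneg _) (hu1 l x))
  have hmean : ∀ k, ∫ x, v k x / q x ∂(law p) = 0 := fun k => by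
    have := ((hq (v k) (hv k) (hvp k)).2 fun _ => 1)
    simp only [mul_one] at this
    rw [this, hv0]
  have hcov : ∀ k l, k ≠ l → ∫ x, v k x / q x * (v l x / q x) ∂(law p) = 0 := fun k l hkl => by
    have : ∀ x, v k x / q x * (v l x / q x) = 0 := fun x => by
      rw [div_mul_div_comm, hdisj k l hkl x, zero_div]
    simp [this]
  have hvar : ∀ k, ∫ x, v k x / q x * (v k x / q x) ∂(law p) ≤ U / κ := fun k => by
    rw [(hq (v k) (hv k) (hvp k)).2]
    have hsq : Integrable fun x => v k x ^ 2 := by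
      have := (hvi k).bdd_mul (hv k).aestronglyMeasurable (c := κ) (Eventually.of_forall (hvκ k))
      simpa [sq] using this
    calc ∫ x, v k x * (v k x / q x) ≤ ∫ x, v k x ^ 2 / κ := by
          refine integral_mono_of_nonneg (Eventually.of_forall fun x => ?_) (hsq.div_const κ)
            (Eventually.of_forall fun x => ?_)
          · have := hq0 x
            show 0 ≤ v k x * (v k x / q x)
            rw [← mul_div_assoc]
            exact div_nonneg (mul_self_nonneg _) this.le
          · show v k x * (v k x / q x) ≤ v k x ^ 2 / κ
            rw [← mul_div_assoc, ← sq]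
            exact div_le_div_of_nonneg_left (sq_nonneg _) hκ (hqκ x)
      _ = (∫ x, v k x ^ 2) / κ := integral_div _ _
      _ ≤ U / κ := by gcongr; exact hv2 k
  set P := Measure.pi fun _ : Fin n => law p
  -- `Z k` is the likelihood ratio of `n` observations from the `k`-th perturbation against `p`.
  set Z : K → (Fin n → E D) → ℝ := fun k x => ∏ i, (1 + v k (x i) / q (x i)) with hZdef
  have hZm : ∀ k, Measurable (Z k) := fun k =>
    Finset.measurable_fun_prod _ fun i _ => measurable_const.add
      ((hum k).comp (measurable_pi_apply i))
  have hfac : ∀ k x, 0 ≤ 1 + v k x / q x ∧ 1 + v k x / q x ≤ 2 := fun k x => by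
    have := abs_le.1 (hu1 k x); constructor <;> linarith
  have hZ0 : ∀ k x, 0 ≤ Z k x := fun k x => Finset.prod_nonneg fun i _ => (hfac k _).1
  have hZC : ∀ k x, Z k x ≤ 2 ^ n := fun k x => by
    calc Z k x ≤ ∏ _i : Fin n, (2 : ℝ) :=
          Finset.prod_le_prod (fun i _ => (hfac k _).1) (fun i _ => (hfac k _).2)
      _ = 2 ^ n := by simp
  have hZi : ∀ k, Integrable (Z k) P := fun k =>
    Integrable.of_bound (hZm k).aestronglyMeasurable (2 ^ n) (Eventually.of_forall fun x => by
      rw [Real.norm_of_nonneg (hZ0 k x)]; exact hZC k x)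
  have hZZi : ∀ k l, Integrable (fun x => Z k x * Z l x) P := fun k l =>
    (hZi l).bdd_mul (hZm k).aestronglyMeasurable (c := 2 ^ n) (Eventually.of_forall fun x => by
      rw [Real.norm_of_nonneg (hZ0 k x)]; exact hZC k x)
  have hZ1 : ∀ k, ∫ x, Z k x ∂P = 1 := fun k => by
    rw [hZdef]
    dsimp only
    rw [integral_fintype_prod_eq_prod (f := fun (_ : Fin n) y => 1 + v k y / q y),
      Finset.prod_eq_one]
    intro i _
    rw [integral_add (integrable_const _) (hui k), hmean k]
    simp
  have hZZ : ∀ k l, ∫ x, Z k x * Z l x ∂P =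
      (1 + ∫ x, v k x / q x * (v l x / q x) ∂(law p)) ^ n := fun k l => by
    rw [hZdef]
    dsimp only
    simp_rw [← Finset.prod_mul_distrib]
    rw [integral_fintype_prod_eq_prod
      (f := fun (_ : Fin n) y => (1 + v k y / q y) * (1 + v l y / q y)),
      Finset.prod_const, Finset.card_univ, Fintype.card_fin]
    congr 1
    have : ∀ y, (1 + v k y / q y) * (1 + v l y / q y) =
        1 + v k y / q y + v l y / q y + v k y / q y * (v l y / q y) := fun y => by ring
    simp_rw [this]
    have i1 : Integrable (fun y => 1 + v k y / q y) (law p) := (integrable_const _).add (hui k)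
    have i2 : Integrable (fun y => 1 + v k y / q y + v l y / q y) (law p) := i1.add (hui l)
    rw [integral_add i2 (huui k l), integral_add i1 (hui l),
      integral_add (integrable_const _) (hui k), hmean, hmean]
    simp
  set M : ℝ := (Fintype.card K : ℝ) with hM
  have hM0 : 0 < M := by rw [hM]; exact_mod_cast Fintype.card_pos
  have hMnn : 0 ≤ M⁻¹ := by positivity
  -- Each row of the Gram matrix of the ratios has a diagonal entry at most `1 + M/4` and `M - 1`
  -- off-diagonal entries equal to `1`, by disjointness of supports. Hence the averaged ratio has
  -- second moment at most `5/4`.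
  have hsumle : ∀ k, ∑ l, ∫ x, Z k x * Z l x ∂P ≤ M * (5 / 4) := fun k => by
    classical
    rw [← Finset.add_sum_erase _ _ (Finset.mem_univ k)]
    have h1 : ∫ x, Z k x * Z k x ∂P ≤ 1 + M / 4 := by
      rw [hZZ]
      refine le_trans ?_ hU
      refine pow_le_pow_left₀ ?_ (by linarith [hvar k]) n
      have : 0 ≤ ∫ x, v k x / q x * (v k x / q x) ∂(law p) :=
        integral_nonneg fun x => mul_self_nonneg _
      linarith
    have h2 : ∑ l ∈ Finset.univ.erase k, ∫ x, Z k x * Z l x ∂P = M - 1 := by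
      rw [Finset.sum_congr rfl (g := fun _ => (1 : ℝ))]
      · rw [Finset.sum_const, Finset.card_erase_of_mem (Finset.mem_univ k), Finset.card_univ,
          nsmul_eq_mul, mul_one, Nat.cast_pred Fintype.card_pos]
      · intro l hl
        rw [hZZ, hcov k l (Finset.ne_of_mem_erase hl).symm]
        simp
    rw [h2]; linarith
  have main := half_le_of_second_moment P (Z := fun x => M⁻¹ * ∑ k, Z k x) (C := 2 ^ n)
    (measurable_const.mul (Finset.measurable_fun_sum _ fun k _ => hZm k))
    (fun x => mul_nonneg hMnn (Finset.sum_nonneg fun k _ => hZ0 k x))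
    (fun x => by
      rw [inv_mul_le_iff₀ hM0]
      calc ∑ k, Z k x ≤ ∑ _k : K, (2 : ℝ) ^ n := Finset.sum_le_sum fun k _ => hZC k x
        _ = M * 2 ^ n := by simp [hM])
    (by
      rw [integral_const_mul, integral_finsetSum _ fun k _ => hZi k]
      simp [hZ1, ← hM, hM0.ne'])
    (by
      have : ∀ x, (M⁻¹ * ∑ k, Z k x) ^ 2 = M⁻¹ * (M⁻¹ * ∑ k, ∑ l, Z k x * Z l x) := fun x => by
        rw [mul_pow, sq, sq, Finset.sum_mul_sum]; ring
      simp_rw [this]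
      rw [integral_const_mul, integral_const_mul,
        integral_finsetSum _ fun k _ => integrable_finsetSum _ fun l _ => hZZi k l]
      simp_rw [integral_finsetSum _ fun l _ => hZZi _ l]
      rw [inv_mul_le_iff₀ hM0, inv_mul_le_iff₀ hM0]
      calc _ ≤ ∑ _k : K, M * (5 / 4) := Finset.sum_le_sum fun k _ => hsumle k
        _ = M * (M * (5 / 4)) := by simp [hM])
    ha hδ
  have hpert : ∀ k, ∫⁻ x, b x ∂(Measure.pi fun _ : Fin n => law fun y => p y + v k y) =
      ∫⁻ x, ENNReal.ofReal (Z k x) * b x ∂P := fun k => by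
    have hlaw := (hq (v k) (hv k) (hvp k)).1 (hvκ k)
    have hprob : IsProbabilityMeasure (law fun x => p x + v k x) := by
      refine isProbabilityMeasure_law (hp.add (hvi k)) (fun x => ?_) ?_
      · by_cases h : v k x = 0
        · simpa [h] using hp0 x
        · linarith [hvp k x h, (abs_le.1 (hvκ k x)).1]
      · rw [integral_add hp (hvi k), hp1, hv0 k, add_zero]
    have hfin : IsProbabilityMeasure
      ((law p).withDensity fun x => ENNReal.ofReal (1 + v k x / q x)) := hlaw ▸ hprob
    rw [hlaw, pi_withDensity (law p) (by have := hum k; fun_prop) n,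
      lintegral_withDensity_eq_lintegral_mul _ ?_ hb]
    · refine lintegral_congr fun x => ?_
      rw [Pi.mul_apply, ENNReal.ofReal_prod_of_nonneg fun i _ => (hfac k _).1]
    · refine Finset.measurable_fun_prod _ fun i _ => ?_
      exact (measurable_const.add ((hum k).comp (measurable_pi_apply i))).ennreal_ofReal
  have hmix : ∫⁻ x, ENNReal.ofReal (M⁻¹ * ∑ k, Z k x) * b x ∂P ≤ R := by
    have e : ∀ x, ENNReal.ofReal (M⁻¹ * ∑ k, Z k x) * b x =
        ENNReal.ofReal M⁻¹ * ∑ k, ENNReal.ofReal (Z k x) * b x := fun x => by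
      rw [ENNReal.ofReal_mul hMnn, ENNReal.ofReal_sum_of_nonneg fun k _ => hZ0 k x,
        Finset.sum_mul .. |>.symm, mul_assoc]
    simp_rw [e]
    have hZb : ∀ k, Measurable fun x => ENNReal.ofReal (Z k x) * b x := fun k =>
      (hZm k).ennreal_ofReal.mul hb
    rw [lintegral_const_mul _ (Finset.measurable_fun_sum _ fun k _ => hZb k),
      lintegral_finsetSum _ fun k _ => hZb k]
    calc _ ≤ ENNReal.ofReal M⁻¹ * ∑ _k : K, R := by
          gcongr with k; rw [← hpert k]; exact hRb k
      _ = ENNReal.ofReal M⁻¹ * ENNReal.ofReal M * R := by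
          rw [Finset.sum_const, Finset.card_univ, nsmul_eq_mul, hM, ENNReal.ofReal_natCast,
            mul_assoc]
      _ = R := by
          rw [← ENNReal.ofReal_mul hMnn, inv_mul_cancel₀ hM0.ne', ENNReal.ofReal_one, one_mul]
  exact main.trans (add_le_add le_rfl hmix)

end

/-! ### Taylor expansion and vanishing moments. -/

section Taylor

theorem integrable_mul_compact {V : Type*} [TopologicalSpace V] [MeasurableSpace V]
    [OpensMeasurableSpace V] (μ : Measure V) [IsFiniteMeasureOnCompacts μ]
    {η : V → ℝ} (hη : Continuous η) (hηc : HasCompactSupport η)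
    {g : V → ℝ} (hg : Continuous g) : Integrable (fun z => g z * η z) μ :=
  (hg.mul hη).integrable_of_hasCompactSupport hηc.mul_left

variable {V : Type*} [NormedAddCommGroup V] [NormedSpace ℝ V]

/-- The `i`-th derivative of `f` at `x` in the direction `z`. -/
def dirDeriv (i : ℕ) (f : V → ℝ) (x z : V) : ℝ := iteratedFDeriv ℝ i f x fun _ => z

theorem dirDeriv_zero (f : V → ℝ) (x z : V) : dirDeriv 0 f x z = f x := by
  simp [dirDeriv]

theorem iteratedDeriv_line {f : V → ℝ} {i : ℕ} (hf : ContDiff ℝ i f) (x z : V) (t : ℝ) :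
    iteratedDeriv i (fun t : ℝ => f (x + t • z)) t = dirDeriv i f (x + t • z) z := by
  have h1 : (fun t : ℝ => f (x + t • z)) =
      (fun y => f (x + y)) ∘ (ContinuousLinearMap.toSpanSingleton ℝ z) := by
    ext t; simp
  rw [iteratedDeriv_eq_iteratedFDeriv, h1,
    ContinuousLinearMap.iteratedFDeriv_comp_right _ (n := i) (by fun_prop) _ le_rfl,
    iteratedFDeriv_comp_add_left]
  simp [dirDeriv, ContinuousMultilinearMap.compContinuousLinearMap_apply]

theorem abs_dirDeriv_le {f : V → ℝ} {i : ℕ} {C : ℝ} (hC : ∀ x, ‖iteratedFDeriv ℝ i f x‖ ≤ C)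
    (x z : V) : |dirDeriv i f x z| ≤ C * ‖z‖ ^ i := by
  calc |dirDeriv i f x z| ≤ ‖iteratedFDeriv ℝ i f x‖ * ∏ _j : Fin i, ‖z‖ :=
        (iteratedFDeriv ℝ i f x).le_opNorm fun _ => z
    _ ≤ C * ‖z‖ ^ i := by
        rw [Finset.prod_const, Finset.card_univ, Fintype.card_fin]
        gcongr
        exact hC x

theorem continuous_dirDeriv {f : V → ℝ} {i : ℕ} (hf : ContDiff ℝ i f) :
    Continuous fun q : V × V => dirDeriv i f q.1 q.2 := by
  have h1 := hf.continuous_iteratedFDeriv'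
  have h2 : Continuous fun q : V × V => (iteratedFDeriv ℝ i f q.1, fun _ : Fin i => q.2) := by
    fun_prop
  exact continuous_eval.comp h2

theorem dirDeriv_smul (i : ℕ) (f : V → ℝ) (x z : V) (c : ℝ) :
    dirDeriv i f x (c • z) = c ^ i * dirDeriv i f x z := by
  simp [dirDeriv, ContinuousMultilinearMap.map_smul_univ]

/-- The Taylor polynomial with terms of degree `< l`. -/
def taylorPoly (l : ℕ) (f : V → ℝ) (x z : V) : ℝ :=
  ∑ i ∈ Finset.range l, (i.factorial : ℝ)⁻¹ * dirDeriv i f x z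

/-- Restriction to a line reduces Taylor expansion to one variable. The set `s` is left free because
the Lagrange form uses a segment and the Peano form the whole line. -/
theorem taylorWithinEval_line {f : V → ℝ} {l : ℕ} (hf : ContDiff ℝ l f) (x z : V) {s : Set ℝ}
    (hs : UniqueDiffOn ℝ s) (h0 : (0 : ℝ) ∈ s) (t : ℝ) :
    taylorWithinEval (fun t : ℝ => f (x + t • z)) l s 0 t = taylorPoly (l + 1) f x (t • z) := by
  rw [taylor_within_apply, taylorPoly]
  refine Finset.sum_congr rfl fun i hi => ?_
  have hil : (i : WithTop ℕ∞) ≤ l := by exact_mod_cast Finset.mem_range_succ_iff.1 hi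
  have hline : ContDiff ℝ i (fun t : ℝ => f (x + t • z)) := by
    have := hf.of_le hil
    fun_prop
  rw [iteratedDerivWithin_eq_iteratedDeriv hs hline.contDiffAt h0,
    iteratedDeriv_line (hf.of_le hil), dirDeriv_smul]
  simp; ring

/-- This is the Lagrange remainder along the segment from `x` to `x + z`, with `1/l!` discarded. For
`l = 0` the polynomial is empty and the bound is that of `f` itself. -/
theorem abs_sub_taylorPoly_le {f : V → ℝ} {l : ℕ} (hf : ContDiff ℝ l f) {C : ℝ}
    (hC : ∀ x, ‖iteratedFDeriv ℝ l f x‖ ≤ C) (x z : V) :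
    |f (x + z) - taylorPoly l f x z| ≤ C * ‖z‖ ^ l := by
  have hC0 : 0 ≤ C := (norm_nonneg _).trans (hC 0)
  rcases l with _ | n
  · have := hC (x + z)
    simpa [taylorPoly] using this
  · have hf' : ContDiff ℝ n f := hf.of_le (by exact_mod_cast n.le_succ)
    have hline : ContDiff ℝ (n + 1 : ℕ) (fun t : ℝ => f (x + t • z)) := by fun_prop
    obtain ⟨t, -, ht⟩ := taylor_mean_remainder_lagrange_iteratedDeriv (x := 1) (x₀ := 0) (n := n)
      zero_ne_one (f := fun t : ℝ => f (x + t • z)) (by exact_mod_cast hline.contDiffOn)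
    rw [taylorWithinEval_line hf' x z (uniqueDiffOn_uIcc zero_ne_one) (by simp),
      iteratedDeriv_line hf] at ht
    simp only [one_smul, sub_zero, one_pow, mul_one] at ht
    rw [ht, abs_div]
    calc _ ≤ |dirDeriv (n + 1) f (x + t • z) z| := by
          refine div_le_self (abs_nonneg _) ?_
          rw [Nat.abs_cast]
          exact_mod_cast Nat.one_le_iff_ne_zero.2 (Nat.factorial_ne_zero _)
      _ ≤ _ := abs_dirDeriv_le hC _ _

/-- This is the Peano form of the remainder. It needs no derivative beyond order `l`, so the moment
argument reaches the top order `r`. -/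
theorem tendsto_taylor_remainder {f : V → ℝ} {l : ℕ} (hf : ContDiff ℝ l f) (x z : V) {u : ℕ → ℝ}
    (hu : Tendsto u atTop (𝓝 0)) (hu0 : ∀ j, u j ≠ 0) :
    Tendsto (fun j => (u j ^ l)⁻¹ * (f (x + u j • z) - taylorPoly l f x (u j • z))) atTop
      (𝓝 ((l.factorial : ℝ)⁻¹ * dirDeriv l f x z)) := by
  have hline : ContDiff ℝ l (fun t : ℝ => f (x + t • z)) := by fun_prop
  have h := (taylor_tendsto (s := Set.univ) (x₀ := 0) convex_univ trivial hline.contDiffOn)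
  rw [nhdsWithin_univ] at h
  have h2 := (h.comp hu).add_const ((l.factorial : ℝ)⁻¹ * dirDeriv l f x z)
  rw [zero_add] at h2
  refine h2.congr fun j => ?_
  have := hu0 j
  simp only [Function.comp, sub_zero, smul_eq_mul]
  rw [taylorWithinEval_line hf x z uniqueDiffOn_univ trivial, taylorPoly, Finset.sum_range_succ,
    ← taylorPoly, dirDeriv_smul]
  field_simp
  ring

theorem continuous_taylorPoly {f : V → ℝ} {l : ℕ} (hf : ContDiff ℝ l f) (x : V) (ε : ℝ) :
    Continuous fun z => taylorPoly l f x (ε • z) := by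
  refine continuous_finsetSum _ fun i hi => continuous_const.mul ?_
  have h := continuous_dirDeriv (hf.of_le (m := i)
    (by exact_mod_cast (Finset.mem_range.1 hi).le))
  exact h.comp (by fun_prop : Continuous fun z => (x, ε • z))

variable [MeasurableSpace V] [BorelSpace V] (μ : Measure V)

/-- The moment `∫ Dⁱf(x)(z,…,z) η(z) dz`. -/
def taylorMoment (i : ℕ) (f η : V → ℝ) (x : V) : ℝ := ∫ z, dirDeriv i f x z * η z ∂μ

variable [IsFiniteMeasureOnCompacts μ]

theorem integral_taylorPoly {f η : V → ℝ} {l : ℕ} (hf : ContDiff ℝ l f)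
    (hη : Continuous η) (hηc : HasCompactSupport η) {x : V}
    (h0 : ∀ i < l, taylorMoment μ i f η x = 0) (ε : ℝ) :
    ∫ z, taylorPoly l f x (ε • z) * η z ∂μ = 0 := by
  simp_rw [taylorPoly, Finset.sum_mul, dirDeriv_smul]
  have hcont : ∀ i ∈ Finset.range l, Continuous fun z => dirDeriv i f x z := fun i hi =>
    (continuous_dirDeriv (hf.of_le (by exact_mod_cast (Finset.mem_range.1 hi).le))).comp
      (Continuous.prodMk_right x)
  rw [integral_finsetSum]
  · refine Finset.sum_eq_zero fun i hi => ?_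
    have := h0 i (Finset.mem_range.1 hi)
    rw [taylorMoment] at this
    simp_rw [mul_assoc]
    rw [integral_const_mul, integral_const_mul, this]
    simp
  · intro i hi
    refine integrable_mul_compact μ hη hηc (g := fun z => (i.factorial : ℝ)⁻¹ *
      (ε ^ i * dirDeriv i f x z)) ?_
    have := hcont i hi
    fun_prop

/-- A kernel with vanishing moments against `f` up to order `l - 1` pairs with `f` at scale `ε`
to order `ε ^ l`. -/
theorem abs_integral_le_of_moments {f η : V → ℝ} {l : ℕ} (hf : ContDiff ℝ l f) {C : ℝ}
    (hC : ∀ x, ‖iteratedFDeriv ℝ l f x‖ ≤ C) (hη : Continuous η) (hηc : HasCompactSupport η)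
    (h0 : ∀ i < l, ∀ x, taylorMoment μ i f η x = 0) {ε : ℝ} (hε : 0 ≤ ε) (x : V) :
    |∫ z, f (x + ε • z) * η z ∂μ| ≤ C * (∫ z, ‖z‖ ^ l * |η z| ∂μ) * ε ^ l := by
  have hfc : Continuous f := hf.continuous
  -- The vanishing moments make the Taylor polynomial integrate to zero against `η`, so it can be
  -- subtracted freely.
  have h1 : ∫ z, f (x + ε • z) * η z ∂μ =
      ∫ z, (f (x + ε • z) - taylorPoly l f x (ε • z)) * η z ∂μ := by
    simp_rw [sub_mul]
    rw [integral_sub (integrable_mul_compact μ hη hηc (by fun_prop))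
      (integrable_mul_compact μ hη hηc (continuous_taylorPoly hf x ε)),
      integral_taylorPoly μ hf hη hηc (fun i hi => h0 i hi x), sub_zero]
  rw [h1, mul_right_comm, ← integral_const_mul]
  refine (abs_integral_le_integral_abs).trans (integral_mono_of_nonneg
    (Eventually.of_forall fun z => abs_nonneg _) ?_ (Eventually.of_forall fun z => ?_))
  · exact (integrable_mul_compact μ hη.abs (hηc.comp_left abs_zero) (by fun_prop)).const_mul _
  · have := abs_sub_taylorPoly_le hf hC x (ε • z)
    rw [norm_smul, Real.norm_of_nonneg hε, mul_pow] at this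
    dsimp only
    rw [abs_mul]
    calc _ ≤ (C * (ε ^ l * ‖z‖ ^ l)) * |η z| := by gcongr
      _ = _ := by ring

theorem continuous_taylorMoment {f η : V → ℝ} {l : ℕ} (hf : ContDiff ℝ l f)
    (hη : Continuous η) (hηc : HasCompactSupport η) : Continuous (taylorMoment μ l f η) := by
  rw [← continuousOn_univ]
  refine continuousOn_integral_of_compact_support (k := tsupport η) hηc ?_ ?_
  · have := continuous_dirDeriv hf
    refine Continuous.continuousOn ?_
    exact this.mul (hη.comp continuous_snd)
  · intro p z _ hz
    rw [image_eq_zero_of_notMem_tsupport hz, mul_zero]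

/-- If `η` is orthogonal to the dilates of `f` around a dense set of centres, at all small dyadic
scales, then its moments against the derivatives of `f` vanish. -/
theorem taylorMoment_eq_zero_of_dyadic {f η : V → ℝ} {r : ℕ} (hf : ContDiff ℝ r f)
    (hfc : HasCompactSupport f) (hη : Continuous η) (hηc : HasCompactSupport η)
    {S : Set V} (hS : Dense S)
    (hort : ∀ x ∈ S, ∀ᶠ j : ℕ in atTop, ∫ z, f (x + ((2 : ℝ)⁻¹ ^ j) • z) * η z ∂μ = 0) :
    ∀ l ≤ r, ∀ x, taylorMoment μ l f η x = 0 := by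
  intro l
  induction l using Nat.strong_induction_on with
  | _ l ih =>
  intro hl
  have hfl : ContDiff ℝ l f := hf.of_le (by exact_mod_cast hl)
  -- The moment is continuous in the centre, so a dense set of centres is enough.
  suffices h : ∀ x ∈ S, taylorMoment μ l f η x = 0 by
    have := (continuous_taylorMoment μ hfl hη hηc).ext_on hS continuous_const (g := fun _ => 0) h
    exact fun x => congrFun this x
  intro x hx
  obtain ⟨C, hC⟩ := (hfl.continuous_iteratedFDeriv').bounded_above_of_compact_support
    (hfc.iteratedFDeriv l)
  set u : ℕ → ℝ := fun j => (2 : ℝ)⁻¹ ^ j with hu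
  have hupos : ∀ j, 0 < u j := fun j => by positivity
  have hut : Tendsto u atTop (𝓝 0) :=
    tendsto_pow_atTop_nhds_zero_of_lt_one (by norm_num) (by norm_num)
  have hcont : Continuous f := hf.continuous
  -- With the lower moments already zero, the pairing at scale `u j` is that of the Taylor
  -- remainder. Divided by `u j ^ l`, it converges to the `l`-th moment over `l!`, while
  -- orthogonality makes it eventually zero.
  have hlim : Tendsto (fun j => ∫ z, ((u j ^ l)⁻¹ *
      (f (x + u j • z) - taylorPoly l f x (u j • z))) * η z ∂μ) atTop
      (𝓝 (∫ z, ((l.factorial : ℝ)⁻¹ * dirDeriv l f x z) * η z ∂μ)) := by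
    refine tendsto_integral_of_dominated_convergence (fun z => C * ‖z‖ ^ l * |η z|) ?_ ?_ ?_ ?_
    · intro j
      refine (integrable_mul_compact μ hη hηc (g := fun z => (u j ^ l)⁻¹ *
        (f (x + u j • z) - taylorPoly l f x (u j • z))) ?_).aestronglyMeasurable
      have := continuous_taylorPoly hfl x (u j)
      fun_prop
    · exact integrable_mul_compact μ hη.abs (hηc.comp_left abs_zero) (by fun_prop)
    · intro j
      refine Eventually.of_forall fun z => ?_
      have := abs_sub_taylorPoly_le hfl hC x (u j • z)
      rw [norm_smul, Real.norm_of_nonneg (hupos j).le, mul_pow] at this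
      rw [Real.norm_eq_abs, abs_mul, abs_mul, abs_inv, abs_of_pos (pow_pos (hupos j) l)]
      refine mul_le_mul_of_nonneg_right ?_ (abs_nonneg _)
      rw [inv_mul_le_iff₀ (pow_pos (hupos j) l)]
      calc _ ≤ _ := this
        _ = _ := by ring
    · exact Eventually.of_forall fun z =>
        (tendsto_taylor_remainder hfl x z hut fun j => (hupos j).ne').mul_const _
  have hzero : ∀ᶠ j in atTop, ∫ z, ((u j ^ l)⁻¹ *
      (f (x + u j • z) - taylorPoly l f x (u j • z))) * η z ∂μ = 0 := by
    filter_upwards [hort x hx] with j hj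
    simp_rw [mul_assoc, sub_mul]
    rw [integral_const_mul, integral_sub (integrable_mul_compact μ hη hηc (by fun_prop))
      (integrable_mul_compact μ hη hηc (continuous_taylorPoly hfl x (u j))),
      integral_taylorPoly μ hfl hη hηc (fun i hi => ih i hi (hi.le.trans hl) x)]
    rw [show ∫ z, f (x + u j • z) * η z ∂μ = 0 from hj]
    simp
  have := tendsto_nhds_unique (hlim.congr' hzero) tendsto_const_nhds
  simp_rw [mul_assoc] at this
  rw [integral_const_mul] at this
  exact (mul_eq_zero.1 this).resolve_left (by positivity)

end Taylor

/-! ### Integration by parts and transfer of vanishing moments. -/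

section Parts

variable {V : Type*} [NormedAddCommGroup V] [NormedSpace ℝ V]

/-- Written as an iterated first-order derivative in one fixed direction, the higher derivative can
be moved across an integral one order at a time. -/
theorem dirDeriv_eq_iterate (z : V) {f : V → ℝ} {i : ℕ} (hf : ContDiff ℝ i f) :
    (fun x => dirDeriv i f x z) = (fun (g : V → ℝ) x => fderiv ℝ g x z)^[i] f := by
  induction i with
  | zero => ext x; simp [dirDeriv_zero]
  | succ n ih =>
    rw [Function.iterate_succ_apply', ← ih (hf.of_le (by exact_mod_cast n.le_succ))]
    ext x
    have hd : DifferentiableAt ℝ (iteratedFDeriv ℝ n f) x :=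
      (hf.differentiable_iteratedFDeriv (by exact_mod_cast n.lt_succ_self)) x
    simp only [dirDeriv, iteratedFDeriv_succ_apply_left]
    rw [fderiv_continuousMultilinear_apply_const_apply hd]
    rfl

theorem contDiff_iterate_fderiv (z : V) {f : V → ℝ} {m i : ℕ} (hf : ContDiff ℝ (m + i : ℕ) f) :
    ContDiff ℝ m ((fun (g : V → ℝ) x => fderiv ℝ g x z)^[i] f) := by
  induction i generalizing m with
  | zero => simpa using hf
  | succ n ih =>
    rw [Function.iterate_succ_apply']
    have := ih (m := m + 1) (by convert hf using 2; ring)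
    exact ContDiff.clm_apply (this.fderiv_right (by norm_cast)) contDiff_const

theorem hasCompactSupport_fderiv_apply (z : V) {f : V → ℝ} (hf : HasCompactSupport f) :
    HasCompactSupport fun x => fderiv ℝ f x z := by
  have := hf.fderiv (𝕜 := ℝ)
  exact this.comp_left (g := fun L : V →L[ℝ] ℝ => L z) (by simp)

theorem dirDeriv_comp_sub_smul {w : V → ℝ} {i : ℕ} (hw : ContDiff ℝ i w) (x y z : V) (δ : ℝ) :
    dirDeriv i (fun y => w (x - δ • y)) y z = (-δ) ^ i * dirDeriv i w (x - δ • y) z := by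
  have hg : ContDiff ℝ i fun y => w (x - δ • y) := by fun_prop
  have h1 := iteratedDeriv_line hg y z 0
  rw [zero_smul, add_zero] at h1
  have h2 := iteratedDeriv_line hw (x - δ • y) z 0
  rw [zero_smul, add_zero] at h2
  have h3 : (fun t : ℝ => w (x - δ • (y + t • z))) =
      fun t => (fun s : ℝ => w (x - δ • y + s • z)) (-δ * t) := by
    ext t; congr 1; rw [smul_add, neg_mul, neg_smul, mul_smul]; abel
  have h4 : ContDiff ℝ i fun s : ℝ => w (x - δ • y + s • z) := by fun_prop
  rw [← h1, h3, iteratedDeriv_comp_const_mul h4]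
  simp [h2]

variable [MeasurableSpace V] [BorelSpace V] [FiniteDimensional ℝ V] (μ : Measure V)
  [μ.IsAddHaarMeasure]

theorem integral_mul_iterate_fderiv (z : V) {f g : V → ℝ} {i : ℕ} (hf : ContDiff ℝ i f)
    (hfc : HasCompactSupport f) (hg : ContDiff ℝ i g) :
    ∫ x, f x * (fun (g : V → ℝ) x => fderiv ℝ g x z)^[i] g x ∂μ =
      (-1) ^ i * ∫ x, (fun (g : V → ℝ) x => fderiv ℝ g x z)^[i] f x * g x ∂μ := by
  induction i generalizing f with
  | zero => simp
  | succ n ih =>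
    rw [Function.iterate_succ_apply', Function.iterate_succ_apply]
    set G := (fun (g : V → ℝ) x => fderiv ℝ g x z)^[n] g
    have hG : ContDiff ℝ (1 : ℕ) G := contDiff_iterate_fderiv z (by convert hg using 2; ring)
    have hf1 : ContDiff ℝ n (fun x => fderiv ℝ f x z) :=
      ContDiff.clm_apply (hf.fderiv_right (by norm_cast)) contDiff_const
    have hG1 : Continuous fun x => fderiv ℝ G x z :=
      (hG.continuous_fderiv (by simp)).clm_apply continuous_const
    have hfc1 := hasCompactSupport_fderiv_apply z hfc
    rw [integral_mul_fderiv_eq_neg_fderiv_mul_of_integrable]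
    · rw [ih hf1 hfc1 (hg.of_le (by exact_mod_cast n.le_succ))]
      ring
    · simpa only [mul_comm] using integrable_mul_compact μ hf1.continuous hfc1 hG.continuous
    · simpa only [mul_comm] using integrable_mul_compact μ hf.continuous hfc hG1
    · simpa only [mul_comm] using integrable_mul_compact μ hf.continuous hfc hG.continuous
    · exact fun x _ => (hf.differentiable (by simp)) x
    · exact fun x _ => (hG.differentiable (by simp)) x

theorem integral_mul_dirDeriv (z : V) {f g : V → ℝ} {i : ℕ} (hf : ContDiff ℝ i f)
    (hfc : HasCompactSupport f) (hg : ContDiff ℝ i g) :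
    ∫ x, f x * dirDeriv i g x z ∂μ = (-1) ^ i * ∫ x, dirDeriv i f x z * g x ∂μ := by
  have := integral_mul_iterate_fderiv μ z hf hfc hg
  rwa [← dirDeriv_eq_iterate z hf, ← dirDeriv_eq_iterate z hg] at this

/-- Vanishing moments against one function with nonzero integral imply vanishing moments against
every smooth function. -/
theorem taylorMoment_eq_zero_of_integral_ne_zero {f η w : V → ℝ} {l : ℕ} (hf : ContDiff ℝ l f)
    (hfc : HasCompactSupport f) (hf0 : ∫ x, f x ∂μ ≠ 0) (hη : Continuous η)
    (hηc : HasCompactSupport η) (h0 : ∀ x, taylorMoment μ l f η x = 0) (hw : ContDiff ℝ l w)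
    (x : V) : taylorMoment μ l w η x = 0 := by
  have hwd := continuous_dirDeriv hw
  have hfd := continuous_dirDeriv hf
  have hwc := hw.continuous
  have hfcont := hf.continuous
  -- `H δ` smooths the moment of `w` by `f` at scale `δ`. At `δ = 0` it equals the moment at `x`
  -- times `∫ f`.
  set H : ℝ → ℝ := fun δ => ∫ y, f y * taylorMoment μ l w η (x - δ • y) ∂μ with hH
  have hHc : Continuous H := by
    rw [← continuousOn_univ]
    refine continuousOn_integral_of_compact_support (k := tsupport f) hfc ?_ ?_
    · have := continuous_taylorMoment μ hw hη hηc
      refine Continuous.continuousOn ?_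
      fun_prop
    · intro p y _ hy
      rw [image_eq_zero_of_notMem_tsupport hy, zero_mul]
  have hsupp : ∀ F : V → V → ℝ, HasCompactSupport fun q : V × V => f q.1 * (F q.1 q.2 * η q.2) := by
    intro F
    refine HasCompactSupport.intro (hfc.prod hηc) fun q hq => ?_
    rw [Set.mem_prod, not_and_or] at hq
    rcases hq with h | h
    · rw [image_eq_zero_of_notMem_tsupport h, zero_mul]
    · rw [image_eq_zero_of_notMem_tsupport h, mul_zero, mul_zero]
  -- For `δ ≠ 0`, the `l` derivatives move from `w` onto `f`, at the cost of a factor `δ^{-l}`.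
  -- After Fubini the inner integrals are moments of `f` against `η`, which vanish.
  have hH0 : ∀ δ, δ ≠ 0 → H δ = 0 := by
    intro δ hδ
    have e1 : H δ = ∫ z, η z * ∫ y, f y * dirDeriv l w (x - δ • y) z ∂μ ∂μ := by
      simp_rw [hH, taylorMoment, ← integral_const_mul]
      rw [integral_integral_swap_of_hasCompactSupport]
      · refine integral_congr_ae (Eventually.of_forall fun z => ?_)
        refine integral_congr_ae (Eventually.of_forall fun y => ?_)
        dsimp only; ring
      · have : Continuous fun q : V × V => dirDeriv l w (x - δ • q.1) q.2 :=
          hwd.comp (by fun_prop : Continuous fun q : V × V => (x - δ • q.1, q.2))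
        show Continuous fun q : V × V => f q.1 * (dirDeriv l w (x - δ • q.1) q.2 * η q.2)
        fun_prop
      · exact hsupp fun y z => dirDeriv l w (x - δ • y) z
    have e2 : ∀ z, ∫ y, f y * dirDeriv l w (x - δ • y) z ∂μ =
        (δ ^ l)⁻¹ * ∫ y, dirDeriv l f y z * w (x - δ • y) ∂μ := by
      intro z
      have := integral_mul_dirDeriv μ z hf hfc
        (by fun_prop : ContDiff ℝ l fun y => w (x - δ • y))
      have e : ∀ y, f y * dirDeriv l (fun y => w (x - δ • y)) y z =
          (-δ) ^ l * (f y * dirDeriv l w (x - δ • y) z) := fun y => by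
        rw [dirDeriv_comp_sub_smul hw]; ring
      simp_rw [e] at this
      rw [integral_const_mul, neg_pow, mul_assoc] at this
      have h1 := mul_left_cancel₀ (pow_ne_zero l (by norm_num : (-1 : ℝ) ≠ 0)) this
      rw [← h1, inv_mul_cancel_left₀ (pow_ne_zero l hδ)]
    have hfdc : HasCompactSupport (iteratedFDeriv ℝ l f) := hfc.iteratedFDeriv l
    rw [e1]
    have e3 : ∀ z, η z * ∫ y, f y * dirDeriv l w (x - δ • y) z ∂μ =
        (δ ^ l)⁻¹ * ∫ y, η z * (dirDeriv l f y z * w (x - δ • y)) ∂μ := fun z => by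
      rw [e2, integral_const_mul]; ring
    simp_rw [e3]
    rw [integral_const_mul, integral_integral_swap_of_hasCompactSupport]
    · have : ∀ y, ∫ z, η z * (dirDeriv l f y z * w (x - δ • y)) ∂μ = 0 := by
        intro y
        have h := h0 y
        rw [taylorMoment] at h
        have e : ∀ z, η z * (dirDeriv l f y z * w (x - δ • y)) =
          w (x - δ • y) * (dirDeriv l f y z * η z) := fun z => by ring
        rw [integral_congr_ae (Eventually.of_forall e), integral_const_mul, h, mul_zero]
      simp_rw [this]
      simp
    · have : Continuous fun q : V × V => dirDeriv l f q.2 q.1 :=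
        hfd.comp (by fun_prop : Continuous fun q : V × V => (q.2, q.1))
      show Continuous fun q : V × V => η q.1 * (dirDeriv l f q.2 q.1 * w (x - δ • q.2))
      fun_prop
    · refine HasCompactSupport.intro (hηc.prod hfdc) fun q hq => ?_
      rw [Set.mem_prod, not_and_or] at hq
      rcases hq with h | h
      · simp [Function.uncurry, image_eq_zero_of_notMem_tsupport h]
      · simp [Function.uncurry, dirDeriv, image_eq_zero_of_notMem_tsupport h]
  -- Continuity of `H` carries its vanishing to `δ = 0`, where `∫ f` factors out.
  have hlim : H 0 = 0 := by
    have h1 : Tendsto (fun n : ℕ => H (1 / ((n : ℝ) + 1))) atTop (𝓝 (H 0)) :=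
      (hHc.tendsto 0).comp tendsto_one_div_add_atTop_nhds_zero_nat
    refine tendsto_nhds_unique h1 (tendsto_const_nhds.congr fun n => ?_)
    rw [hH0 _ (by positivity)]
  simp only [hH, zero_smul, sub_zero, integral_mul_const] at hlim
  exact (mul_eq_zero.1 hlim).resolve_left hf0

end Parts

/-! ### Orthonormal expansions and the multiresolution spaces. -/

section

section Hilbert

theorem inner_eq_zero_of_mem_closure_span {H ι : Type*} [NormedAddCommGroup H]
    [InnerProductSpace ℝ H] {u : ι → H} {w v : H} (h : ∀ i, inner ℝ w (u i) = 0)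
    (hv : v ∈ (Submodule.span ℝ (Set.range u)).topologicalClosure) : inner ℝ w v = 0 := by
  have h1 : (Submodule.span ℝ (Set.range u)).topologicalClosure ≤ (innerSL ℝ w).ker := by
    refine Submodule.topologicalClosure_minimal _ ?_ (innerSL ℝ w).isClosed_ker
    rw [Submodule.span_le]
    rintro _ ⟨i, rfl⟩
    exact h i
  exact h1 hv

/-- On the closed span, `w` acts only through its projection `P` onto the finitely many `u i` with
`i ∈ S`. Then `‖P‖²` is a sum of at most `S.card` squared coefficients, and Cauchy–Schwarz
concludes. -/
theorem inner_sq_le_card_mul {H ι : Type*} [NormedAddCommGroup H] [InnerProductSpace ℝ H]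
    {u : ι → H} (hu : Orthonormal ℝ u) {w v : H} {S : Finset ι} {b : ℝ}
    (h0 : ∀ i ∉ S, inner ℝ w (u i) = 0) (hS : ∀ i, |inner ℝ w (u i)| ≤ b)
    (hv : v ∈ (Submodule.span ℝ (Set.range u)).topologicalClosure) :
    inner ℝ w v ^ 2 ≤ S.card * b ^ 2 * ‖v‖ ^ 2 := by
  classical
  set P := ∑ i ∈ S, inner ℝ w (u i) • u i with hP
  have h1 : inner ℝ (w - P) v = 0 := by
    refine inner_eq_zero_of_mem_closure_span (fun i => ?_) hv
    rw [inner_sub_left, hP, sum_inner]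
    simp_rw [real_inner_smul_left, orthonormal_iff_ite.1 hu]
    by_cases hi : i ∈ S
    · simp [hi]
    · simp [hi, h0 i hi]
  rw [inner_sub_left, sub_eq_zero] at h1
  rw [h1]
  have hPn : ‖P‖ ^ 2 ≤ S.card * b ^ 2 := by
    rw [← real_inner_self_eq_norm_sq, hP, hu.inner_sum]
    calc _ ≤ ∑ i ∈ S, b ^ 2 := Finset.sum_le_sum fun i _ => by
          rw [← sq_abs b]
          simpa [← sq] using sq_le_sq.2 ((hS i).trans ((le_abs_self b).trans (abs_abs b).ge))
      _ = S.card * b ^ 2 := by simp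
  calc inner ℝ P v ^ 2 ≤ (‖P‖ * ‖v‖) ^ 2 := sq_le_sq.2
        ((abs_real_inner_le_norm P v).trans (le_abs_self _))
    _ = ‖P‖ ^ 2 * ‖v‖ ^ 2 := mul_pow _ _ _
    _ ≤ _ := by gcongr

end Hilbert

variable {D : ℕ}

/-- `f` represents an element of the subspace `U` of `L²`. -/
def Represents (U : Submodule ℝ (Lp ℝ 2 (volume : Measure (E D)))) (f : E D → ℝ) : Prop :=
  ∃ u ∈ U, u =ᵐ[volume] f

variable {U : Submodule ℝ (Lp ℝ 2 (volume : Measure (E D)))} {f g : E D → ℝ}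

theorem Represents.memLp (h : Represents U f) : MemLp f 2 volume := by
  obtain ⟨u, -, hu⟩ := h
  exact (memLp_congr_ae hu).1 (Lp.memLp u)

theorem Represents.const_mul (h : Represents U f) (c : ℝ) : Represents U fun x => c * f x := by
  obtain ⟨u, hu, huf⟩ := h
  refine ⟨c • u, U.smul_mem c hu, ?_⟩
  filter_upwards [Lp.coeFn_smul c u, huf] with x h1 h2
  rw [h1, Pi.smul_apply, h2, smul_eq_mul]

theorem inner_Lp_eq {u v : Lp ℝ 2 (volume : Measure (E D))} (hu : u =ᵐ[volume] f)
    (hv : v =ᵐ[volume] g) : inner ℝ u v = ∫ x, f x * g x := by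
  rw [L2.inner_def]
  refine integral_congr_ae ?_
  filter_upwards [hu, hv] with x h1 h2
  rw [h1, h2, real_inner_eq_re_inner, RCLike.inner_apply]
  simp [mul_comm]

variable {ι : Type} {e : ι → E D → ℝ}

theorem IsOrthonormalBasisOf.represents (h : IsOrthonormalBasisOf e U) (i : ι) :
    Represents U (e i) := by
  obtain ⟨u, hue, -, hU⟩ := h
  exact ⟨u i, hU ▸ Submodule.le_topologicalClosure _ (Submodule.subset_span ⟨i, rfl⟩), hue i⟩

theorem IsOrthonormalBasisOf.integral_mul [DecidableEq ι] (h : IsOrthonormalBasisOf e U)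
    (i l : ι) : ∫ x, e i x * e l x = if i = l then 1 else 0 := by
  obtain ⟨u, hue, hu, -⟩ := h
  rw [← inner_Lp_eq (hue i) (hue l), orthonormal_iff_ite.1 hu]

theorem IsOrthonormalBasisOf.integral_eq_zero (h : IsOrthonormalBasisOf e U)
    (hf : MemLp f 2 volume) (h0 : ∀ i, ∫ x, f x * e i x = 0) (hg : Represents U g) :
    ∫ x, f x * g x = 0 := by
  obtain ⟨u, hue, -, hU⟩ := h
  obtain ⟨v, hv, hvg⟩ := hg
  rw [← inner_Lp_eq hf.coeFn_toLp hvg]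
  refine inner_eq_zero_of_mem_closure_span (u := u) (fun i => ?_) (hU ▸ hv)
  rw [inner_Lp_eq hf.coeFn_toLp (hue i), h0]

theorem IsOrthonormalBasisOf.inner_sq_le (h : IsOrthonormalBasisOf e U)
    (hf : MemLp f 2 volume) {S : Finset ι} {b : ℝ}
    (h0 : ∀ i ∉ S, ∫ x, f x * e i x = 0) (hS : ∀ i, |∫ x, f x * e i x| ≤ b)
    {v : Lp ℝ 2 (volume : Measure (E D))} (hv : v ∈ U) :
    inner ℝ (hf.toLp f) v ^ 2 ≤ S.card * b ^ 2 * ‖v‖ ^ 2 := by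
  obtain ⟨u, hue, hu, hU⟩ := h
  refine inner_sq_le_card_mul hu (fun i hi => ?_) (fun i => ?_) (hU ▸ hv)
  · rw [inner_Lp_eq hf.coeFn_toLp (hue i), h0 i hi]
  · rw [inner_Lp_eq hf.coeFn_toLp (hue i)]; exact hS i

/-- When only finitely many coefficients are nonzero, the `L²` expansion is an a.e. identity of
finite sums. It can then be integrated against functions that are only locally integrable. -/
theorem IsOrthonormalBasisOf.ae_eq_sum (h : IsOrthonormalBasisOf e U) (hf : Represents U f)
    {S : Finset ι} (h0 : ∀ i ∉ S, ∫ x, f x * e i x = 0) :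
    f =ᵐ[volume] fun x => ∑ i ∈ S, (∫ y, f y * e i y) * e i x := by
  classical
  obtain ⟨u, hue, hu, hU⟩ := h
  obtain ⟨v, hv, hvf⟩ := hf
  have hc : ∀ i, inner ℝ v (u i) = ∫ y, f y * e i y := fun i => inner_Lp_eq hvf (hue i)
  set P := ∑ i ∈ S, (∫ y, f y * e i y) • u i with hP
  have hPmem : P ∈ (Submodule.span ℝ (Set.range u)).topologicalClosure :=
    Submodule.le_topologicalClosure _ (Submodule.sum_mem _ fun i _ =>
      Submodule.smul_mem _ _ (Submodule.subset_span ⟨i, rfl⟩))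
  have hperp : ∀ i, inner ℝ (v - P) (u i) = 0 := by
    intro i
    rw [inner_sub_left, hP, sum_inner, hc]
    simp_rw [real_inner_smul_left, orthonormal_iff_ite.1 hu]
    by_cases hi : i ∈ S
    · simp [hi]
    · simp [hi, h0 i hi]
  have hvP : v - P = 0 := by
    rw [← inner_self_eq_zero (𝕜 := ℝ)]
    exact inner_eq_zero_of_mem_closure_span hperp (Submodule.sub_mem _ (hU ▸ hv) hPmem)
  rw [sub_eq_zero] at hvP
  have hsum : (P : E D → ℝ) =ᵐ[volume] fun x => ∑ i ∈ S, (∫ y, f y * e i y) * e i x := by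
    rw [hP]
    refine (Lp.coeFn_finsetSum S fun i => (∫ y, f y * e i y) • u i).trans ?_
    have h2 : ∀ᵐ x, ∀ i ∈ S, ((∫ y, f y * e i y) • u i : Lp ℝ 2 volume) x =
        (∫ y, f y * e i y) * e i x := by
      rw [Finset.eventually_all]
      intro i _
      filter_upwards [Lp.coeFn_smul (∫ y, f y * e i y) (u i), hue i] with x h3 h4
      rw [h3, Pi.smul_apply, h4, smul_eq_mul]
    filter_upwards [h2] with x hx
    rw [Finset.sum_apply]
    exact Finset.sum_congr rfl hx
  exact hvf.symm.trans (hvP ▸ hsum)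

theorem memLp_comp_smul (hf : MemLp f 2 volume) {c : ℝ} (hc : c ≠ 0) :
    MemLp (fun x => f (c • x)) 2 volume := by
  have h1 : MemLp f 2 (Measure.map (c • ·) (volume : Measure (E D))) := by
    rw [Measure.map_addHaar_smul _ hc]
    exact hf.smul_measure ENNReal.ofReal_ne_top
  exact h1.comp_of_map (by fun_prop)

variable {r : ℕ} (W : WaveletMRA D r)

theorem represents_dilate {j : ℤ} (h : Represents (W.V j) f) :
    Represents (W.V (j + 1)) fun x => f ((2 : ℝ) • x) := by
  have hm := memLp_comp_smul h.memLp (two_ne_zero (α := ℝ))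
  obtain ⟨u, hu, huf⟩ := h
  refine ⟨hm.toLp _, ?_, hm.coeFn_toLp⟩
  refine (W.dilate j u _ ?_).1 hu
  exact hm.coeFn_toLp.trans
    ((Measure.quasiMeasurePreserving_smul volume (two_ne_zero (α := ℝ))).ae_eq_comp huf).symm

theorem represents_undilate {j : ℤ} (h : Represents (W.V (j + 1)) f) :
    Represents (W.V j) fun x => f ((2 : ℝ)⁻¹ • x) := by
  have hm := memLp_comp_smul h.memLp (inv_ne_zero (two_ne_zero (α := ℝ)))
  obtain ⟨u, hu, huf⟩ := h
  refine ⟨hm.toLp _, ?_, hm.coeFn_toLp⟩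
  refine (W.dilate j _ u ?_).2 hu
  have := (Measure.quasiMeasurePreserving_smul volume (two_ne_zero (α := ℝ))).ae_eq_comp
    hm.coeFn_toLp
  refine huf.trans (EventuallyEq.trans ?_ this.symm)
  refine Eventually.of_forall fun x => ?_
  simp

theorem scaled_zero (k : Fin D → ℤ) (g : E D → ℝ) : scaled 0 k g = fun x => g (x - latt k) := by
  ext x; simp [scaled]

theorem scaled_succ (j : ℕ) (k : Fin D → ℤ) (g : E D → ℝ) (x : E D) :
    scaled ((j : ℤ) + 1) k g x = (2 : ℝ) ^ ((D : ℝ) / 2) * scaled j k g ((2 : ℝ) • x) := by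
  rw [scaled, scaled, ← mul_assoc, ← Real.rpow_add two_pos, smul_smul, zpow_add_one₀ two_ne_zero]
  congr 2
  push_cast; ring

theorem scaled_nat (j : ℕ) (k : Fin D → ℤ) (g : E D → ℝ) (x : E D) :
    scaled (j : ℤ) k g x = (2 : ℝ) ^ ((D : ℝ) * j / 2) * g ((2 : ℝ) ^ j • x - latt k) := by
  simp [scaled]

/-- The substitution `x = 2^{-j}(k + z)` turns a wavelet coefficient into a local average of `w`
around `2^{-j}k`, the form to which Taylor expansion applies. -/
theorem integral_scaled (j : ℕ) (k : Fin D → ℤ) (w g : E D → ℝ) :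
    ∫ x, w x * scaled (j : ℤ) k g x = (2 : ℝ) ^ (-((D : ℝ) * j / 2)) *
      ∫ z, w (((2 : ℝ)⁻¹ ^ j) • latt k + ((2 : ℝ)⁻¹ ^ j) • z) * g z := by
  have h1 := Measure.integral_comp_smul (volume : Measure (E D))
    (fun y => w (((2 : ℝ)⁻¹ ^ j) • y) * g (y - latt k)) ((2 : ℝ) ^ j)
  have h2 := integral_add_right_eq_self (μ := (volume : Measure (E D)))
    (fun y => w (((2 : ℝ)⁻¹ ^ j) • y) * g (y - latt k)) (latt k)
  simp only [add_sub_cancel_right, smul_add] at h2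
  simp_rw [add_comm (((2 : ℝ)⁻¹ ^ j) • latt k)]
  have e1 : ∀ x, w x * scaled (j : ℤ) k g x = (2 : ℝ) ^ ((D : ℝ) * j / 2) *
      (w (((2 : ℝ)⁻¹ ^ j) • (2 : ℝ) ^ j • x) * g ((2 : ℝ) ^ j • x - latt k)) := fun x => by
    rw [scaled_nat, smul_smul, ← mul_pow, inv_mul_cancel₀ two_ne_zero, one_pow, one_smul]; ring
  simp_rw [e1]
  rw [integral_const_mul, h1, h2, smul_eq_mul, ← mul_assoc, finrank_euclideanSpace_fin, ← pow_mul,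
    abs_of_pos (by positivity), ← Real.rpow_natCast, ← Real.rpow_neg two_pos.le,
    ← Real.rpow_add two_pos]
  congr 2
  push_cast; ring

theorem represents_father (j : ℕ) (k : Fin D → ℤ) : Represents (W.V j) (scaled j k W.φ) := by
  induction j with
  | zero =>
    have := W.father.represents k
    rwa [Nat.cast_zero, scaled_zero]
  | succ j ih =>
    push_cast
    rw [show scaled ((j : ℤ) + 1) k W.φ = fun x => (2 : ℝ) ^ ((D : ℝ) / 2) *
      scaled j k W.φ ((2 : ℝ) • x) from funext (scaled_succ j k W.φ)]
    exact (represents_dilate W ih).const_mul _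

theorem represents_mother (j : ℕ) (ek : Eps D × (Fin D → ℤ)) :
    Represents (W.V (j + 1)) (scaled j ek.2 (W.ψ ek.1)) :=
  (W.mother j).represents (Sum.inr ek)

theorem Represents.mono {i j : ℤ} (h : Represents (W.V i) f) (hij : i ≤ j) :
    Represents (W.V j) f := by
  obtain ⟨u, hu, huf⟩ := h
  exact ⟨u, W.mono hij hu, huf⟩

/-- At level `0` the father translates span `V 0` and belong to the same orthonormal family as the
mother wavelets. Dilation carries this orthogonality to every level. -/
theorem integral_mul_mother_eq_zero (j : ℕ) (ek : Eps D × (Fin D → ℤ))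
    (h : Represents (W.V j) f) : ∫ x, f x * scaled j ek.2 (W.ψ ek.1) x = 0 := by
  classical
  induction j generalizing f with
  | zero =>
    simp_rw [mul_comm (f _)]
    refine W.father.integral_eq_zero ((W.mother 0).represents (Sum.inr ek)).memLp
      (fun k => ?_) (by simpa using h)
    have := (W.mother 0).integral_mul (Sum.inr ek) (Sum.inl k)
    simpa [scaled_zero] using this
  | succ j ih =>
    have h1 := ih (represents_undilate W (by exact_mod_cast h))
    have h2 := Measure.integral_comp_smul (volume : Measure (E D))
      (fun x => f ((2 : ℝ)⁻¹ • x) * scaled j ek.2 (W.ψ ek.1) x) (2 : ℝ)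
    rw [h1, smul_zero] at h2
    simp only [smul_smul, inv_mul_cancel₀ (two_ne_zero (α := ℝ)), one_smul] at h2
    push_cast
    have e1 : ∀ x, f x * scaled ((j : ℤ) + 1) ek.2 (W.ψ ek.1) x = (2 : ℝ) ^ ((D : ℝ) / 2) *
        (f x * scaled j ek.2 (W.ψ ek.1) ((2 : ℝ) • x)) := fun x => by
      rw [scaled_succ]; ring
    simp_rw [e1]
    rw [integral_const_mul, h2, mul_zero]

theorem coeff_father_mother (k : Fin D → ℤ) (j : ℕ) (ek : Eps D × (Fin D → ℤ)) :
    ∫ x, W.φ (x - latt k) * scaled j ek.2 (W.ψ ek.1) x = 0 := by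
  refine integral_mul_mother_eq_zero W j ek ((W.father.represents k).mono W ?_)
  exact_mod_cast j.zero_le

/-- Across levels, the coarser wavelet lies in a space `V` to which the finer one is orthogonal. -/
theorem coeff_mother_mother (i j : ℕ) (ek fl : Eps D × (Fin D → ℤ)) :
    ∫ x, scaled i ek.2 (W.ψ ek.1) x * scaled j fl.2 (W.ψ fl.1) x =
      if i = j ∧ ek = fl then 1 else 0 := by
  classical
  rcases lt_trichotomy i j with h | h | h
  · rw [if_neg (by omega)]
    exact integral_mul_mother_eq_zero W j fl ((represents_mother W i ek).mono W (by omega))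
  · subst h
    have := (W.mother i).integral_mul (Sum.inr ek) (Sum.inr fl)
    simpa using this
  · rw [if_neg (by omega)]
    simp_rw [mul_comm (scaled i _ _ _)]
    exact integral_mul_mother_eq_zero W i ek ((represents_mother W j fl).mono W (by omega))

end

/-! ### Compact supports, refinement, and the integral of the father wavelet. -/

section

variable {D : ℕ}

/-- `f` vanishes outside the cube `[-R, R]^D`. -/
def BoxSupp (f : E D → ℝ) (R : ℝ) : Prop := ∀ x, f x ≠ 0 → ∀ i, |x i| ≤ R

theorem BoxSupp.hasCompactSupport {f : E D → ℝ} {R : ℝ} (h : BoxSupp f R) :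
    HasCompactSupport f := by
  have hK : IsCompact ((EuclideanSpace.equiv (Fin D) ℝ).symm ''
      (Set.univ.pi fun _ => Set.Icc (-R) R)) :=
    (isCompact_univ_pi fun _ => isCompact_Icc).image
      (EuclideanSpace.equiv (Fin D) ℝ).symm.continuous
  refine HasCompactSupport.intro hK fun x hx => ?_
  by_contra hfx
  refine hx ⟨EuclideanSpace.equiv (Fin D) ℝ x, fun i _ => ?_, by simp⟩
  exact abs_le.1 (h x hfx i)

theorem boxSupp_of_hasCompactSupport {f : E D → ℝ} (h : HasCompactSupport f) :
    ∃ R, 0 ≤ R ∧ BoxSupp f R := by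
  obtain ⟨R, hR⟩ := h.isCompact.isBounded.exists_norm_le
  refine ⟨max R 0, le_max_right _ _, fun x hx i => ?_⟩
  have h1 := hR x (subset_tsupport f hx)
  have h2 := PiLp.norm_apply_le x i
  rw [Real.norm_eq_abs] at h2
  exact (h2.trans h1).trans (le_max_left _ _)

/-- The lattice points in the cube of half-side `2 ^ j R + A`. -/
def latticeBox (D : ℕ) (R A : ℝ) (j : ℕ) : Finset (Fin D → ℤ) :=
  Fintype.piFinset fun _ => Finset.Icc (-⌈(2 : ℝ) ^ j * R + A⌉) ⌈(2 : ℝ) ^ j * R + A⌉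

theorem mul_scaled_eq_zero {f g : E D → ℝ} {R A : ℝ} (hf : BoxSupp f R) (hg : BoxSupp g A) {j : ℕ}
    {k : Fin D → ℤ} (hk : k ∉ latticeBox D R A j) (x : E D) : f x * scaled j k g x = 0 := by
  by_contra h
  rw [scaled_nat] at h
  have h1 := hf x (left_ne_zero_of_mul h)
  have h2 := hg _ (right_ne_zero_of_mul (right_ne_zero_of_mul h))
  refine hk (Fintype.mem_piFinset.2 fun i => ?_)
  have h3 := h2 i
  simp only [latt, PiLp.sub_apply, PiLp.smul_apply, smul_eq_mul] at h3
  have h4 : |(k i : ℝ)| ≤ (2 : ℝ) ^ j * R + A := by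
    calc |(k i : ℝ)| = |2 ^ j * x i - (2 ^ j * x i - k i)| := by ring_nf
      _ ≤ |2 ^ j * x i| + |2 ^ j * x i - k i| := abs_sub _ _
      _ ≤ 2 ^ j * R + A := by
        rw [abs_mul, abs_of_pos (by positivity : (0 : ℝ) < 2 ^ j)]
        gcongr
        exact h1 i
  have h5 : ((|k i| : ℤ) : ℝ) ≤ (⌈(2 : ℝ) ^ j * R + A⌉ : ℝ) := by
    rw [Int.cast_abs]; exact h4.trans (Int.le_ceil _)
  exact Finset.mem_Icc.2 (abs_le.1 (by exact_mod_cast h5))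

theorem card_latticeBox_le {R A : ℝ} (hR : 0 ≤ R) (hA : 0 ≤ A) (j : ℕ) :
    ((latticeBox D R A j).card : ℝ) ≤ ((2 * R + 2 * A + 3) * 2 ^ j) ^ D := by
  rw [latticeBox, Fintype.card_piFinset, Finset.prod_const, Finset.card_univ, Fintype.card_fin,
    Nat.cast_pow, Int.card_Icc]
  have h1 : 0 ≤ (2 : ℝ) ^ j * R + A := by positivity
  have h2 : 0 ≤ ⌈(2 : ℝ) ^ j * R + A⌉ := Int.ceil_nonneg h1
  gcongr
  rw [← Int.cast_natCast, Int.toNat_of_nonneg (by omega)]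
  push_cast
  have h3 := Int.ceil_lt_add_one ((2 : ℝ) ^ j * R + A)
  have h4 : (1 : ℝ) ≤ 2 ^ j := one_le_pow₀ (by norm_num)
  nlinarith

theorem boxSupp_sum {ι : Type*} (S : Finset ι) {f : ι → E D → ℝ} {R : ι → ℝ}
    (hR : ∀ i, 0 ≤ R i) (h : ∀ i, BoxSupp (f i) (R i)) :
    BoxSupp (fun x => ∑ i ∈ S, f i x) (∑ i ∈ S, R i) := by
  intro x hx l
  obtain ⟨i, hi, hfi⟩ := Finset.exists_ne_zero_of_sum_ne_zero hx
  exact (h i x hfi l).trans (Finset.single_le_sum (f := R) (fun i _ => hR i) hi)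

theorem scaled_congr {f g : E D → ℝ} (h : f =ᵐ[volume] g) (j : ℕ) (k : Fin D → ℤ) :
    scaled (j : ℤ) k f =ᵐ[volume] scaled (j : ℤ) k g := by
  have h1 : Measure.QuasiMeasurePreserving (fun x : E D => (2 : ℝ) ^ j • x - latt k)
      volume volume :=
    (measurePreserving_sub_right volume (latt k)).quasiMeasurePreserving.comp
      (Measure.quasiMeasurePreserving_smul volume (pow_ne_zero j two_ne_zero))
  filter_upwards [h1.ae_eq_comp h] with x hx
  rw [scaled_nat, scaled_nat]
  exact congrArg _ hx

theorem continuous_scaled {g : E D → ℝ} (hg : Continuous g) (j : ℕ) (k : Fin D → ℤ) :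
    Continuous (scaled (j : ℤ) k g) := by
  have : scaled (j : ℤ) k g = fun x => (2 : ℝ) ^ ((D : ℝ) * j / 2) *
    g ((2 : ℝ) ^ j • x - latt k) := funext (scaled_nat j k g)
  rw [this]; fun_prop

theorem hasCompactSupport_scaled {g : E D → ℝ} (hg : HasCompactSupport g) (j : ℕ)
    (k : Fin D → ℤ) : HasCompactSupport (scaled (j : ℤ) k g) := by
  have : scaled (j : ℤ) k g = fun x => (2 : ℝ) ^ ((D : ℝ) * j / 2) *
    g ((2 : ℝ) ^ j • x - latt k) := funext (scaled_nat j k g)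
  rw [this]
  let e : E D ≃ₜ E D := (Homeomorph.smulOfNeZero ((2 : ℝ) ^ j) (by positivity)).trans
    (Homeomorph.subRight (latt k))
  exact (hg.comp_homeomorph e).mul_left

theorem memLp_of_continuous {f : E D → ℝ} (hf : Continuous f) (hfc : HasCompactSupport f) :
    MemLp f 2 volume := hf.memLp_of_hasCompactSupport hfc

/-- Wavelet coefficients with respect to a kernel with vanishing moments decay fast. -/
theorem exists_coeff_bound {w g : E D → ℝ} {l : ℕ} (hw : ContDiff ℝ l w)
    (hwc : HasCompactSupport w) (hg : Continuous g) (hgc : HasCompactSupport g)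
    (h0 : ∀ i < l, ∀ x, taylorMoment volume i w g x = 0) :
    ∃ C : ℝ, 0 ≤ C ∧ ∀ (j : ℕ) (k : Fin D → ℤ), |∫ x, w x * scaled (j : ℤ) k g x| ≤
      C * (2 : ℝ) ^ (-((D : ℝ) * j / 2)) * ((2 : ℝ)⁻¹ ^ j) ^ l := by
  obtain ⟨C, hC⟩ := (hw.continuous_iteratedFDeriv').bounded_above_of_compact_support
    (hwc.iteratedFDeriv l)
  have hC0 : 0 ≤ C := (norm_nonneg _).trans (hC 0)
  refine ⟨C * ∫ z, ‖z‖ ^ l * |g z|, mul_nonneg hC0 (integral_nonneg fun z => by positivity),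
    fun j k => ?_⟩
  rw [integral_scaled, abs_mul, abs_of_pos (by positivity)]
  calc _ ≤ (2 : ℝ) ^ (-((D : ℝ) * j / 2)) *
        (C * (∫ z, ‖z‖ ^ l * |g z|) * ((2 : ℝ)⁻¹ ^ j) ^ l) := by
        gcongr
        exact abs_integral_le_of_moments volume hw hC hg hgc h0 (by positivity) _
    _ = _ := by ring

theorem dense_dyadic :
    Dense {x : E D | ∃ (J : ℕ) (K : Fin D → ℤ), x = ((2 : ℝ)⁻¹ ^ J) • latt K} := by
  intro x
  refine mem_closure_of_tendsto (f := fun J : ℕ => ((2 : ℝ)⁻¹ ^ J) •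
    (latt fun i => ⌊(2 : ℝ) ^ J * x i⌋ : E D)) (b := atTop) ?_
    (Eventually.of_forall fun J => ⟨J, _, rfl⟩)
  have h : ∀ i, Tendsto (fun J : ℕ => ((2 : ℝ)⁻¹ ^ J) * (⌊(2 : ℝ) ^ J * x i⌋ : ℝ)) atTop
      (𝓝 (x i)) := by
    intro i
    rw [tendsto_iff_dist_tendsto_zero]
    refine squeeze_zero (fun _ => dist_nonneg) (fun J => ?_)
      (tendsto_pow_atTop_nhds_zero_of_lt_one (by norm_num) (by norm_num : (2 : ℝ)⁻¹ < 1))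
    rw [Real.dist_eq]
    have e : x i = (2 : ℝ)⁻¹ ^ J * ((2 : ℝ) ^ J * x i) := by
      rw [← mul_assoc, ← mul_pow, inv_mul_cancel₀ two_ne_zero, one_pow, one_mul]
    nth_rw 2 [e]
    rw [← mul_sub, abs_mul, abs_of_pos (by positivity : (0 : ℝ) < 2⁻¹ ^ J)]
    refine mul_le_of_le_one_right (by positivity) ?_
    rw [abs_le]
    constructor <;> linarith [Int.floor_le ((2 : ℝ) ^ J * x i),
      Int.lt_floor_add_one ((2 : ℝ) ^ J * x i)]
  have h2 := (PiLp.continuous_toLp 2 (fun _ : Fin D => ℝ)).tendsto (fun i => x i)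
  have h3 := h2.comp (tendsto_pi_nhds.2 h)
  exact h3.congr fun J => by ext i; simp [latt]

variable {r : ℕ} (W : WaveletMRA D r)

theorem boxSupp_father : BoxSupp W.φ |W.A| := fun x hx i =>
  (W.support_father x hx i).trans (le_abs_self _)

theorem boxSupp_mother (e : Eps D) : BoxSupp (W.ψ e) |W.A| := fun x hx i =>
  (W.support_mother e x hx i).trans (le_abs_self _)

theorem continuous_father : Continuous W.φ := W.smooth.continuous

/-- Dilated by two, a mother wavelet lies in `V 0` and has compact support, so only finitely many
father translates enter its expansion. The finite sum is continuous, a property not assumed of `ψ`.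
-/
theorem exists_refinement (e : Eps D) : ∃ (S : Finset (Fin D → ℤ)) (c : (Fin D → ℤ) → ℝ),
    (fun x => ∑ k ∈ S, c k * W.φ ((2 : ℝ) • x - latt k)) =ᵐ[volume] W.ψ e := by
  have hl : (latt (0 : Fin D → ℤ) : E D) = 0 := by ext i; simp [latt]
  have h1 := represents_mother W 0 (e, 0)
  simp only [Nat.cast_zero, scaled_zero, hl, sub_zero] at h1
  have h2 := represents_undilate W h1
  have hbox : BoxSupp (fun x : E D => W.ψ e ((2 : ℝ)⁻¹ • x)) (2 * |W.A|) := by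
    intro x hx i
    have := boxSupp_mother W e _ hx i
    simp only [PiLp.smul_apply, smul_eq_mul, abs_mul] at this
    rw [abs_of_pos (by norm_num : (0 : ℝ) < 2⁻¹)] at this
    linarith
  have h3 := W.father.ae_eq_sum h2 (S := latticeBox D (2 * |W.A|) |W.A| 0) fun k hk => by
    have := mul_scaled_eq_zero hbox (boxSupp_father W) hk
    simp only [Nat.cast_zero, scaled_zero] at this
    simp [this]
  refine ⟨_, _, ((Measure.quasiMeasurePreserving_smul volume
    (two_ne_zero (α := ℝ))).ae_eq_comp h3).symm.trans (Eventually.of_forall fun x => ?_)⟩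
  simp

/-- The continuous representative of a mother wavelet. -/
def motherRep (e : Eps D) : E D → ℝ := fun x =>
  ∑ k ∈ (exists_refinement W e).choose, (exists_refinement W e).choose_spec.choose k *
    W.φ ((2 : ℝ) • x - latt k)

theorem motherRep_ae_eq (e : Eps D) : motherRep W e =ᵐ[volume] W.ψ e :=
  (exists_refinement W e).choose_spec.choose_spec

theorem continuous_motherRep (e : Eps D) : Continuous (motherRep W e) := by
  have := continuous_father W
  unfold motherRep; fun_prop

theorem exists_boxSupp_motherRep (e : Eps D) : ∃ R, 0 ≤ R ∧ BoxSupp (motherRep W e) R := by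
  refine ⟨_, ?_, boxSupp_sum _ (R := fun k => |W.A| + ∑ i, |(k i : ℝ)|) (fun k => ?_) ?_⟩
  · exact Finset.sum_nonneg fun k _ =>
      add_nonneg (abs_nonneg _) (Finset.sum_nonneg fun i _ => abs_nonneg _)
  · exact add_nonneg (abs_nonneg _) (Finset.sum_nonneg fun i _ => abs_nonneg _)
  · intro k x hx i
    have h1 := boxSupp_father W _ (right_ne_zero_of_mul hx) i
    simp only [latt, PiLp.sub_apply, PiLp.smul_apply, smul_eq_mul] at h1
    have h2 : |(k i : ℝ)| ≤ ∑ i, |(k i : ℝ)| :=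
      Finset.single_le_sum (f := fun i => |(k i : ℝ)|) (fun _ _ => abs_nonneg _)
        (Finset.mem_univ i)
    have h3 : |2 * x i| ≤ |2 * x i - k i| + |(k i : ℝ)| := by
      simpa using abs_add_le (2 * x i - k i) (k i : ℝ)
    rw [abs_mul, abs_two] at h3
    linarith [abs_nonneg (x i)]

theorem hasCompactSupport_motherRep (e : Eps D) : HasCompactSupport (motherRep W e) := by
  obtain ⟨R, -, hR⟩ := exists_boxSupp_motherRep W e
  exact hR.hasCompactSupport

theorem integral_motherRep_eq_zero (h : ∫ x, W.φ x = 0) (e : Eps D) :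
    ∫ x, motherRep W e x = 0 := by
  have hc : ∀ k : Fin D → ℤ, Integrable fun x : E D => W.φ ((2 : ℝ) • x - latt k) := fun k => by
    have hφ : Integrable W.φ :=
      (continuous_father W).integrable_of_hasCompactSupport (boxSupp_father W).hasCompactSupport
    exact (hφ.comp_sub_right (latt k)).comp_smul two_ne_zero
  unfold motherRep
  rw [integral_finsetSum _ fun k _ => (hc k).const_mul _]
  refine Finset.sum_eq_zero fun k _ => ?_
  rw [integral_const_mul, Measure.integral_comp_smul volume (fun x => W.φ (x - latt k)),
    integral_sub_right_eq_self, h]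
  simp

/-- If `∫ φ = 0`, the refinement equation gives every mother wavelet mean zero. The level-`j`
coefficients of a smooth bump are then `O(2^{-Dj/2} 2^{-j})`, and only `O(2^{Dj})` of them are
nonzero, so its projection onto `V (j + 1)` has squared norm `O(4^{-j})`. The bump is therefore
orthogonal to every `V i`, and density of their union forces it to vanish. -/
theorem integral_father_ne_zero : ∫ x, W.φ x ≠ 0 := by
  intro h
  let w : ContDiffBump (0 : E D) := ⟨1, 2, one_pos, one_lt_two⟩
  have hw : ContDiff ℝ (1 : ℕ) w := w.contDiff
  have hwc := w.hasCompactSupport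
  have hwL : MemLp w 2 volume := memLp_of_continuous w.continuous hwc
  obtain ⟨R, hR0, hR⟩ := boxSupp_of_hasCompactSupport hwc
  have hmom : ∀ g : E D → ℝ, ∫ x, g x = 0 → ∀ i < 1, ∀ x, taylorMoment volume i w g x = 0 := by
    intro g hg i hi x
    obtain rfl : i = 0 := by omega
    simp only [taylorMoment, dirDeriv_zero]
    rw [integral_const_mul, hg, mul_zero]
  obtain ⟨C₁, hC₁, hb₁⟩ := exists_coeff_bound hw hwc (continuous_father W)
    (boxSupp_father W).hasCompactSupport (hmom _ h)
  choose C₂ hC₂ hb₂ using fun e => exists_coeff_bound hw hwc (continuous_motherRep W e)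
    (hasCompactSupport_motherRep W e) (hmom _ (integral_motherRep_eq_zero W h e))
  set C := C₁ + ∑ e, C₂ e with hCdef
  have hCe : ∀ e, C₂ e ≤ C := fun e => by
    have := Finset.single_le_sum (f := C₂) (fun e _ => hC₂ e) (Finset.mem_univ e)
    linarith
  have hC1 : C₁ ≤ C := by
    have := Finset.sum_nonneg (f := C₂) (s := Finset.univ) fun e _ => hC₂ e
    linarith
  have key : ∀ (i : ℤ) (v : Lp ℝ 2 (volume : Measure (E D))), v ∈ W.V i →
      inner ℝ (hwL.toLp w) v = 0 := by
    intro i v hv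
    set c := (1 + Fintype.card (Eps D) : ℝ) * (2 * R + 2 * |W.A| + 3) ^ D * C ^ 2 * ‖v‖ ^ 2
    have hlim : Tendsto (fun j : ℕ => c * (4 : ℝ)⁻¹ ^ j) atTop (𝓝 0) := by
      simpa using (tendsto_pow_atTop_nhds_zero_of_lt_one (by norm_num)
        (by norm_num : (4 : ℝ)⁻¹ < 1)).const_mul c
    have hle : ∀ᶠ j : ℕ in atTop, inner ℝ (hwL.toLp w) v ^ 2 ≤ c * (4 : ℝ)⁻¹ ^ j := by
      filter_upwards [eventually_ge_atTop i.toNat] with j hj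
      have hvj : v ∈ W.V (j + 1) := W.mono (by omega) hv
      set b := C * (2 : ℝ) ^ (-((D : ℝ) * j / 2)) * ((2 : ℝ)⁻¹ ^ j) ^ 1 with hb
      set B := latticeBox D R |W.A| j
      have := (W.mother j).inner_sq_le hwL
        (S := B.disjSum (Finset.univ ×ˢ B)) (b := b) ?_ ?_ hvj
      · refine this.trans ?_
        have hcard := card_latticeBox_le (D := D) hR0 (abs_nonneg W.A) j
        have hb2 : b ^ 2 = C ^ 2 * ((2 ^ j) ^ D)⁻¹ * (4 : ℝ)⁻¹ ^ j := by
          rw [hb, mul_pow, mul_pow, pow_one, ← pow_mul, mul_comm j 2, pow_mul,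
            ← Real.rpow_natCast ((2 : ℝ) ^ (-((D : ℝ) * j / 2))), ← Real.rpow_mul two_pos.le,
            show -((D : ℝ) * j / 2) * (2 : ℕ) = -((j * D : ℕ) : ℝ) by push_cast; ring,
            Real.rpow_neg two_pos.le, Real.rpow_natCast, pow_mul]
          norm_num
        rw [hb2, Finset.card_disjSum, Finset.card_product, Finset.card_univ]
        push_cast
        have h2j : (0 : ℝ) < (2 ^ j) ^ D := by positivity
        calc ((B.card : ℝ) + Fintype.card (Eps D) * B.card) *
              (C ^ 2 * ((2 ^ j) ^ D)⁻¹ * 4⁻¹ ^ j) * ‖v‖ ^ 2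
            = (1 + Fintype.card (Eps D)) * B.card * (C ^ 2 * ((2 ^ j) ^ D)⁻¹ * 4⁻¹ ^ j) *
              ‖v‖ ^ 2 := by ring
          _ ≤ (1 + Fintype.card (Eps D)) * ((2 * R + 2 * |W.A| + 3) * 2 ^ j) ^ D *
              (C ^ 2 * ((2 ^ j) ^ D)⁻¹ * 4⁻¹ ^ j) * ‖v‖ ^ 2 := by gcongr
          _ = c * 4⁻¹ ^ j := by
              rw [mul_pow]; field_simp; ring
      · rintro (k | ⟨e, k⟩) hk
        · have hk' : k ∉ B := fun h => hk (Finset.inl_mem_disjSum.2 h)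
          have := mul_scaled_eq_zero hR (boxSupp_father W) hk'
          simp [this]
        · have hk' : k ∉ B := fun h => hk (Finset.inr_mem_disjSum.2 (by simpa using h))
          have := mul_scaled_eq_zero hR (boxSupp_mother W e) hk'
          simp [this]
      · rintro (k | ⟨e, k⟩)
        · refine (hb₁ j k).trans ?_
          rw [hb]; gcongr
        · have e1 : ∫ x, w x * scaled j k (W.ψ e) x = ∫ x, w x * scaled j k (motherRep W e) x := by
            refine integral_congr_ae ?_
            filter_upwards [scaled_congr (motherRep_ae_eq W e) j k] with x hx
            rw [hx]
          show |∫ x, w x * scaled j k (W.ψ e) x| ≤ b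
          rw [e1]
          refine (hb₂ e j k).trans ?_
          rw [hb]; gcongr; exact hCe e
    have h2 : inner ℝ (hwL.toLp w) v ^ 2 ≤ 0 := ge_of_tendsto hlim hle
    exact pow_eq_zero_iff two_ne_zero |>.1 (le_antisymm h2 (sq_nonneg _))
  have hzero : hwL.toLp w = 0 := by
    have h1 : (⨆ i, W.V i) ≤ (innerSL ℝ (hwL.toLp w)).ker :=
      iSup_le fun i v hv => key i v hv
    have h2 := Submodule.topologicalClosure_minimal _ h1
      (innerSL ℝ (hwL.toLp w)).isClosed_ker
    rw [W.iSup_eq] at h2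
    have h3 := h2 (Submodule.mem_top (x := hwL.toLp w))
    exact inner_self_eq_zero (𝕜 := ℝ).1 h3
  have hae : (w : E D → ℝ) =ᵐ[volume] fun _ => (0 : ℝ) := by
    have := hwL.coeFn_toLp
    rw [hzero] at this
    exact this.symm.trans (Lp.coeFn_zero _ _ _)
  have := congrFun ((w.continuous.ae_eq_iff_eq volume continuous_const).1 hae) 0
  have h1 : w 0 = 1 := w.one_of_mem_closedBall (by simp [w.rIn_pos.le])
  rw [h1] at this
  exact one_ne_zero this

end

/-! ### Besov norms, vanishing moments of mother wavelets, and wavelet sums. -/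

section

section SeqNorm

variable {ι : Type} {p : ℝ≥0∞}

/-- Identification with the `L^p` norm of counting measure gives Minkowski's inequality. -/
theorem seqNorm_eq_eLpNorm [MeasurableSpace ι] [DiscreteMeasurableSpace ι] (hp : 1 ≤ p)
    (a : ι → ℝ≥0∞) : seqNorm p a = eLpNorm a p Measure.count := by
  rw [seqNorm]
  split_ifs with h
  · subst h; simp
  · have hp0 : p ≠ 0 := (one_pos.trans_le hp).ne'
    rw [eLpNorm_eq_lintegral_rpow_enorm_toReal hp0 h, lintegral_count]
    simp

theorem seqNorm_add_le (hp : 1 ≤ p) (a b : ι → ℝ≥0∞) :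
    seqNorm p (fun i => a i + b i) ≤ seqNorm p a + seqNorm p b := by
  let _ : MeasurableSpace ι := ⊤
  rw [seqNorm_eq_eLpNorm hp, seqNorm_eq_eLpNorm hp, seqNorm_eq_eLpNorm hp]
  exact eLpNorm_add_le (Measurable.of_discrete.aestronglyMeasurable)
    (Measurable.of_discrete.aestronglyMeasurable) hp

theorem seqNorm_mono {a b : ι → ℝ≥0∞} (h : ∀ i, a i ≤ b i) : seqNorm p a ≤ seqNorm p b := by
  rw [seqNorm, seqNorm]
  split_ifs
  · exact iSup_mono h
  · gcongr with i; exact h i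

theorem seqNorm_const_mul (hp : 1 ≤ p) (c : ℝ≥0∞) (a : ι → ℝ≥0∞) :
    seqNorm p (fun i => c * a i) = c * seqNorm p a := by
  rw [seqNorm, seqNorm]
  split_ifs with h
  · rw [ENNReal.mul_iSup]
  · have hp0 : 0 < p.toReal := ENNReal.toReal_pos (by positivity) h
    simp_rw [ENNReal.mul_rpow_of_nonneg _ _ hp0.le]
    rw [ENNReal.tsum_mul_left, ENNReal.mul_rpow_of_nonneg _ _ (inv_nonneg.2 hp0.le),
      ENNReal.rpow_rpow_inv hp0.ne']

theorem seqNorm_le_card (hp : 1 ≤ p) {a : ι → ℝ≥0∞} {S : Finset ι} {b : ℝ≥0∞}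
    (h0 : ∀ i ∉ S, a i = 0) (hb : ∀ i, a i ≤ b) :
    seqNorm p a ≤ b * (S.card : ℝ≥0∞) ^ (p⁻¹).toReal := by
  rw [seqNorm]
  split_ifs with h
  · subst h; simpa using hb
  · have hp0 : 0 < p.toReal := ENNReal.toReal_pos (by positivity) h
    rw [tsum_eq_sum (s := S) fun i hi => by rw [h0 i hi, ENNReal.zero_rpow_of_pos hp0],
      ENNReal.toReal_inv]
    calc (∑ i ∈ S, a i ^ p.toReal) ^ p.toReal⁻¹ ≤ (∑ _i ∈ S, b ^ p.toReal) ^ p.toReal⁻¹ := by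
          gcongr with i _; exact hb i
      _ = b * (S.card : ℝ≥0∞) ^ p.toReal⁻¹ := by
          rw [Finset.sum_const, nsmul_eq_mul, ENNReal.mul_rpow_of_nonneg _ _ (inv_nonneg.2 hp0.le),
            ENNReal.rpow_rpow_inv hp0.ne', mul_comm]

theorem seqNorm_eq_zero (hp : 1 ≤ p) {a : ι → ℝ≥0∞} (h : seqNorm p a = 0) (i : ι) : a i = 0 := by
  let _ : MeasurableSpace ι := ⊤
  have h1 := seqNorm_eq_eLpNorm hp a
  have h2 := enorm_le_eLpNorm_count a i (p := p) (by positivity)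
  rw [← h1, h] at h2
  simpa using h2

theorem seqNorm_geometric_ne_top (hp : 1 ≤ p) {c ρ : ℝ≥0∞} (hc : c ≠ ∞) (hρ : ρ < 1) {a : ℕ → ℝ≥0∞}
    (ha : ∀ j, a j ≤ c * ρ ^ j) : seqNorm p a ≠ ∞ := by
  refine ne_top_of_le_ne_top ?_ (seqNorm_mono ha)
  rw [seqNorm_const_mul hp]
  refine ENNReal.mul_ne_top hc ?_
  rw [seqNorm]
  split_ifs with h
  · exact ne_top_of_le_ne_top ENNReal.one_ne_top (iSup_le fun j => pow_le_one₀ zero_le hρ.le)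
  · have hp0 : 0 < p.toReal := ENNReal.toReal_pos (by positivity) h
    refine ENNReal.rpow_ne_top_of_nonneg (inv_nonneg.2 hp0.le) ?_
    have e : ∀ j : ℕ, (ρ ^ j) ^ p.toReal = (ρ ^ p.toReal) ^ j := fun j => by
      rw [← ENNReal.rpow_natCast, ← ENNReal.rpow_natCast, ← ENNReal.rpow_mul, ← ENNReal.rpow_mul,
        mul_comm]
    simp_rw [e]
    rw [ENNReal.tsum_geometric]
    refine ENNReal.inv_ne_top.2 (tsub_pos_of_lt ?_).ne'
    exact ENNReal.rpow_lt_one hρ hp0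

end SeqNorm

variable {D r : ℕ} (W : WaveletMRA D r)

theorem integral_mul_mother_eq (f : E D → ℝ) (j : ℕ) (ek : Eps D × (Fin D → ℤ)) :
    ∫ x, f x * scaled (j : ℤ) ek.2 (motherRep W ek.1) x =
      ∫ x, f x * scaled (j : ℤ) ek.2 (W.ψ ek.1) x := by
  refine integral_congr_ae ?_
  filter_upwards [scaled_congr (motherRep_ae_eq W ek.1) j ek.2] with x hx
  rw [hx]

theorem taylorMoment_motherRep (e : Eps D) {l : ℕ} (hl : l ≤ r) {w : E D → ℝ}
    (hw : ContDiff ℝ l w) (x : E D) : taylorMoment volume l w (motherRep W e) x = 0 := by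
  refine taylorMoment_eq_zero_of_integral_ne_zero volume (W.smooth.of_le (by exact_mod_cast hl))
    (boxSupp_father W).hasCompactSupport (integral_father_ne_zero W) (continuous_motherRep W e)
    (hasCompactSupport_motherRep W e) (fun y => ?_) hw x
  refine taylorMoment_eq_zero_of_dyadic volume W.smooth (boxSupp_father W).hasCompactSupport
    (continuous_motherRep W e) (hasCompactSupport_motherRep W e) dense_dyadic ?_ l hl y
  rintro _ ⟨J, K, rfl⟩
  filter_upwards [eventually_ge_atTop J] with j hj
  obtain ⟨m, rfl⟩ := Nat.exists_eq_add_of_le hj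
  -- The index `2^m K` at level `J + m` has the same centre `2^{-J}K` for every `m`.
  have h1 := coeff_father_mother W 0 (J + m) (e, fun i => 2 ^ m * K i)
  rw [← integral_mul_mother_eq, integral_scaled] at h1
  have hl : (latt (0 : Fin D → ℤ) : E D) = 0 := by ext i; simp [latt]
  have h2 : ((2 : ℝ)⁻¹ ^ (J + m)) • (latt (fun i => 2 ^ m * K i) : E D) =
      ((2 : ℝ)⁻¹ ^ J) • latt K := by
    ext i
    simp only [latt, PiLp.smul_apply, smul_eq_mul]
    push_cast
    rw [pow_add, mul_assoc, ← mul_assoc ((2 : ℝ)⁻¹ ^ m), ← mul_pow, inv_mul_cancel₀ two_ne_zero,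
      one_pow, one_mul]
  rw [hl, h2] at h1
  simp only [sub_zero] at h1
  exact (mul_eq_zero.1 h1).resolve_left (by positivity)

/-- Taking the constant `1` as the smooth function isolates the zeroth moment. Mean zero is what
preserves the total mass of a perturbed density. -/
theorem integral_motherRep (e : Eps D) : ∫ x, motherRep W e x = 0 := by
  have h := taylorMoment_motherRep W e (r.zero_le) (w := fun _ => (1 : ℝ)) contDiff_const 0
  simpa [taylorMoment, dirDeriv_zero] using h

theorem integrable_mul_of_compact {f g : E D → ℝ} (hf : LocallyIntegrable f volume)
    (hg : Continuous g) (hgc : HasCompactSupport g) : Integrable fun x => f x * g x := by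
  have := hf.integrable_smul_left_of_hasCompactSupport hg hgc
  simpa [mul_comm] using this

theorem integrable_father (f : E D → ℝ) (hf : LocallyIntegrable f volume) (j : ℕ)
    (k : Fin D → ℤ) : Integrable fun x => f x * scaled (j : ℤ) k W.φ x :=
  integrable_mul_of_compact hf (continuous_scaled (continuous_father W) j k)
    (hasCompactSupport_scaled (boxSupp_father W).hasCompactSupport j k)

theorem integrable_motherRep (f : E D → ℝ) (hf : LocallyIntegrable f volume) (j : ℕ)
    (k : Fin D → ℤ) (e : Eps D) :
    Integrable fun x => f x * scaled (j : ℤ) k (motherRep W e) x :=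
  integrable_mul_of_compact hf (continuous_scaled (continuous_motherRep W e) j k)
    (hasCompactSupport_scaled (hasCompactSupport_motherRep W e) j k)

theorem coeffFather_add_mul {f g : E D → ℝ} (hf : LocallyIntegrable f volume)
    (hg : LocallyIntegrable g volume) (c d : ℝ) (k : Fin D → ℤ) :
    coeffFather W (fun x => c * f x + d * g x) k =
      c * coeffFather W f k + d * coeffFather W g k := by
  have h1 := integrable_father W f hf 0 k
  have h2 := integrable_father W g hg 0 k
  simp only [Nat.cast_zero, scaled_zero] at h1 h2
  simp only [coeffFather, add_mul, mul_assoc]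
  rw [integral_add (h1.const_mul c) (h2.const_mul d), integral_const_mul, integral_const_mul]

theorem coeffMother_add_mul {f g : E D → ℝ} (hf : LocallyIntegrable f volume)
    (hg : LocallyIntegrable g volume) (c d : ℝ) (j : ℕ) (ek : Eps D × (Fin D → ℤ)) :
    coeffMother W (fun x => c * f x + d * g x) j ek =
      c * coeffMother W f j ek + d * coeffMother W g j ek := by
  simp only [coeffMother, ← integral_mul_mother_eq W _ j ek]
  simp only [add_mul, mul_assoc]
  rw [integral_add ((integrable_motherRep W f hf j ek.2 ek.1).const_mul c)
    ((integrable_motherRep W g hg j ek.2 ek.1).const_mul d), integral_const_mul,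
    integral_const_mul]

theorem besovNorm_add_mul_le {σ : ℝ} {p q : ℝ≥0∞} (hp : 1 ≤ p) (hq : 1 ≤ q) {f g : E D → ℝ}
    (hf : LocallyIntegrable f volume) (hg : LocallyIntegrable g volume) (c d : ℝ) :
    besovNorm W σ p q (fun x => c * f x + d * g x) ≤
      ‖c‖ₑ * besovNorm W σ p q f + ‖d‖ₑ * besovNorm W σ p q g := by
  have key : ∀ {ι : Type} (a b : ι → ℝ), seqNorm p (fun i => ‖c * a i + d * b i‖ₑ) ≤
      ‖c‖ₑ * seqNorm p (fun i => ‖a i‖ₑ) + ‖d‖ₑ * seqNorm p (fun i => ‖b i‖ₑ) := by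
    intro ι a b
    rw [← seqNorm_const_mul hp, ← seqNorm_const_mul hp]
    refine (seqNorm_mono fun i => ?_).trans (seqNorm_add_le hp _ _)
    rw [← enorm_mul, ← enorm_mul]
    exact enorm_add_le _ _
  simp only [besovNorm, coeffFather_add_mul W hf hg, coeffMother_add_mul W hf hg]
  rw [mul_add, mul_add, add_add_add_comm]
  refine add_le_add (key _ _) ?_
  rw [← seqNorm_const_mul hq, ← seqNorm_const_mul hq]
  refine (seqNorm_mono fun j => ?_).trans (seqNorm_add_le hq _ _)
  rw [mul_left_comm, mul_left_comm (‖d‖ₑ), ← mul_add]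
  gcongr
  exact key _ _

/-- Compactly supported functions of class `C^r` have finite Besov norms of smoothness `σ < r`. -/
theorem besovNorm_ne_top {σ : ℝ} {p q : ℝ≥0∞} (hp : 1 ≤ p) (hq : 1 ≤ q) (hσ : σ < r)
    {w : E D → ℝ} (hw : ContDiff ℝ r w) (hwc : HasCompactSupport w) :
    besovNorm W σ p q w ≠ ∞ := by
  obtain ⟨R, hR0, hR⟩ := boxSupp_of_hasCompactSupport hwc
  have hip : 0 ≤ (p⁻¹).toReal := ENNReal.toReal_nonneg
  have hφmom : ∀ i < 0, ∀ x, taylorMoment volume i w W.φ x = 0 := fun i hi => by omega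
  obtain ⟨C₁, hC₁, hb₁⟩ := exists_coeff_bound (hw.of_le (by exact_mod_cast r.zero_le)) hwc
    (continuous_father W) (boxSupp_father W).hasCompactSupport hφmom
  choose C₂ hC₂ hb₂ using fun e => exists_coeff_bound hw hwc (continuous_motherRep W e)
    (hasCompactSupport_motherRep W e)
    (fun i hi x => taylorMoment_motherRep W e hi.le (hw.of_le (by exact_mod_cast hi.le)) x)
  set C := ∑ e, C₂ e with hCdef
  have hC0 : 0 ≤ C := Finset.sum_nonneg fun e _ => hC₂ e
  have hCe : ∀ e, C₂ e ≤ C := fun e =>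
    Finset.single_le_sum (f := C₂) (fun e _ => hC₂ e) (Finset.mem_univ e)
  rw [besovNorm]
  refine ENNReal.add_ne_top.2 ⟨?_, ?_⟩
  · refine ne_top_of_le_ne_top ?_ (seqNorm_le_card hp (S := latticeBox D R |W.A| 0)
      (b := ENNReal.ofReal C₁) (fun k hk => ?_) (fun k => ?_))
    · exact ENNReal.mul_ne_top ENNReal.ofReal_ne_top
        (ENNReal.rpow_ne_top_of_nonneg hip (ENNReal.natCast_ne_top _))
    · have := mul_scaled_eq_zero hR (boxSupp_father W) hk
      simp only [Nat.cast_zero, scaled_zero] at this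
      simp [coeffFather, this]
    · have := hb₁ 0 k
      simp only [Nat.cast_zero, scaled_zero] at this
      rw [coeffFather, Real.enorm_eq_ofReal_abs]
      exact ENNReal.ofReal_le_ofReal (by simpa using this)
  · set B : ℝ := 2 * R + 2 * |W.A| + 3 with hB
    have hB0 : 0 ≤ B := by positivity
    set c : ℝ := C * (Fintype.card (Eps D) * B ^ D) ^ (p⁻¹).toReal with hc
    -- The weight `2^{j(σ+D/2-D/p)}`, the coefficient size `2^{-jD/2-jr}` and the count `2^{jD}` to
    -- the power `1/p` multiply to `2^{-j(r-σ)}`, which is geometric because `σ < r`.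
    set ρ : ℝ := (2 : ℝ) ^ (-(r - σ)) with hρ
    have hρ1 : ρ < 1 := Real.rpow_lt_one_of_one_lt_of_neg one_lt_two (by linarith)
    refine seqNorm_geometric_ne_top hq (c := ENNReal.ofReal c) (ρ := ENNReal.ofReal ρ)
      ENNReal.ofReal_ne_top (by rw [← ENNReal.ofReal_one]; exact
        (ENNReal.ofReal_lt_ofReal_iff one_pos).2 hρ1) fun j => ?_
    set b : ℝ := C * (2 : ℝ) ^ (-((D : ℝ) * j / 2)) * ((2 : ℝ)⁻¹ ^ j) ^ r with hb
    have hle := seqNorm_le_card hp (a := fun ek => ‖coeffMother W w j ek‖ₑ)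
      (S := Finset.univ ×ˢ latticeBox D R |W.A| j) (b := ENNReal.ofReal b) ?_ ?_
    · refine (mul_le_mul_right hle _).trans ?_
      rw [Finset.card_product, Finset.card_univ, ← ENNReal.ofReal_natCast,
        ENNReal.ofReal_rpow_of_nonneg (by positivity) hip,
        ← ENNReal.ofReal_mul (by positivity), ← ENNReal.ofReal_pow (by positivity),
        ← ENNReal.ofReal_mul (by positivity),
        show (2 : ℝ≥0∞) = ENNReal.ofReal 2 by simp, ENNReal.ofReal_rpow_of_pos two_pos,
        ← ENNReal.ofReal_mul (by positivity)]
      refine ENNReal.ofReal_le_ofReal ?_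
      have hcard : ((Fintype.card (Eps D) * (latticeBox D R |W.A| j).card : ℕ) : ℝ) ≤
          (Fintype.card (Eps D) * B ^ D) * 2 ^ ((j : ℝ) * D) := by
        push_cast
        rw [mul_assoc, Real.rpow_mul two_pos.le, Real.rpow_natCast, Real.rpow_natCast, ← mul_pow]
        gcongr
        exact card_latticeBox_le hR0 (abs_nonneg _) j
      calc _ ≤ (2 : ℝ) ^ ((j : ℝ) * (σ + D * (1 / 2 - (p⁻¹).toReal))) *
            (b * ((Fintype.card (Eps D) * B ^ D) * 2 ^ ((j : ℝ) * D)) ^ (p⁻¹).toReal) := by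
            gcongr
        _ = c * ρ ^ j := by
            rw [Real.mul_rpow (by positivity) (by positivity), hc, hb, hρ,
              ← Real.rpow_mul two_pos.le, ← Real.rpow_natCast ((2 : ℝ) ^ (-(r - σ))) j,
              ← Real.rpow_mul two_pos.le, inv_pow, inv_pow, ← pow_mul,
              ← Real.rpow_natCast 2 (j * r), ← Real.rpow_neg two_pos.le]
            have e : (2 : ℝ) ^ ((j : ℝ) * (σ + D * (1 / 2 - (p⁻¹).toReal))) *
                (2 : ℝ) ^ (-((D : ℝ) * j / 2)) * (2 : ℝ) ^ (-((j * r : ℕ) : ℝ)) *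
                (2 : ℝ) ^ ((j : ℝ) * D * (p⁻¹).toReal) = (2 : ℝ) ^ (-(r - σ) * (j : ℝ)) := by
              rw [← Real.rpow_add two_pos, ← Real.rpow_add two_pos, ← Real.rpow_add two_pos]
              congr 1; push_cast; ring
            rw [← e]; ring
    · rintro ⟨e, k⟩ hk
      have hk' : k ∉ latticeBox D R |W.A| j := fun h => hk (by simpa using h)
      have := mul_scaled_eq_zero hR (boxSupp_mother W e) hk'
      simp [coeffMother, this]
    · rintro ⟨e, k⟩
      rw [coeffMother, ← integral_mul_mother_eq, Real.enorm_eq_ofReal_abs]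
      refine ENNReal.ofReal_le_ofReal ((hb₂ e j k).trans ?_)
      rw [hb]; gcongr; exact hCe e

/-- A finite linear combination of the wavelets of type `e` at level `J`. -/
def waveletSum {K : Type*} [Fintype K] (J : ℕ) (e : Eps D) (κ : K → Fin D → ℤ) (a : K → ℝ) :
    E D → ℝ := fun x => ∑ m, a m * scaled (J : ℤ) (κ m) (motherRep W e) x

section WaveletSum

variable {K : Type*} [Fintype K] (J : ℕ) (e : Eps D) (κ : K → Fin D → ℤ) (a : K → ℝ)

theorem continuous_waveletSum : Continuous (waveletSum W J e κ a) :=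
  continuous_finsetSum _ fun m _ =>
    continuous_const.mul (continuous_scaled (continuous_motherRep W e) J (κ m))

theorem hasCompactSupport_scaled_motherRep (k : Fin D → ℤ) :
    HasCompactSupport (scaled (J : ℤ) k (motherRep W e)) :=
  hasCompactSupport_scaled (hasCompactSupport_motherRep W e) J k

theorem integrable_scaled_motherRep (k : Fin D → ℤ) :
    Integrable (scaled (J : ℤ) k (motherRep W e)) :=
  (continuous_scaled (continuous_motherRep W e) J k).integrable_of_hasCompactSupport
    (hasCompactSupport_scaled_motherRep W J e k)

theorem integral_scaled_motherRep (k : Fin D → ℤ) :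
    ∫ x, scaled (J : ℤ) k (motherRep W e) x = 0 := by
  have h := integral_scaled J k (fun _ => (1 : ℝ)) (motherRep W e)
  simpa [integral_motherRep W e] using h

theorem integrable_waveletSum : Integrable (waveletSum W J e κ a) :=
  integrable_finsetSum _ fun m _ => (integrable_scaled_motherRep W J e (κ m)).const_mul _

theorem integral_waveletSum : ∫ x, waveletSum W J e κ a x = 0 := by
  unfold waveletSum
  rw [integral_finsetSum _ fun m _ => (integrable_scaled_motherRep W J e (κ m)).const_mul _]
  simp [integral_const_mul, integral_scaled_motherRep W J e]

theorem integral_waveletSum_mul {g : E D → ℝ} (hg : LocallyIntegrable g volume) :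
    ∫ x, waveletSum W J e κ a x * g x =
      ∑ m, a m * ∫ x, scaled (J : ℤ) (κ m) (motherRep W e) x * g x := by
  simp only [waveletSum, Finset.sum_mul, mul_assoc]
  rw [integral_finsetSum]
  · simp_rw [integral_const_mul]
  · intro m _
    have := (integrable_motherRep W g hg J (κ m) e).const_mul (a m)
    simpa only [mul_comm] using this

theorem integral_motherRep_mul (k l : Fin D → ℤ) (e' : Eps D) (j : ℕ) :
    ∫ x, scaled (J : ℤ) k (motherRep W e) x * scaled (j : ℤ) l (motherRep W e') x =
      if J = j ∧ e = e' ∧ k = l then 1 else 0 := by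
  have h1 := coeff_mother_mother W J j (e, k) (e', l)
  rw [← integral_mul_mother_eq] at h1
  simp_rw [mul_comm (scaled (J : ℤ) _ (W.ψ _) _)] at h1
  have h2 := integral_mul_mother_eq W (scaled (j : ℤ) l (motherRep W e')) J (e, k)
  dsimp only at h1 h2
  rw [← h2] at h1
  simp_rw [mul_comm (scaled (j : ℤ) _ _ _)] at h1
  rw [h1]
  simp

theorem coeffFather_waveletSum (k : Fin D → ℤ) : coeffFather W (waveletSum W J e κ a) k = 0 := by
  have hg : Continuous fun x => W.φ (x - latt k) := by
    have := continuous_father W; fun_prop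
  rw [coeffFather, integral_waveletSum_mul W J e κ a hg.locallyIntegrable]
  refine Finset.sum_eq_zero fun m _ => ?_
  have h1 := coeff_father_mother W k J (e, κ m)
  rw [← integral_mul_mother_eq] at h1
  simp_rw [mul_comm (scaled (J : ℤ) _ _ _)]
  rw [h1, mul_zero]

theorem coeffMother_waveletSum (j : ℕ) (ek : Eps D × (Fin D → ℤ)) :
    coeffMother W (waveletSum W J e κ a) j ek =
      ∑ m, a m * if J = j ∧ e = ek.1 ∧ κ m = ek.2 then 1 else 0 := by
  rw [coeffMother, ← integral_mul_mother_eq, integral_waveletSum_mul W J e κ a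
    (continuous_scaled (continuous_motherRep W ek.1) j ek.2).locallyIntegrable]
  simp_rw [integral_motherRep_mul]

/-- Only level `J` contributes, so `q` plays no role. Injectivity of `κ` prevents coefficients from
piling up on one wavelet. -/
theorem besovNorm_waveletSum_le {σ : ℝ} {p q : ℝ≥0∞} (hp : 1 ≤ p) (hq : 1 ≤ q)
    (hκ : Function.Injective κ) {b : ℝ} (hb0 : 0 ≤ b) (ha : ∀ m, |a m| ≤ b) {S : Finset K}
    (hS : ∀ m ∉ S, a m = 0) :
    besovNorm W σ p q (waveletSum W J e κ a) ≤
      ENNReal.ofReal ((2 : ℝ) ^ ((J : ℝ) * (σ + D * (1 / 2 - (p⁻¹).toReal))) *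
        (b * (S.card : ℝ) ^ (p⁻¹).toReal)) := by
  classical
  have hip : 0 ≤ (p⁻¹).toReal := ENNReal.toReal_nonneg
  have h0 : ∀ {ι : Type} {t : ℝ≥0∞} (_ : 1 ≤ t) (f : ι → ℝ≥0∞) (_ : ∀ i, f i = 0),
      seqNorm t f = 0 := fun ht f hf => by
    simpa using seqNorm_le_card ht (S := ∅) (b := 0) (fun i _ => hf i) (fun i => (hf i).le)
  have hzero : ∀ (m : K) (ek : Eps D × (Fin D → ℤ)), κ m = ek.2 → ∀ m',
      (a m' * if J = J ∧ e = ek.1 ∧ κ m' = ek.2 then 1 else 0)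
      = if m' = m then (a m * if e = ek.1 then 1 else 0) else 0 := by
    rintro m ek h m'
    by_cases hm : m' = m
    · subst hm; simp [h]
    · have : κ m' ≠ ek.2 := fun h' => hm (hκ (h'.trans h.symm))
      simp [hm, this]
  have hlevel : seqNorm p (fun ek => ‖coeffMother W (waveletSum W J e κ a) J ek‖ₑ) ≤
      ENNReal.ofReal b * (S.card : ℝ≥0∞) ^ (p⁻¹).toReal := by
    have := seqNorm_le_card hp (a := fun ek => ‖coeffMother W (waveletSum W J e κ a) J ek‖ₑ)
      (S := S.image fun m => (e, κ m)) (b := ENNReal.ofReal b) ?_ ?_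
    · refine this.trans ?_
      gcongr
      exact Finset.card_image_le
    · intro ek hek
      rw [coeffMother_waveletSum, Finset.sum_eq_zero, enorm_zero]
      intro m _
      by_cases hm : m ∈ S
      · rw [if_neg, mul_zero]
        rintro ⟨-, h1, h2⟩
        exact hek (Finset.mem_image.2 ⟨m, hm, Prod.ext h1 h2⟩)
      · rw [hS m hm, zero_mul]
    · intro ek
      rw [coeffMother_waveletSum, Real.enorm_eq_ofReal_abs]
      refine ENNReal.ofReal_le_ofReal ?_
      by_cases h : ∃ m, κ m = ek.2
      · obtain ⟨m, hm⟩ := h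
        rw [Finset.sum_congr rfl fun m' _ => hzero m ek hm m', Finset.sum_ite_eq' Finset.univ m,
          if_pos (Finset.mem_univ m)]
        split_ifs
        · simpa using ha m
        · simpa using hb0
      · push Not at h
        rw [Finset.sum_eq_zero fun m _ => by rw [if_neg fun h' => h m h'.2.2, mul_zero]]
        simpa using hb0
  rw [besovNorm, h0 hp _ fun k => by rw [coeffFather_waveletSum, enorm_zero], zero_add]
  have := seqNorm_le_card hq (a := fun j : ℕ => (2 : ℝ≥0∞) ^
      ((j : ℝ) * (σ + D * (1 / 2 - (p⁻¹).toReal))) *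
        seqNorm p fun ek => ‖coeffMother W (waveletSum W J e κ a) j ek‖ₑ) (S := {J})
    (b := (2 : ℝ≥0∞) ^ ((J : ℝ) * (σ + D * (1 / 2 - (p⁻¹).toReal))) *
      (ENNReal.ofReal b * (S.card : ℝ≥0∞) ^ (p⁻¹).toReal)) ?_ ?_
  · refine this.trans (le_of_eq ?_)
    rw [Finset.card_singleton, Nat.cast_one, ENNReal.one_rpow, mul_one,
      ← ENNReal.ofReal_natCast, ENNReal.ofReal_rpow_of_nonneg (by positivity) hip,
      ← ENNReal.ofReal_mul hb0, show (2 : ℝ≥0∞) = ENNReal.ofReal 2 by simp,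
      ENNReal.ofReal_rpow_of_pos two_pos, ← ENNReal.ofReal_mul (by positivity)]
  · intro j hj
    rw [Finset.mem_singleton] at hj
    rw [h0 hp, mul_zero]
    intro ek
    rw [coeffMother_waveletSum, Finset.sum_eq_zero, enorm_zero]
    intro m _
    rw [if_neg fun h => hj h.1.symm, mul_zero]
  · intro j
    by_cases hj : j = J
    · subst hj; gcongr
    · rw [h0 hp, mul_zero]
      · exact zero_le
      intro ek
      rw [coeffMother_waveletSum, Finset.sum_eq_zero, enorm_zero]
      intro m _
      rw [if_neg fun h => hj h.1.symm, mul_zero]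

end WaveletSum

end

/-! ### Uniqueness of wavelet coefficients and the base density. -/

section

variable {D r : ℕ} (W : WaveletMRA D r)

theorem boxSupp_scaled {g : E D → ℝ} {A : ℝ} (hg : BoxSupp g A) (j : ℕ) (k : Fin D → ℤ) :
    ∃ R, 0 ≤ R ∧ BoxSupp (scaled (j : ℤ) k g) R :=
  boxSupp_of_hasCompactSupport (hasCompactSupport_scaled hg.hasCompactSupport j k)

/-- If all coefficients of `g` vanish, then so do its pairings with the father wavelets of every
level. -/
theorem integral_mul_father_eq_zero {g : E D → ℝ} (hg : LocallyIntegrable g volume)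
    (hα : ∀ k, coeffFather W g k = 0) (hβ : ∀ j ek, coeffMother W g j ek = 0) (j : ℕ)
    (k : Fin D → ℤ) : ∫ x, g x * scaled (j : ℤ) k W.φ x = 0 := by
  induction j generalizing k with
  | zero => simpa [scaled_zero, coeffFather] using hα k
  | succ j ih =>
    obtain ⟨R, -, hR⟩ := boxSupp_scaled (boxSupp_father W) (j + 1) k
    have hrep := represents_father W (j + 1) k
    push_cast at hrep hR ⊢
    set B := latticeBox D R |W.A| j
    -- The expansion of a level-`j + 1` father wavelet in level-`j` functions is finite, so it may
    -- be paired with `g` term by term although `g` need not be in `L²`.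
    have hexp := (W.mother j).ae_eq_sum hrep (S := B.disjSum (Finset.univ ×ˢ B)) ?_
    · set c := fun i => ∫ y, scaled ((j : ℤ) + 1) k W.φ y * (Sum.elim
        (fun k : Fin D → ℤ => scaled j k W.φ)
        (fun ek : Eps D × (Fin D → ℤ) => scaled j ek.2 (W.ψ ek.1))) i y with hc
      have h1 : ∫ x, g x * scaled ((j : ℤ) + 1) k W.φ x = ∫ x,
          ∑ i ∈ B.disjSum (Finset.univ ×ˢ B), c i * (g x * (Sum.elim
            (fun k : Fin D → ℤ => scaled j k W.φ)
            (fun ek : Eps D × (Fin D → ℤ) => scaled j ek.2 (W.ψ ek.1))) i x) := by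
        refine integral_congr_ae ?_
        filter_upwards [hexp] with x hx
        rw [hx, Finset.mul_sum]
        exact Finset.sum_congr rfl fun i _ => by rw [hc]; ring
      rw [h1, integral_finsetSum]
      · refine Finset.sum_eq_zero fun i _ => ?_
        rw [integral_const_mul]
        rcases i with l | ek
        · simp only [Sum.elim_inl]
          rw [ih l, mul_zero]
        · have := hβ j ek
          rw [coeffMother] at this
          simp only [Sum.elim_inr]
          rw [this, mul_zero]
      · rintro (l | ek) _
        · exact (integrable_father W g hg j l).const_mul _
        · refine ((integrable_motherRep W g hg j ek.2 ek.1).congr ?_).const_mul _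
          filter_upwards [scaled_congr (motherRep_ae_eq W ek.1) j ek.2] with x hx
          rw [hx]; rfl
    · rintro (l | ⟨e, l⟩) hl
      · have hl' : l ∉ B := fun h => hl (Finset.inl_mem_disjSum.2 h)
        have := mul_scaled_eq_zero hR (boxSupp_father W) hl'
        simp [this]
      · have hl' : l ∉ B := fun h => hl (Finset.inr_mem_disjSum.2 (by simpa using h))
        have := mul_scaled_eq_zero hR (boxSupp_mother W e) hl'
        simp [this]

theorem norm_le_of_abs_le {x : E D} {b : ℝ} (h : ∀ i, |x i| ≤ b) : ‖x‖ ≤ D * b := by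
  have h1 : x = ∑ i, EuclideanSpace.single i (x i) := by
    ext l; simp [Finset.sum_apply, Pi.single_apply]
  rw [h1]
  calc _ ≤ ∑ _i : Fin D, b := norm_sum_le_of_le _ fun i _ => by simpa using h i
    _ = D * b := by simp

/-- At a Lebesgue point `y`, the zero pairing of `g` with a level-`j` father wavelet near `y` bounds
`|g y ∫ φ|` by a constant times the average of `|g - g y|` over a ball of radius of order `2^{-j}`.
The average tends to zero and `∫ φ ≠ 0`. -/
theorem ae_eq_zero_of_coeff {g : E D → ℝ} (hg : LocallyIntegrable g volume)
    (hα : ∀ k, coeffFather W g k = 0) (hβ : ∀ j ek, coeffMother W g j ek = 0) :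
    g =ᵐ[volume] 0 := by
  have hφc := continuous_father W
  obtain ⟨B, hB⟩ := hφc.bounded_above_of_compact_support (boxSupp_father W).hasCompactSupport
  -- The ball of radius `M 2^{-j}` about the chosen lattice point contains both the rescaled support
  -- of `φ` and the point `y`, which is within one lattice step in each coordinate.
  set M : ℝ := D * (|W.A| + 1) + 1 with hM
  have hM0 : 0 < M := by positivity
  filter_upwards [IsUnifLocDoublingMeasure.ae_tendsto_average_norm_sub volume hg 1] with y hy
  set k : ℕ → Fin D → ℤ := fun j i => ⌊(2 : ℝ) ^ j * y i⌋ with hk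
  set w : ℕ → E D := fun j => ((2 : ℝ)⁻¹ ^ j) • latt (k j) with hw
  set δ : ℕ → ℝ := fun j => M * (2 : ℝ)⁻¹ ^ j with hδ
  have hδ0 : ∀ j, 0 < δ j := fun j => by positivity
  have h2 : ∀ j : ℕ, (2 : ℝ)⁻¹ ^ j * 2 ^ j = 1 := fun j => by
    rw [← mul_pow, inv_mul_cancel₀ two_ne_zero, one_pow]
  have hnorm : ∀ (j : ℕ) (x : E D), x - w j = ((2 : ℝ)⁻¹ ^ j) • ((2 : ℝ) ^ j • x - latt (k j)) :=
    fun j x => by rw [smul_sub, smul_smul, h2, one_smul]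
  have hclose : ∀ (j : ℕ) (x : E D), (∀ i, |((2 : ℝ) ^ j • x - latt (k j)) i| ≤ |W.A| + 1) →
      x ∈ Metric.closedBall (w j) (δ j) := fun j x hx => by
    rw [mem_closedBall_iff_norm, hnorm, norm_smul, Real.norm_of_nonneg (by positivity)]
    calc _ ≤ (2 : ℝ)⁻¹ ^ j * M := by
          gcongr
          linarith [norm_le_of_abs_le hx]
      _ = δ j := mul_comm _ _
  have hlim := hy (l := atTop) w δ (tendsto_nhdsWithin_iff.2 ⟨by
      have := (tendsto_pow_atTop_nhds_zero_of_lt_one (by norm_num)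
        (by norm_num : (2 : ℝ)⁻¹ < 1)).const_mul M
      rwa [mul_zero] at this, Eventually.of_forall hδ0⟩)
    (Eventually.of_forall fun j => by
      rw [one_mul]
      refine hclose j y fun i => ?_
      simp only [latt, PiLp.sub_apply, PiLp.smul_apply, smul_eq_mul, hk]
      rw [abs_le]
      constructor <;> linarith [Int.floor_le ((2 : ℝ) ^ j * y i),
        Int.lt_floor_add_one ((2 : ℝ) ^ j * y i), abs_nonneg W.A])
  set v := (volume (Metric.ball (0 : E D) 1)).toReal with hv
  have hbound : ∀ j : ℕ, |g y * ∫ x, W.φ x| ≤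
      B * (M ^ D * v) * ⨍ x in Metric.closedBall (w j) (δ j), ‖g x - g y‖ := by
    intro j
    set F : E D → ℝ := fun x => W.φ ((2 : ℝ) ^ j • x - latt (k j)) with hF
    have hFs : scaled (j : ℤ) (k j) W.φ = fun x => (2 : ℝ) ^ ((D : ℝ) * j / 2) * F x :=
      funext (scaled_nat j (k j) W.φ)
    have hFc : Continuous F := by fun_prop
    have hFcs : HasCompactSupport F := by
      have := hasCompactSupport_scaled (boxSupp_father W).hasCompactSupport j (k j)
      rw [hFs] at this
      have h3 := this.mul_left (f := fun _ => ((2 : ℝ) ^ ((D : ℝ) * j / 2))⁻¹)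
      have h4 : (fun _ => ((2 : ℝ) ^ ((D : ℝ) * j / 2))⁻¹) *
          (fun x => (2 : ℝ) ^ ((D : ℝ) * j / 2) * F x) = F := by
        funext x
        rw [Pi.mul_apply, inv_mul_cancel_left₀ (by positivity)]
      rwa [h4] at h3
    have hgF : ∫ x, g x * F x = 0 := by
      have := integral_mul_father_eq_zero W hg hα hβ j (k j)
      rw [hFs] at this
      simp only [mul_left_comm (g _)] at this
      rw [integral_const_mul] at this
      exact (mul_eq_zero.1 this).resolve_left (by positivity)
    have hFint : ∫ x, F x = ((2 : ℝ) ^ (j * D))⁻¹ * ∫ x, W.φ x := by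
      rw [hF, Measure.integral_comp_smul volume (fun x => W.φ (x - latt (k j))),
        integral_sub_right_eq_self, finrank_euclideanSpace_fin, smul_eq_mul, ← pow_mul,
        abs_of_pos (by positivity)]
    have hFsupp : ∀ x ∉ Metric.closedBall (w j) (δ j), F x = 0 := fun x hx => by
      by_contra h
      exact hx (hclose j x fun i => (boxSupp_father W _ h i).trans (by linarith))
    have hgi : Integrable fun x => g x * F x := integrable_mul_of_compact hg hFc hFcs
    have hFi : Integrable F := hFc.integrable_of_hasCompactSupport hFcs
    have e1 : ∫ x, (g x - g y) * F x = -(g y * ∫ x, F x) := by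
      simp_rw [sub_mul]
      rw [integral_sub hgi (hFi.const_mul _), hgF, integral_const_mul, zero_sub]
    have hK : IntegrableOn (fun x => ‖g x - g y‖) (Metric.closedBall (w j) (δ j)) volume :=
      ((hg.integrableOn_isCompact (isCompact_closedBall _ _)).sub
        (integrableOn_const (by exact measure_closedBall_lt_top.ne))).norm
    have e2 : |∫ x, (g x - g y) * F x| ≤
        B * ∫ x in Metric.closedBall (w j) (δ j), ‖g x - g y‖ := by
      rw [← setIntegral_eq_integral_of_forall_compl_eq_zero (s := Metric.closedBall (w j) (δ j))
        fun x hx => by rw [hFsupp x hx, mul_zero], ← integral_const_mul]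
      refine abs_integral_le_integral_abs.trans (integral_mono_of_nonneg
        (Eventually.of_forall fun x => abs_nonneg _) (hK.const_mul B)
        (Eventually.of_forall fun x => ?_))
      dsimp only
      rw [abs_mul, mul_comm, Real.norm_eq_abs]
      gcongr
      exact hB _
    have hvol : (volume (Metric.closedBall (w j) (δ j))).toReal =
        M ^ D * ((2 : ℝ) ^ (j * D))⁻¹ * v := by
      rw [Measure.addHaar_closedBall _ _ (hδ0 j).le, ENNReal.toReal_mul,
        ENNReal.toReal_ofReal (by positivity), finrank_euclideanSpace_fin, hδ, mul_pow, ← pow_mul,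
        inv_pow]
    have hvpos : 0 < (volume (Metric.closedBall (w j) (δ j))).toReal :=
      ENNReal.toReal_pos (Metric.measure_closedBall_pos volume _ (hδ0 j)).ne'
        measure_closedBall_lt_top.ne
    rw [setAverage_eq, smul_eq_mul, Measure.real]
    have h2j : (0 : ℝ) < 2 ^ (j * D) := by positivity
    have e3 : |g y * ∫ x, W.φ x| = 2 ^ (j * D) * |∫ x, (g x - g y) * F x| := by
      rw [e1, hFint, abs_neg, mul_left_comm, abs_mul _ (g y * _), abs_of_pos (inv_pos.2 h2j),
        mul_inv_cancel_left₀ h2j.ne']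
    rw [e3]
    have hv0 : v ≠ 0 := by
      intro h0; rw [hvol, h0, mul_zero] at hvpos; exact lt_irrefl _ hvpos
    calc _ ≤ 2 ^ (j * D) * (B * ∫ x in Metric.closedBall (w j) (δ j), ‖g x - g y‖) := by gcongr
      _ = _ := by
        rw [hvol]
        field_simp
  have h0 : |g y * ∫ x, W.φ x| ≤ 0 := by
    have := hlim.const_mul (B * (M ^ D * v))
    rw [mul_zero] at this
    exact ge_of_tendsto' this hbound
  have h1 := abs_eq_zero.1 (le_antisymm h0 (abs_nonneg _))
  exact (mul_eq_zero.1 h1).resolve_right (integral_father_ne_zero W)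

/-- Since `ENNReal.ofReal` sends nonpositive radii to `0`, this excludes such radii for a nonempty
class of densities. -/
theorem besovNorm_ne_zero {σ : ℝ} {p q : ℝ≥0∞} (hp : 1 ≤ p) (hq : 1 ≤ q) {g : E D → ℝ}
    (hg : Integrable g) (hg1 : ∫ x, g x = 1) : besovNorm W σ p q g ≠ 0 := by
  intro h
  rw [besovNorm, add_eq_zero] at h
  have h0 := ae_eq_zero_of_coeff W hg.locallyIntegrable
    (fun k => by simpa using seqNorm_eq_zero hp h.1 k)
    (fun j ek => by
      have h1 := (mul_eq_zero.1 (seqNorm_eq_zero hq h.2 j)).resolve_left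
        (ENNReal.rpow_pos two_pos ENNReal.ofNat_ne_top).ne'
      simpa using seqNorm_eq_zero hp h1 ek)
  rw [integral_congr_ae h0] at hg1
  simp at hg1

/-- A density in the interior of the Besov ball that is bounded below on a ball inside the sample
space. -/
theorem exists_base_density {X : Set (E D)} (hX : (interior X).Nonempty) {σ : ℝ} {p q : ℝ≥0∞}
    (hp : 1 ≤ p) (hq : 1 ≤ q) (hσ : σ < r) {L : ℝ}
    (hL : ∃ L' < L, (densities W X σ p q L').Nonempty) :
    ∃ (g : E D → ℝ) (L₁ κ ρ : ℝ) (x₀ : E D), 0 ≤ L₁ ∧ L₁ < L ∧ 0 < κ ∧ 0 < ρ ∧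
      g ∈ densities W X σ p q L₁ ∧ ∀ x ∈ Metric.closedBall x₀ ρ, x ∈ X ∧ κ ≤ g x := by
  obtain ⟨L', hL', f, ⟨hfl, hfn⟩, hf0, hfX, hfi, hf1⟩ := hL
  have hL'0 : 0 < L' := by
    by_contra h
    rw [ENNReal.ofReal_of_nonpos (not_lt.1 h)] at hfn
    exact besovNorm_ne_zero W hp hq hfi hf1 (le_antisymm hfn zero_le)
  obtain ⟨x₀, hx₀⟩ := hX
  obtain ⟨R, hR, hRX⟩ := Metric.isOpen_iff.1 isOpen_interior x₀ hx₀
  let b : ContDiffBump x₀ := ⟨R / 2, R, half_pos hR, half_lt_self hR⟩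
  set h := b.normed volume with hh
  have hhc : ContDiff ℝ r h := b.contDiff_normed
  have hhs : HasCompactSupport h := b.hasCompactSupport_normed
  have hK := besovNorm_ne_top W (p := p) (q := q) hp hq hσ hhc hhs
  set K := (besovNorm W σ p q h).toReal with hKdef
  have hK0 : 0 ≤ K := ENNReal.toReal_nonneg
  have hKe : besovNorm W σ p q h = ENNReal.ofReal K := (ENNReal.ofReal_toReal hK).symm
  -- The weight of the bump is small enough that `t K ≤ (L - L')/2`, so the mixture has norm at most
  -- the midpoint `(L' + L)/2`.
  set t := min 1 ((L - L') / (2 * (K + 1))) with ht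
  have ht0 : 0 < t := lt_min one_pos (div_pos (by linarith) (by linarith))
  have ht1 : t ≤ 1 := min_le_left _ _
  have htK : t * K ≤ (L - L') / 2 := by
    calc t * K ≤ (L - L') / (2 * (K + 1)) * K := by gcongr; exact min_le_right _ _
      _ ≤ (L - L') / (2 * (K + 1)) * (K + 1) := by
        refine mul_le_mul_of_nonneg_left (by linarith) ?_
        exact div_nonneg (by linarith) (by linarith)
      _ = (L - L') / 2 := by field_simp
  have hhi : Integrable h := hhc.continuous.integrable_of_hasCompactSupport hhs
  refine ⟨fun x => (1 - t) * f x + t * h x, (L' + L) / 2, t * (1 / ∫ x, b x), R / 2, x₀,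
    by linarith, by linarith, ?_, half_pos hR, ⟨⟨?_, ?_⟩, ?_, ?_, ?_, ?_⟩, ?_⟩
  · exact mul_pos ht0 (one_div_pos.2 b.integral_pos)
  · exact ((hfi.const_mul _).add (hhi.const_mul _)).locallyIntegrable
  · refine (besovNorm_add_mul_le W hp hq hfl hhi.locallyIntegrable _ _).trans ?_
    rw [Real.enorm_eq_ofReal (by linarith), Real.enorm_eq_ofReal ht0.le, hKe]
    calc _ ≤ ENNReal.ofReal (1 - t) * ENNReal.ofReal L' + ENNReal.ofReal t * ENNReal.ofReal K := by
          gcongr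
      _ ≤ ENNReal.ofReal ((L' + L) / 2) := by
          rw [← ENNReal.ofReal_mul (by linarith), ← ENNReal.ofReal_mul ht0.le,
            ← ENNReal.ofReal_add (mul_nonneg (by linarith) hL'0.le) (by positivity)]
          refine ENNReal.ofReal_le_ofReal ?_
          nlinarith
  · exact fun x => add_nonneg (mul_nonneg (by linarith) (hf0 x))
      (mul_nonneg ht0.le (b.nonneg_normed x))
  · intro x hx
    have hx2 : x ∉ Metric.ball x₀ R := fun h' => hx (interior_subset (hRX h'))
    have : h x = 0 := by
      rw [← Function.notMem_support, hh, b.support_normed_eq]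
      exact hx2
    simp only [hfX x hx, this]; simp
  · exact (hfi.const_mul _).add (hhi.const_mul _)
  · rw [integral_add (hfi.const_mul _) (hhi.const_mul _), integral_const_mul, integral_const_mul,
      hf1, hh, b.integral_normed]
    ring
  · intro x hx
    refine ⟨interior_subset (hRX (Metric.closedBall_subset_ball (half_lt_self hR) hx)), ?_⟩
    have : h x = 1 / ∫ x, b x := by
      rw [hh, b.normed_def, b.one_of_mem_closedBall hx]
    have h2 := mul_nonneg (by linarith : 0 ≤ 1 - t) (hf0 x)
    dsimp only
    rw [this]
    linarith

end

/-! ### Packing of wavelets and minimax bounds at a fixed level. -/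

section

variable {D r : ℕ}

/-- Lattice points at level `J` whose wavelets are supported in a given ball, with pairwise disjoint
supports. -/
theorem exists_packing {η : E D → ℝ} {a : ℝ} (hη : BoxSupp η a) (hD : 0 < D)
    (x₀ : E D) {ρ : ℝ} (hρ : 0 < ρ) :
    ∃ (θ : ℝ) (J₀ : ℕ), 0 < θ ∧ ∀ J ≥ J₀, ∃ N : ℕ, θ * 2 ^ J ≤ N ∧ N ≤ 2 * θ * 2 ^ J ∧
      ∃ κ : (Fin D → Fin N) → Fin D → ℤ, Function.Injective κ ∧
        (∀ m x, scaled (J : ℤ) (κ m) η x ≠ 0 → x ∈ Metric.closedBall x₀ ρ) ∧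
        ∀ m l, m ≠ l → ∀ x, scaled (J : ℤ) (κ m) η x * scaled (J : ℤ) (κ l) η x = 0 := by
  obtain ⟨A, hA⟩ := exists_nat_ge a
  have hD' : (0 : ℝ) < D := by exact_mod_cast hD
  -- In coordinates scaled by `2^J`, the grid together with the supports reaches at most
  -- `8θ(A+1)2^J` from the centre. This `θ` makes each coordinate deviation at most `ρ/D`.
  set θ : ℝ := ρ / (8 * D * (A + 1)) with hθ
  have hθ0 : 0 < θ := by positivity
  have hθe : θ * (8 * D * (A + 1)) = ρ := by rw [hθ]; field_simp
  -- From level `J₀` on, `θ 2^J ≥ 1`, so rounding `2θ 2^J` down still leaves at least `θ 2^J`.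
  obtain ⟨J₀, hJ₀⟩ := pow_unbounded_of_one_lt (1 / θ) (one_lt_two (α := ℝ))
  refine ⟨θ, J₀, hθ0, fun J hJ => ?_⟩
  have hJ1 : 1 ≤ θ * 2 ^ J := by
    have h1 : (2 : ℝ) ^ J₀ ≤ 2 ^ J := pow_le_pow_right₀ one_le_two hJ
    have h2 := (div_lt_iff₀ hθ0).1 (hJ₀.trans_le h1)
    linarith
  set N := ⌊2 * θ * (2 : ℝ) ^ J⌋₊ with hN
  have hN1 : (N : ℝ) ≤ 2 * θ * 2 ^ J := Nat.floor_le (by positivity)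
  have hN2 : θ * 2 ^ J ≤ N := by
    have := Nat.lt_floor_add_one (2 * θ * (2 : ℝ) ^ J)
    rw [← hN] at this
    linarith
  -- Spacing `2(A+1)` exceeds the support width `2A`, which gives disjointness.
  refine ⟨N, hN2, hN1, fun m i => ⌊(2 : ℝ) ^ J * x₀ i⌋ + 2 * (A + 1) * (m i : ℕ), ?_, ?_, ?_⟩
  · intro m l h
    ext i
    have h1 := congrFun h i
    simp only [add_right_inj] at h1
    have h2 : ((m i : ℕ) : ℤ) = (l i : ℕ) := mul_left_cancel₀ (by positivity) h1
    exact_mod_cast h2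
  · intro m x hx
    rw [scaled_nat] at hx
    have h1 := hη _ (right_ne_zero_of_mul hx)
    have h2J : (0 : ℝ) < 2 ^ J := by positivity
    rw [mem_closedBall_iff_norm]
    have h2 : ∀ i, |(x - x₀) i| ≤ ρ / D := by
      intro i
      have h3 := abs_le.1 ((h1 i).trans hA)
      simp only [latt, PiLp.sub_apply, PiLp.smul_apply, smul_eq_mul] at h3
      push_cast at h3
      have h4 := Int.floor_le ((2 : ℝ) ^ J * x₀ i)
      have h5 := Int.lt_floor_add_one ((2 : ℝ) ^ J * x₀ i)
      have h6 : ((m i : ℕ) : ℝ) + 1 ≤ N := by exact_mod_cast (m i).2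
      have h7 : (0 : ℝ) ≤ ((m i : ℕ) : ℝ) := Nat.cast_nonneg _
      have h8 : (0 : ℝ) ≤ A := Nat.cast_nonneg _
      rw [PiLp.sub_apply, le_div_iff₀ hD', ← hθe]
      have h9 : |(2 : ℝ) ^ J * (x i - x₀ i)| ≤ 4 * (A + 1) * (2 * θ * 2 ^ J) := by
        have h10 : (2 : ℝ) * (A + 1) * (m i : ℕ) ≤ 2 * (A + 1) * (2 * θ * 2 ^ J) := by
          gcongr; linarith
        have h11 : (A + 1 : ℝ) ≤ 2 * (A + 1) * (2 * θ * 2 ^ J) := by nlinarith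
        rw [abs_le]
        constructor <;> nlinarith
      rw [abs_mul, abs_of_pos h2J] at h9
      have h10 : |x i - x₀ i| ≤ θ * (8 * (A + 1)) := by
        refine le_of_mul_le_mul_left ?_ h2J
        linarith
      calc |x i - x₀ i| * D ≤ θ * (8 * (A + 1)) * D := by gcongr
        _ = _ := by ring
    calc ‖x - x₀‖ ≤ D * (ρ / D) := norm_le_of_abs_le h2
      _ = ρ := by field_simp
  · intro m l hml x
    by_contra h
    rw [scaled_nat, scaled_nat] at h
    have h1 := hη _ (right_ne_zero_of_mul (left_ne_zero_of_mul h))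
    have h2 := hη _ (right_ne_zero_of_mul (right_ne_zero_of_mul h))
    refine hml (funext fun i => Fin.ext ?_)
    have h3 := abs_le.1 ((h1 i).trans hA)
    have h4 := abs_le.1 ((h2 i).trans hA)
    simp only [latt, PiLp.sub_apply, PiLp.smul_apply, smul_eq_mul] at h3 h4
    push_cast at h3 h4
    have h8 : (0 : ℝ) ≤ A := Nat.cast_nonneg _
    rcases lt_trichotomy (m i : ℕ) (l i : ℕ) with h | h | h
    · have h5 : ((m i : ℕ) : ℝ) + 1 ≤ (l i : ℕ) := by exact_mod_cast h
      nlinarith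
    · exact h
    · have h5 : ((l i : ℕ) : ℝ) + 1 ≤ (m i : ℕ) := by exact_mod_cast h
      nlinarith

variable (W : WaveletMRA D r)

section Level

variable {K : Type} {J : ℕ} {e : Eps D} {κ : K → Fin D → ℤ}

/-- The centred coefficients of an estimate. -/
def estCoeff (J : ℕ) (e : Eps D) (κ : K → Fin D → ℤ) (g₀ : E D → ℝ) (ν : SignedMeasure (E D))
    (m : K) : ℝ :=
  VectorMeasure.integral ν (scaled (J : ℤ) (κ m) (motherRep W e)) (ContinuousLinearMap.lsmul ℝ ℝ) -
    ∫ x, scaled (J : ℤ) (κ m) (motherRep W e) x * g₀ x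

theorem exists_bound_scaled (k : Fin D → ℤ) :
    ∃ M, ∀ x, |scaled (J : ℤ) k (motherRep W e) x| ≤ M :=
  (continuous_scaled (continuous_motherRep W e) J k).bounded_above_of_compact_support
    (hasCompactSupport_scaled_motherRep W J e k)

theorem measurable_estCoeff {g₀ : E D → ℝ} {n : ℕ} {T : (Fin n → E D) → SignedMeasure (E D)}
    (hT : T ∈ estimators D n) (m : K) :
    Measurable fun x => estCoeff W J e κ g₀ (T x) m := by
  obtain ⟨M, hM⟩ := exists_bound_scaled W (J := J) (e := e) (κ m)
  exact (measurable_signed_integral hT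
    (continuous_scaled (continuous_motherRep W e) J (κ m)).measurable hM).sub_const _

variable [Fintype K]

theorem waveletSum_single [DecidableEq K] (m : K) (c : ℝ) :
    waveletSum W J e κ (Pi.single m c) = fun x => c * scaled (J : ℤ) (κ m) (motherRep W e) x := by
  ext x
  rw [waveletSum, Finset.sum_eq_single m]
  · simp
  · intro l _ hl; simp [hl]
  · simp

/-- Disjointness leaves at most one nonzero term at each point, so the supremum does not grow with
the number of wavelets. -/
theorem abs_waveletSum_le
    (hdisj : ∀ m l, m ≠ l → ∀ x, scaled (J : ℤ) (κ m) (motherRep W e) x *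
      scaled (J : ℤ) (κ l) (motherRep W e) x = 0) {B : ℝ}
    (hB : ∀ m x, |scaled (J : ℤ) (κ m) (motherRep W e) x| ≤ B) {a : K → ℝ} {γ : ℝ}
    (ha : ∀ m, |a m| ≤ γ) (hγ : 0 ≤ γ * B) (x : E D) : |waveletSum W J e κ a x| ≤ γ * B := by
  by_cases h : ∃ m, scaled (J : ℤ) (κ m) (motherRep W e) x ≠ 0
  · obtain ⟨m, hm⟩ := h
    rw [waveletSum, Finset.sum_eq_single m, abs_mul]
    · exact mul_le_mul (ha m) (hB m x) (abs_nonneg _) ((abs_nonneg _).trans (ha m))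
    · intro l _ hl
      rw [(mul_eq_zero.1 (hdisj l m hl x)).resolve_right hm, mul_zero]
    · simp
  · push Not at h
    simpa [waveletSum, h] using hγ

theorem waveletSum_ne_zero {a : K → ℝ} {x : E D} (h : waveletSum W J e κ a x ≠ 0) :
    ∃ m, scaled (J : ℤ) (κ m) (motherRep W e) x ≠ 0 := by
  obtain ⟨m, -, hm⟩ := Finset.exists_ne_zero_of_sum_ne_zero h
  exact ⟨m, right_ne_zero_of_mul hm⟩

variable {g₀ : E D → ℝ} {X : Set (E D)} {σ : ℝ} {p q : ℝ≥0∞} {L₁ L k₀ ρ : ℝ} {x₀ : E D}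

/-- The perturbation lives where `g₀ ≥ k₀` and is bounded by `k₀`, which preserves positivity. It
has mean zero, and its Besov norm uses only the slack `L - L₁`. -/
theorem add_waveletSum_mem_densities (hp : 1 ≤ p) (hq : 1 ≤ q)
    (hL₁ : 0 ≤ L₁) (hL : L₁ ≤ L) (hg : g₀ ∈ densities W X σ p q L₁)
    (hball : ∀ x ∈ Metric.closedBall x₀ ρ, x ∈ X ∧ k₀ ≤ g₀ x)
    (hκb : ∀ m x, scaled (J : ℤ) (κ m) (motherRep W e) x ≠ 0 → x ∈ Metric.closedBall x₀ ρ)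
    {a : K → ℝ} (ha : ∀ x, |waveletSum W J e κ a x| ≤ k₀)
    (hbes : besovNorm W σ p q (waveletSum W J e κ a) ≤ ENNReal.ofReal (L - L₁)) :
    (fun x => g₀ x + waveletSum W J e κ a x) ∈ densities W X σ p q L := by
  obtain ⟨⟨hgl, hgn⟩, hg0, hgX, hgi, hg1⟩ := hg
  have hwi := integrable_waveletSum W J e κ a
  refine ⟨⟨(hgi.add hwi).locallyIntegrable, ?_⟩, fun x => ?_, fun x hx => ?_, hgi.add hwi, ?_⟩
  · have := besovNorm_add_mul_le W (σ := σ) hp hq hgl hwi.locallyIntegrable 1 1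
    simp only [one_mul, enorm_one] at this
    refine this.trans ((add_le_add hgn hbes).trans ?_)
    rw [← ENNReal.ofReal_add hL₁ (by linarith), add_sub_cancel]
  · by_cases h : waveletSum W J e κ a x = 0
    · simpa [h] using hg0 x
    · obtain ⟨m, hm⟩ := waveletSum_ne_zero W h
      have h1 := (hball x (hκb m x hm)).2
      have h2 := (abs_le.1 (ha x)).1
      linarith
  · have h : waveletSum W J e κ a x = 0 := by
      by_contra h
      obtain ⟨m, hm⟩ := waveletSum_ne_zero W h
      exact hx (hball x (hκb m x hm)).1
    simp only [h, hgX x hx, add_zero]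
  · rw [integral_add hgi hwi, hg1, integral_waveletSum, add_zero]

theorem waveletSum_mem_discriminators {a : K → ℝ}
    (hbes : besovNorm W σ p q (waveletSum W J e κ a) ≤ ENNReal.ofReal L) :
    waveletSum W J e κ a ∈ discriminators W σ p q L := by
  have hc := continuous_waveletSum W J e κ a
  have hcs : HasCompactSupport (waveletSum W J e κ a) := by
    refine HasCompactSupport.intro (K := ⋃ m, tsupport (scaled (J : ℤ) (κ m) (motherRep W e)))
      (isCompact_iUnion fun m => hasCompactSupport_scaled_motherRep W J e (κ m)) fun x hx => ?_
    refine Finset.sum_eq_zero fun m _ => ?_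
    rw [image_eq_zero_of_notMem_tsupport fun h => hx (Set.mem_iUnion.2 ⟨m, h⟩), mul_zero]
  exact ⟨⟨hc.locallyIntegrable, hbes⟩, hc.measurable, hc.bounded_above_of_compact_support hcs⟩

/-- Orthonormality makes the pairing of the discriminator with the perturbation equal to `∑ u_m
a_m`. The base density is absorbed by the centring in `estCoeff`. -/
theorem le_ipm (hκ : Function.Injective κ) (hg : LocallyIntegrable g₀ volume)
    {F : Set (E D → ℝ)} {u a : K → ℝ} (hu : waveletSum W J e κ u ∈ F) (ν : SignedMeasure (E D)) :
    ENNReal.ofReal |∑ m, u m * (a m - estCoeff W J e κ g₀ ν m)| ≤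
      ipm F (fun x => g₀ x + waveletSum W J e κ a x) ν := by
  classical
  refine le_trans (le_of_eq ?_) (le_iSup₂ (f := fun f (_ : f ∈ F) => ENNReal.ofReal
    |(∫ x, f x * (g₀ x + waveletSum W J e κ a x)) -
      VectorMeasure.integral ν f (ContinuousLinearMap.lsmul ℝ ℝ)|) _ hu)
  congr 2
  have hcont := continuous_waveletSum W J e κ a
  have hI := integral_waveletSum_mul W J e κ u (hg.add hcont.locallyIntegrable)
  simp only [Pi.add_apply] at hI
  rw [hI]
  have h1 : ∀ m, ∫ x, scaled (J : ℤ) (κ m) (motherRep W e) x *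
      (g₀ x + waveletSum W J e κ a x) =
      (∫ x, scaled (J : ℤ) (κ m) (motherRep W e) x * g₀ x) + a m := by
    intro m
    have hc := continuous_scaled (continuous_motherRep W e) J (κ m)
    have hcs := hasCompactSupport_scaled_motherRep W J e (κ m)
    simp only [mul_add]
    have i1 : Integrable fun x => scaled (J : ℤ) (κ m) (motherRep W e) x * g₀ x := by
      simpa only [mul_comm] using integrable_mul_of_compact hg hc hcs
    have i2 : Integrable fun x => scaled (J : ℤ) (κ m) (motherRep W e) x *
        waveletSum W J e κ a x := by
      simpa only [mul_comm] using integrable_mul_of_compact hcont.locallyIntegrable hc hcs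
    rw [integral_add i1 i2]
    congr 1
    simp_rw [mul_comm (scaled (J : ℤ) _ _ _)]
    rw [integral_waveletSum_mul W J e κ a hc.locallyIntegrable]
    simp_rw [integral_motherRep_mul, hκ.eq_iff]
    simp
  have h2 : VectorMeasure.integral ν (waveletSum W J e κ u) (ContinuousLinearMap.lsmul ℝ ℝ) =
      ∑ m, u m * VectorMeasure.integral ν (scaled (J : ℤ) (κ m) (motherRep W e))
        (ContinuousLinearMap.lsmul ℝ ℝ) := by
    have e1 : waveletSum W J e κ u =
        fun x => ∑ m, (u m • scaled (J : ℤ) (κ m) (motherRep W e)) x := by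
      ext x; simp [waveletSum]
    rw [e1, VectorMeasure.integral_finsetSum]
    · simp_rw [VectorMeasure.integral_smul, smul_eq_mul]
    · intro m _
      obtain ⟨M, hM⟩ := exists_bound_scaled W (J := J) (e := e) (κ m)
      exact (integrable_signed ν
        (continuous_scaled (continuous_motherRep W e) J (κ m)).measurable hM).smul (u m)
  simp_rw [h1]
  rw [h2, ← Finset.sum_sub_distrib]
  exact Finset.sum_congr rfl fun m _ => by rw [estCoeff]; ring

theorem lintegral_le_iSup {F G : Set (E D → ℝ)} {n : ℕ} (T : (Fin n → E D) → SignedMeasure (E D))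
    {g : E D → ℝ} (hg : g ∈ G) {a : (Fin n → E D) → ℝ≥0∞} (ha : ∀ x, a x ≤ ipm F g (T x)) :
    ∫⁻ x, a x ∂(Measure.pi fun _ : Fin n => law g) ≤
      ⨆ g ∈ G, ∫⁻ x, ipm F g (T x) ∂(Measure.pi fun _ : Fin n => law g) :=
  (lintegral_mono ha).trans (le_iSup₂ (f := fun g (_ : g ∈ G) =>
    ∫⁻ x, ipm F g (T x) ∂(Measure.pi fun _ : Fin n => law g)) g hg)

theorem integral_sq_scaled_motherRep (k : Fin D → ℤ) (c : ℝ) :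
    ∫ x, (c * scaled (J : ℤ) k (motherRep W e) x) ^ 2 = c ^ 2 := by
  simp_rw [mul_pow, sq (scaled _ _ _ _)]
  rw [integral_const_mul, integral_motherRep_mul]
  simp

/-- Lower bound from single-wavelet perturbations of a base density. -/
theorem sparse_level_bound [Nonempty K] {σ' : ℝ} {p' q' : ℝ≥0∞} {L' : ℝ} (hp : 1 ≤ p) (hq : 1 ≤ q)
    (hL₁ : 0 ≤ L₁) (hL : L₁ ≤ L) (hg : g₀ ∈ densities W X σ p q L₁)
    (hball : ∀ x ∈ Metric.closedBall x₀ ρ, x ∈ X ∧ k₀ ≤ g₀ x) (hk₀ : 0 < k₀)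
    (hκ : Function.Injective κ)
    (hκb : ∀ m x, scaled (J : ℤ) (κ m) (motherRep W e) x ≠ 0 → x ∈ Metric.closedBall x₀ ρ)
    (hdisj : ∀ m l, m ≠ l → ∀ x, scaled (J : ℤ) (κ m) (motherRep W e) x *
      scaled (J : ℤ) (κ l) (motherRep W e) x = 0)
    {B γ γ' : ℝ} (hB : ∀ m x, |scaled (J : ℤ) (κ m) (motherRep W e) x| ≤ B)
    (hγ : 0 < γ) (hγ' : 0 < γ') (hγB : γ * B ≤ k₀)
    (hbes : ∀ (a : K → ℝ) (S : Finset K), S.card ≤ 1 → (∀ m ∉ S, a m = 0) → (∀ m, |a m| ≤ γ) →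
      besovNorm W σ p q (waveletSum W J e κ a) ≤ ENNReal.ofReal (L - L₁))
    (hbes' : ∀ (a : K → ℝ) (S : Finset K), S.card ≤ 1 → (∀ m ∉ S, a m = 0) → (∀ m, |a m| ≤ γ') →
      besovNorm W σ' p' q' (waveletSum W J e κ a) ≤ ENNReal.ofReal L') {n : ℕ}
    (hn : (1 + γ ^ 2 / k₀) ^ n ≤ 1 + (Fintype.card K : ℝ) / 4) :
    ENNReal.ofReal (γ * γ' / 8) ≤
      minimaxRisk (discriminators W σ' p' q' L') (densities W X σ p q L) n := by
  classical
  have hg' := hg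
  obtain ⟨⟨hgl, hgn⟩, hg0, hgX, hgi, hg1⟩ := hg'
  set F := discriminators W σ' p' q' L'
  set G := densities W X σ p q L
  refine le_iInf₂ fun T hT => ?_
  set R := ⨆ g ∈ G, ∫⁻ x, ipm F g (T x) ∂(Measure.pi fun _ : Fin n => law g) with hR
  have hsingle : ∀ (m : K) (c : ℝ), (∀ l ∉ ({m} : Finset K), (Pi.single m c : K → ℝ) l = 0) ∧
      ∀ l, |(Pi.single m c : K → ℝ) l| ≤ |c| := by
    intro m c
    refine ⟨fun l hl => ?_, fun l => ?_⟩
    · rw [Finset.mem_singleton] at hl; simp [hl]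
    · by_cases hl : l = m
      · subst hl; simp
      · simp [hl]
  have hF : ∀ m, waveletSum W J e κ (Pi.single m γ') ∈ F := fun m =>
    waveletSum_mem_discriminators W (hbes' _ {m} (by simp) (hsingle m γ').1
      fun l => ((hsingle m γ').2 l).trans (abs_of_pos hγ').le)
  have hB0 : ∀ m, 0 ≤ B := fun m => (abs_nonneg _).trans (hB m 0)
  have hv : ∀ m x, |waveletSum W J e κ (Pi.single m γ) x| ≤ k₀ := fun m x => by
    rw [waveletSum_single, abs_mul, abs_of_pos hγ]
    exact (mul_le_mul_of_nonneg_left (hB m x) hγ.le).trans hγB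
  have hG : ∀ m, (fun x => g₀ x + waveletSum W J e κ (Pi.single m γ) x) ∈ G := fun m =>
    add_waveletSum_mem_densities W hp hq hL₁ hL hg hball hκb (hv m)
      (hbes _ {m} (by simp) (hsingle m γ).1 fun l => ((hsingle m γ).2 l).trans (abs_of_pos hγ).le)
  have hG0 : g₀ ∈ G := ⟨⟨hgl, hgn.trans (ENNReal.ofReal_le_ofReal hL)⟩, hg0, hgX, hgi, hg1⟩
  set δ : ℝ≥0∞ := ENNReal.ofReal (γ' * (γ / 2)) with hδ
  -- The event that the estimate detects no perturbation. Off `A` the loss at `g₀` is at least `δ`;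
  -- on `A` the loss at every perturbed density is at least `δ`, since its coefficient `γ` is missed
  -- by at least `γ/2`.
  set A : Set (Fin n → E D) := {x | ∀ m, |estCoeff W J e κ g₀ (T x) m| < γ / 2} with hA
  have hAm : MeasurableSet A := by
    rw [hA, Set.ofPred_forall]
    exact MeasurableSet.iInter fun m => measurableSet_lt
      (continuous_abs.measurable.comp (measurable_estCoeff W hT m)) measurable_const
  have hsum : ∀ (a : K → ℝ) (m : K) (x : Fin n → E D),
      ∑ l, (Pi.single m γ' : K → ℝ) l * (a l - estCoeff W J e κ g₀ (T x) l) =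
        γ' * (a m - estCoeff W J e κ g₀ (T x) m) := by
    intro a m x
    rw [Finset.sum_eq_single m]
    · simp
    · intro l _ hl; simp [hl]
    · simp
  have hRa : ∫⁻ x, Aᶜ.indicator (fun _ => δ) x ∂(Measure.pi fun _ : Fin n => law g₀) ≤ R := by
    refine lintegral_le_iSup T hG0 fun x => ?_
    by_cases hx : x ∈ Aᶜ
    · rw [Set.indicator_of_mem hx]
      simp only [hA, Set.mem_compl_iff, Set.mem_ofPred_eq, not_forall, not_lt] at hx
      obtain ⟨m, hm⟩ := hx
      have h1 := le_ipm W hκ hgl (a := fun _ => 0) (hF m) (T x)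
      have h2 : (fun x => g₀ x + waveletSum W J e κ (fun _ => 0) x) = g₀ := by
        ext x; simp [waveletSum]
      rw [hsum, h2] at h1
      refine le_trans (ENNReal.ofReal_le_ofReal ?_) h1
      rw [zero_sub, abs_mul, abs_neg, abs_of_pos hγ']
      gcongr
    · rw [Set.indicator_of_notMem hx]; exact zero_le
  have hRb : ∀ m, ∫⁻ x, A.indicator (fun _ => δ) x ∂(Measure.pi fun _ : Fin n =>
      law fun y => g₀ y + waveletSum W J e κ (Pi.single m γ) y) ≤ R := by
    intro m
    refine lintegral_le_iSup T (hG m) fun x => ?_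
    by_cases hx : x ∈ A
    · rw [Set.indicator_of_mem hx]
      have h1 := le_ipm W hκ hgl (a := Pi.single m γ) (hF m) (T x)
      rw [hsum] at h1
      refine le_trans (ENNReal.ofReal_le_ofReal ?_) h1
      rw [abs_mul, abs_of_pos hγ', Pi.single_eq_same]
      gcongr
      have := abs_lt.1 (hx m)
      exact le_trans (by linarith) (le_abs_self _)
    · rw [Set.indicator_of_notMem hx]; exact zero_le
  have main := mixture_bound hgi hg0 hg1 hk₀ (v := fun m => waveletSum W J e κ (Pi.single m γ))
    (fun m => (continuous_waveletSum W J e κ _).measurable)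
    (fun m x hx => by
      obtain ⟨l, hl⟩ := waveletSum_ne_zero W hx
      exact (hball x (hκb l x hl)).2)
    hv (fun m => integrable_waveletSum W J e κ _) (fun m => integral_waveletSum W J e κ _)
    (fun m l hml x => by
      rw [waveletSum_single, waveletSum_single, mul_mul_mul_comm, hdisj m l hml x, mul_zero])
    (U := γ ^ 2) (fun m => by
      rw [waveletSum_single, integral_sq_scaled_motherRep]) hn
    (a := Aᶜ.indicator fun _ => δ) (b := A.indicator fun _ => δ)
    (measurable_const.indicator hAm.compl) (measurable_const.indicator hAm) (δ := δ)
    (fun x => by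
      by_cases hx : x ∈ A
      · simp [hx]
      · simp [hx]) hRb
  have h2 : δ / 2 ≤ R + R := main.trans (add_le_add hRa le_rfl)
  have h3 : ENNReal.ofReal (γ * γ' / 8) * 4 ≤ R * 4 := by
    calc ENNReal.ofReal (γ * γ' / 8) * 4 = δ := by
          rw [hδ, show (4 : ℝ≥0∞) = ENNReal.ofReal 4 by simp, ← ENNReal.ofReal_mul (by positivity)]
          congr 1; ring
      _ ≤ (R + R) * 2 := (ENNReal.div_le_iff (by norm_num) (by norm_num)).1 h2
      _ = R * 4 := by ring
  exact (ENNReal.mul_le_mul_iff_left (by norm_num) (by norm_num)).1 h3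

/-- Lower bound from sign perturbations in all the wavelets at once. -/
theorem dense_level_bound {σ' : ℝ} {p' q' : ℝ≥0∞} {L' : ℝ} (hp : 1 ≤ p) (hq : 1 ≤ q)
    (hL₁ : 0 ≤ L₁) (hL : L₁ ≤ L) (hg : g₀ ∈ densities W X σ p q L₁)
    (hball : ∀ x ∈ Metric.closedBall x₀ ρ, x ∈ X ∧ k₀ ≤ g₀ x) (hk₀ : 0 < k₀)
    (hκ : Function.Injective κ)
    (hκb : ∀ m x, scaled (J : ℤ) (κ m) (motherRep W e) x ≠ 0 → x ∈ Metric.closedBall x₀ ρ)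
    (hdisj : ∀ m l, m ≠ l → ∀ x, scaled (J : ℤ) (κ m) (motherRep W e) x *
      scaled (J : ℤ) (κ l) (motherRep W e) x = 0)
    {B γ γ' : ℝ} (hB0 : 0 ≤ B) (hB : ∀ m x, |scaled (J : ℤ) (κ m) (motherRep W e) x| ≤ B)
    (hγ : 0 < γ) (hγ' : 0 < γ') (hγB : γ * B ≤ k₀ / 4)
    (hbes : ∀ (a : K → ℝ), (∀ m, |a m| ≤ γ) →
      besovNorm W σ p q (waveletSum W J e κ a) ≤ ENNReal.ofReal (L - L₁))
    (hbes' : ∀ (a : K → ℝ), (∀ m, |a m| ≤ γ') →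
      besovNorm W σ' p' q' (waveletSum W J e κ a) ≤ ENNReal.ofReal L') {n : ℕ}
    (hn : (1 + 8 * γ ^ 2 / k₀) ^ n ≤ 5 / 4) :
    ENNReal.ofReal (Fintype.card K * (γ * γ') / 2) ≤
      minimaxRisk (discriminators W σ' p' q' L') (densities W X σ p q L) n := by
  classical
  have hg' := hg
  obtain ⟨⟨hgl, hgn⟩, hg0, hgX, hgi, hg1⟩ := hg'
  set F := discriminators W σ' p' q' L'
  set G := densities W X σ p q L
  refine le_iInf₂ fun T hT => ?_
  set R := ⨆ g ∈ G, ∫⁻ x, ipm F g (T x) ∂(Measure.pi fun _ : Fin n => law g) with hR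
  let sg : Bool → ℝ := fun b => if b then 1 else -1
  have hsg : ∀ b, |sg b| = 1 := by intro b; cases b <;> simp [sg]
  set α : (K → Bool) → K → ℝ := fun s m => γ * sg (s m) with hα
  have hαγ : ∀ s m, |α s m| ≤ γ := fun s m => by rw [hα, abs_mul, hsg, mul_one, abs_of_pos hγ]
  -- A quarter of `k₀` leaves each perturbed density at least `k₀/2` on the ball, and a sign flip,
  -- twice as large, is still at most `k₀/2`.
  have hsup : ∀ s x, |waveletSum W J e κ (α s) x| ≤ k₀ / 4 := fun s x =>
    (abs_waveletSum_le W hdisj hB (hαγ s) (by positivity) x).trans hγB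
  have hG : ∀ s, (fun x => g₀ x + waveletSum W J e κ (α s) x) ∈ G := fun s =>
    add_waveletSum_mem_densities W hp hq hL₁ hL hg hball hκb
      (fun x => (hsup s x).trans (by linarith)) (hbes _ (hαγ s))
  set a : K → Bool → (Fin n → E D) → ℝ≥0∞ := fun m b x =>
    ENNReal.ofReal (γ' * |γ * sg b - estCoeff W J e κ g₀ (T x) m|) with ha
  have ham : ∀ m b, Measurable (a m b) := fun m b => by
    have := measurable_estCoeff W (J := J) (e := e) (κ := κ) (g₀ := g₀) hT m
    exact (measurable_const.mul (continuous_abs.measurable.comp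
      (measurable_const.sub this))).ennreal_ofReal
  have hflip : ∀ b, sg (!b) = -sg b := by intro b; cases b <;> simp [sg]
  have main := assouad (fun s => Measure.pi fun _ : Fin n =>
    law fun x => g₀ x + waveletSum W J e κ (α s) x) a ham (δ := ENNReal.ofReal (2 * (γ * γ')))
    (R := R) ?_ ?_
  · refine le_trans (le_of_eq ?_) main
    rw [ENNReal.ofReal_div_of_pos two_pos, ENNReal.ofReal_mul (Nat.cast_nonneg _),
      ENNReal.ofReal_natCast, ENNReal.ofReal_mul two_pos.le, ENNReal.ofReal_ofNat]
    rw [mul_left_comm, show (4 : ℝ≥0∞) = 2 * 2 by norm_num,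
      ENNReal.mul_div_mul_left _ _ (by norm_num) (by norm_num)]
  · intro s m
    obtain ⟨-, hp0, -, hpi, hp1⟩ := hG s
    -- Adding `c` times the `m`-th wavelet reverses its sign.
    set c := -2 * α s m with hc
    have hcabs : |c| = 2 * γ := by
      rw [hc, hα, abs_mul, abs_mul, hsg, abs_of_pos hγ]; norm_num
    have hcv : ∀ x, |waveletSum W J e κ (Pi.single m c) x| ≤ k₀ / 2 := fun x => by
      rw [waveletSum_single, abs_mul, hcabs]
      calc 2 * γ * |scaled (J : ℤ) (κ m) (motherRep W e) x| ≤ 2 * γ * B := by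
            gcongr; exact hB m x
        _ ≤ k₀ / 2 := by linarith
    have hnew : ∀ x, g₀ x + waveletSum W J e κ (α s) x + waveletSum W J e κ (Pi.single m c) x =
        g₀ x + waveletSum W J e κ (α (Function.update s m !(s m))) x := fun x => by
      rw [add_assoc, waveletSum, waveletSum, waveletSum, ← Finset.sum_add_distrib]
      congr 1
      refine Finset.sum_congr rfl fun l _ => ?_
      rw [← add_mul]
      congr 1
      by_cases hl : l = m
      · subst hl
        simp only [hc, hα, Pi.single_eq_same, Function.update_self, hflip]
        ring
      · simp [hα, hl]
    -- A mixture with one component is the plain two-point bound. Here `U = 4γ²` and the lower bound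
    -- `k₀/2` give the ratio `8γ²/k₀`.
    have hb := mixture_bound (n := n) hpi hp0 hp1 (half_pos hk₀) (K := Unit)
      (v := fun _ => waveletSum W J e κ (Pi.single m c))
      (fun _ => (continuous_waveletSum W J e κ _).measurable)
      (fun _ x hx => by
        obtain ⟨l, hl⟩ := waveletSum_ne_zero W hx
        have h1 := (hball x (hκb l x hl)).2
        have h2 := abs_le.1 (hsup s x)
        linarith [h2.1])
      (fun _ => hcv) (fun _ => integrable_waveletSum W J e κ _)
      (fun _ => integral_waveletSum W J e κ _)
      (fun k l hkl => absurd (Subsingleton.elim k l) hkl) (U := 4 * γ ^ 2)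
      (fun _ => by
        rw [waveletSum_single, integral_sq_scaled_motherRep, ← sq_abs, hcabs]
        exact le_of_eq (by ring))
      (by
        rw [Fintype.card_unit]
        have e1 : 4 * γ ^ 2 / (k₀ / 2) = 8 * γ ^ 2 / k₀ := by field_simp; ring
        rw [e1]
        exact hn.trans (by norm_num))
      (ham m (s m)) (ham m (!(s m))) (δ := ENNReal.ofReal (2 * (γ * γ')))
      (fun x => by
        rw [ha, ← ENNReal.ofReal_add (by positivity) (by positivity)]
        refine ENNReal.ofReal_le_ofReal ?_
        rw [← mul_add, hflip]
        set t := estCoeff W J e κ g₀ (T x) m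
        have h1 : 2 * γ ≤ |γ * sg (s m) - t| + |γ * -sg (s m) - t| := by
          calc 2 * γ = |(γ * sg (s m) - t) - (γ * -sg (s m) - t)| := by
                rw [show (γ * sg (s m) - t) - (γ * -sg (s m) - t) = 2 * γ * sg (s m) by ring,
                  abs_mul, hsg, mul_one, abs_of_pos (by positivity)]
            _ ≤ _ := abs_sub _ _
        nlinarith) (R := ∫⁻ x, a m (!(s m)) x ∂(Measure.pi fun _ : Fin n =>
          law fun x => g₀ x + waveletSum W J e κ (α (Function.update s m !(s m))) x))
      (fun _ => by simp_rw [hnew]; exact le_rfl)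
    exact hb
  · intro s
    refine lintegral_le_iSup T (hG s) fun x => ?_
    -- The discriminator may depend on the data because the supremum is inside the expectation.
    -- Matching the signs of the errors turns the pairing into a sum of absolute values.
    set u : K → ℝ := fun m => γ' * (SignType.sign (α s m - estCoeff W J e κ g₀ (T x) m) : ℝ) with hu
    have huγ : ∀ m, |u m| ≤ γ' := fun m => by
      rw [hu, abs_mul, abs_of_pos hγ']
      refine mul_le_of_le_one_right hγ'.le ?_
      rcases SignType.sign (α s m - estCoeff W J e κ g₀ (T x) m) <;> simp
    have h1 := le_ipm W hκ hgl (a := α s) (F := F)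
      (waveletSum_mem_discriminators W (hbes' u huγ)) (T x)
    refine le_trans (le_of_eq ?_) h1
    have h2 : ∀ m, u m * (α s m - estCoeff W J e κ g₀ (T x) m) =
        γ' * |α s m - estCoeff W J e κ g₀ (T x) m| := fun m => by
      rw [hu, mul_assoc, sign_mul_self]
    simp_rw [h2]
    rw [abs_of_nonneg (Finset.sum_nonneg fun m _ => by positivity),
      ENNReal.ofReal_sum_of_nonneg fun m _ => by positivity]

end Level

end

/-! ### Choice of the level and the two rates. -/

section

variable {D r : ℕ}

section Rates

variable (W : WaveletMRA D r)

theorem toReal_inv_le_one {p : ℝ≥0∞} (hp : 1 ≤ p) : (p⁻¹).toReal ≤ 1 := by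
  simpa only [ENNReal.toReal_one] using
    ENNReal.toReal_mono ENNReal.one_ne_top (ENNReal.inv_le_one.2 hp)

/-- With `M 2^{Ju}` coefficients of size `c 2^{-Jt}`, this `t` is the exponent at which all powers
of `2^J` cancel. The dense case takes `u = D`, the sparse case `u = 0`. The assumption `1 ≤ M`
allows `M^{1/p} ≤ M`. -/
theorem besovNorm_waveletSum_le_of_card_le {K : Type} [Fintype K] {J : ℕ} {e : Eps D}
    {κ : K → Fin D → ℤ} {σ : ℝ} {p q : ℝ≥0∞} (hp : 1 ≤ p) (hq : 1 ≤ q)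
    (hκ : Function.Injective κ) {c M u t L : ℝ} (hc : 0 ≤ c) (hM : 1 ≤ M) (hcM : c * M ≤ L)
    (ht : t = σ + D / 2 + (u - D) * (p⁻¹).toReal) {a : K → ℝ}
    (ha : ∀ m, |a m| ≤ c * (2 : ℝ) ^ (-(J * t))) {S : Finset K} (hS : ∀ m ∉ S, a m = 0)
    (hcard : (S.card : ℝ) ≤ M * (2 : ℝ) ^ (J * u)) :
    besovNorm W σ p q (waveletSum W J e κ a) ≤ ENNReal.ofReal L := by
  refine (besovNorm_waveletSum_le W J e κ a hp hq hκ (by positivity) ha hS).trans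
    (ENNReal.ofReal_le_ofReal (le_trans ?_ hcM))
  set w := (p⁻¹).toReal
  have hw0 : 0 ≤ w := ENNReal.toReal_nonneg
  have hw1 : w ≤ 1 := toReal_inv_le_one hp
  have h1 : (S.card : ℝ) ^ w ≤ M * (2 : ℝ) ^ (J * u * w) := by
    calc (S.card : ℝ) ^ w ≤ (M * (2 : ℝ) ^ (J * u)) ^ w :=
          Real.rpow_le_rpow (Nat.cast_nonneg _) hcard hw0
      _ = M ^ w * (2 : ℝ) ^ (J * u * w) := by
          rw [Real.mul_rpow (by positivity) (by positivity), ← Real.rpow_mul two_pos.le]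
      _ ≤ M * (2 : ℝ) ^ (J * u * w) := by
          gcongr
          calc M ^ w ≤ M ^ (1 : ℝ) := Real.rpow_le_rpow_of_exponent_le hM hw1
            _ = M := Real.rpow_one M
  calc (2 : ℝ) ^ ((J : ℝ) * (σ + D * (1 / 2 - w))) *
        (c * (2 : ℝ) ^ (-(J * t)) * (S.card : ℝ) ^ w)
      ≤ (2 : ℝ) ^ ((J : ℝ) * (σ + D * (1 / 2 - w))) *
        (c * (2 : ℝ) ^ (-(J * t)) * (M * (2 : ℝ) ^ (J * u * w))) := by gcongr
    _ = c * M * (2 : ℝ) ^ ((J : ℝ) * (σ + D * (1 / 2 - w)) + -(J * t) + J * u * w) := by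
        rw [Real.rpow_add two_pos, Real.rpow_add two_pos]; ring
    _ = c * M := by
        rw [show (J : ℝ) * (σ + D * (1 / 2 - w)) + -(J * t) + J * u * w = 0 by rw [ht]; ring,
          Real.rpow_zero, mul_one]

/-- At every fine level there is a grid of wavelets with disjoint supports inside a given ball. -/
theorem exists_wavelet_grid (hD : 0 < D) (x₀ : E D) {ρ : ℝ} (hρ : 0 < ρ) :
    ∃ (e : Eps D) (θ B : ℝ) (J₀ : ℕ), 0 < θ ∧ 0 < B ∧ ∀ J ≥ J₀, ∃ N : ℕ,
      θ * 2 ^ J ≤ N ∧ N ≤ 2 * θ * 2 ^ J ∧ ∃ κ : (Fin D → Fin N) → Fin D → ℤ,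
      Function.Injective κ ∧
      (∀ m x, scaled (J : ℤ) (κ m) (motherRep W e) x ≠ 0 → x ∈ Metric.closedBall x₀ ρ) ∧
      (∀ m l, m ≠ l → ∀ x, scaled (J : ℤ) (κ m) (motherRep W e) x *
        scaled (J : ℤ) (κ l) (motherRep W e) x = 0) ∧
      ∀ m x, |scaled (J : ℤ) (κ m) (motherRep W e) x| ≤ B * (2 : ℝ) ^ ((J : ℝ) * (D / 2)) := by
  -- Any nonzero index serves; the all-ones vector is nonzero because `D > 0`.
  let e : Eps D := ⟨fun _ => 1, fun h => by simpa using congrFun h ⟨0, hD⟩⟩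
  obtain ⟨R, hR0, hR⟩ := exists_boxSupp_motherRep W e
  obtain ⟨θ, J₀, hθ, h⟩ := exists_packing hR hD x₀ hρ
  obtain ⟨B, hB⟩ := (continuous_motherRep W e).bounded_above_of_compact_support hR.hasCompactSupport
  refine ⟨e, θ, max B 1, J₀, hθ, by positivity, fun J hJ => ?_⟩
  obtain ⟨N, h1, h2, κ, h3, h4, h5⟩ := h J hJ
  refine ⟨N, h1, h2, κ, h3, h4, h5, fun m x => ?_⟩
  rw [scaled, abs_mul, abs_of_pos (by positivity), mul_comm]
  refine mul_le_mul ((hB _).trans (le_max_left _ _)) (le_of_eq ?_) (by positivity) (by positivity)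
  congr 1; push_cast; ring

theorem one_add_pow_le_exp {x : ℝ} (hx : 0 ≤ x) (n : ℕ) : (1 + x) ^ n ≤ Real.exp (n * x) := by
  rw [Real.exp_nat_mul]
  exact pow_le_pow_left₀ (by positivity) (by linarith [Real.add_one_le_exp x]) n

variable {X : Set (E D)} {σg σd Lg Ld : ℝ} {pg qg pd qd : ℝ≥0∞}

/-- About `2^{JD}` coordinates each contribute `γγ' ~ 2^{-J(σg+σd+D)}`, and the bound on `n` keeps
`nγ²` bounded. -/
theorem dense_bound_of_level (hD : 0 < D) (hX : (interior X).Nonempty)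
    (hpg : 1 ≤ pg) (hqg : 1 ≤ qg) (hpd : 1 ≤ pd) (hqd : 1 ≤ qd) (hσg : 0 ≤ σg) (hσgr : σg < r)
    (hLd : 0 < Ld) (hLg : ∃ L' < Lg, (densities W X σg pg qg L').Nonempty) :
    ∃ C : ℝ, 0 < C ∧ ∃ J₀ : ℕ, ∀ J ≥ J₀, ∀ n : ℕ, (n : ℝ) ≤ (2 : ℝ) ^ (J * (2 * σg + D)) →
      ENNReal.ofReal (C * (2 : ℝ) ^ (-(J * (σg + σd)))) ≤
        minimaxRisk (discriminators W σd pd qd Ld) (densities W X σg pg qg Lg) n := by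
  obtain ⟨g₀, L₁, k₀, ρ, x₀, hL₁, hL, hk₀, hρ, hg, hball⟩ :=
    exists_base_density W hX hpg hqg hσgr hLg
  obtain ⟨e, θ, B, J₀, hθ, hB, hgrid⟩ := exists_wavelet_grid W hD x₀ hρ
  set M : ℝ := max 1 ((2 * θ) ^ D) with hM
  have hM1 : 1 ≤ M := le_max_left _ _
  have hM0 : 0 < M := by positivity
  -- The four constraints serve, in order, the Besov radius, the sup bound `k₀/4`, the inequality
  -- `c² ≤ c`, and the chi-square bound `8c²/k₀ ≤ 1/5`, used with `e^{1/5} ≤ 5/4`.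
  obtain ⟨c, hc0, hc⟩ : ∃ c : ℝ, 0 < c ∧
      c ≤ min (min ((Lg - L₁) / M) (k₀ / 4 / B)) (min 1 (k₀ / 40)) :=
    ⟨_, by have := sub_pos.2 hL; positivity, le_rfl⟩
  simp only [le_min_iff] at hc
  obtain ⟨⟨hc1, hc2⟩, hc3, hc4⟩ := hc
  rw [le_div_iff₀ hM0] at hc1
  rw [le_div_iff₀ hB] at hc2
  refine ⟨θ ^ D * c * (Ld / M) / 2, by positivity, J₀, fun J hJ n hn => ?_⟩
  obtain ⟨N, hN1, hN2, κ, hκ, hκb, hdisj, hκB⟩ := hgrid J hJ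
  have hcard : (Fintype.card (Fin D → Fin N) : ℝ) = (N : ℝ) ^ D := by simp
  have h2D : (2 : ℝ) ^ ((J : ℝ) * D) = ((2 : ℝ) ^ J) ^ D := by
    rw [Real.rpow_mul two_pos.le, Real.rpow_natCast, Real.rpow_natCast]
  have hcardM : ((Finset.univ : Finset (Fin D → Fin N)).card : ℝ) ≤
      M * (2 : ℝ) ^ ((J : ℝ) * D) := by
    rw [Finset.card_univ, hcard, h2D]
    calc (N : ℝ) ^ D ≤ (2 * θ * 2 ^ J) ^ D := by gcongr
      _ = (2 * θ) ^ D * (2 ^ J) ^ D := mul_pow _ _ _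
      _ ≤ M * (2 ^ J) ^ D := by gcongr; exact le_max_right _ _
  have hbound := dense_level_bound W (σ := σg) (σ' := σd) (p' := pd) (q' := qd) (L' := Ld) hpg hqg
    hL₁ hL.le hg hball hk₀ hκ hκb hdisj (B := B * (2 : ℝ) ^ ((J : ℝ) * (D / 2)))
    (γ := c * (2 : ℝ) ^ (-(J * (σg + D / 2)))) (γ' := Ld / M * (2 : ℝ) ^ (-(J * (σd + D / 2))))
    (by positivity) hκB (by positivity) (by positivity) ?_ ?_ ?_ (n := n) ?_
  · refine le_trans (ENNReal.ofReal_le_ofReal ?_) hbound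
    rw [hcard]
    have h1 : θ ^ D * (2 : ℝ) ^ ((J : ℝ) * D) ≤ (N : ℝ) ^ D := by
      rw [h2D, ← mul_pow]; gcongr
    calc θ ^ D * c * (Ld / M) / 2 * (2 : ℝ) ^ (-(J * (σg + σd)))
        = θ ^ D * (2 : ℝ) ^ ((J : ℝ) * D) * (c * (2 : ℝ) ^ (-(J * (σg + D / 2))) *
          (Ld / M * (2 : ℝ) ^ (-(J * (σd + D / 2))))) / 2 := by
          rw [show -((J : ℝ) * (σg + σd)) = J * D + -(J * (σg + D / 2)) + -(J * (σd + D / 2)) by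
            ring, Real.rpow_add two_pos, Real.rpow_add two_pos]
          ring
      _ ≤ _ := by gcongr
  · calc c * (2 : ℝ) ^ (-(J * (σg + D / 2))) * (B * (2 : ℝ) ^ ((J : ℝ) * (D / 2)))
        = c * B * (2 : ℝ) ^ (-(J * σg)) := by
          rw [show -((J : ℝ) * σg) = -(J * (σg + D / 2)) + J * (D / 2) by ring,
            Real.rpow_add two_pos]
          ring
      _ ≤ c * B * 1 := by
          gcongr
          exact Real.rpow_le_one_of_one_le_of_nonpos one_le_two (neg_nonpos.2 (by positivity))
      _ ≤ k₀ / 4 := by rwa [mul_one]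
  · exact fun a ha => besovNorm_waveletSum_le_of_card_le W hpg hqg hκ hc0.le hM1 hc1 (by ring) ha
      (S := Finset.univ) (by simp) hcardM
  · exact fun a ha => besovNorm_waveletSum_le_of_card_le W hpd hqd hκ (by positivity) hM1
      (div_mul_cancel₀ _ hM0.ne').le (by ring) ha (S := Finset.univ) (by simp) hcardM
  · have h1 : (n : ℝ) * (8 * (c * (2 : ℝ) ^ (-(J * (σg + D / 2)))) ^ 2 / k₀) ≤ 1 / 5 := by
      calc (n : ℝ) * (8 * (c * (2 : ℝ) ^ (-(J * (σg + D / 2)))) ^ 2 / k₀)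
          = n * (2 : ℝ) ^ (-(J * (2 * σg + D))) * (8 * c ^ 2 / k₀) := by
            rw [show -((J : ℝ) * (2 * σg + D)) = -(J * (σg + D / 2)) + -(J * (σg + D / 2)) by ring,
              Real.rpow_add two_pos]
            ring
        _ ≤ 1 * (8 * c ^ 2 / k₀) := by
            gcongr
            rw [Real.rpow_neg two_pos.le, ← div_eq_mul_inv]
            exact div_le_one_of_le₀ hn (by positivity)
        _ ≤ 1 / 5 := by
            rw [one_mul, div_le_iff₀ hk₀]
            nlinarith
    have h2 := Real.one_sub_le_exp_neg (1 / 5 : ℝ)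
    have h3 : Real.exp (1 / 5) ≤ 5 / 4 := by
      rw [Real.exp_neg] at h2
      have := (le_inv_comm₀ (by norm_num) (Real.exp_pos _)).1 h2
      exact this.trans (by norm_num)
    exact ((one_add_pow_le_exp (by positivity) n).trans (Real.exp_le_exp.2 h1)).trans h3

/-- The perturbations hide among about `2^{JD}` positions, so the likelihood ratio may have a second
moment of that order. The parameter `τ` stands for `γ²/k₀` up to its power of two and can be made
small through `c`. -/
theorem sparse_bound_of_level (hD : 0 < D) (hX : (interior X).Nonempty)
    (hpg : 1 ≤ pg) (hqg : 1 ≤ qg) (hpd : 1 ≤ pd) (hqd : 1 ≤ qd)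
    (hσg : (D : ℝ) * (pg⁻¹).toReal ≤ σg) (hσgr : σg < r)
    (hLd : 0 < Ld) (hLg : ∃ L' < Lg, (densities W X σg pg qg L').Nonempty) {τ : ℝ} (hτ : 0 < τ) :
    ∃ C θ : ℝ, 0 < C ∧ 0 < θ ∧ ∃ J₀ : ℕ, ∀ J ≥ J₀, ∀ n : ℕ,
      Real.exp (n * (τ * (2 : ℝ) ^ (-(J * (2 * σg + D - 2 * D * (pg⁻¹).toReal))))) ≤
        θ * (2 : ℝ) ^ ((J : ℝ) * D) →
      ENNReal.ofReal
        (C * (2 : ℝ) ^ (-(J * (σg + σd + D - D * (pg⁻¹).toReal - D * (pd⁻¹).toReal)))) ≤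
        minimaxRisk (discriminators W σd pd qd Ld) (densities W X σg pg qg Lg) n := by
  obtain ⟨g₀, L₁, k₀, ρ, x₀, hL₁, hL, hk₀, hρ, hg, hball⟩ :=
    exists_base_density W hX hpg hqg hσgr hLg
  obtain ⟨e, θ, B, J₀, hθ, hB, hgrid⟩ := exists_wavelet_grid W hD x₀ hρ
  set wg := (pg⁻¹).toReal
  set wd := (pd⁻¹).toReal
  obtain ⟨c, hc0, hc⟩ : ∃ c : ℝ, 0 < c ∧ c ≤ min (min (Lg - L₁) (k₀ / B)) (min 1 (k₀ * τ)) :=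
    ⟨_, by have := sub_pos.2 hL; positivity, le_rfl⟩
  simp only [le_min_iff] at hc
  obtain ⟨⟨hc1, hc2⟩, hc3, hc4⟩ := hc
  rw [le_div_iff₀ hB] at hc2
  refine ⟨c * Ld / 8, θ ^ D / 4, by positivity, by positivity, J₀, fun J hJ n hn => ?_⟩
  obtain ⟨N, hN1, hN2, κ, hκ, hκb, hdisj, hκB⟩ := hgrid J hJ
  have hcard : (Fintype.card (Fin D → Fin N) : ℝ) = (N : ℝ) ^ D := by simp
  have h2D : (2 : ℝ) ^ ((J : ℝ) * D) = ((2 : ℝ) ^ J) ^ D := by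
    rw [Real.rpow_mul two_pos.le, Real.rpow_natCast, Real.rpow_natCast]
  have hNpos : 0 < N := by
    have : (0 : ℝ) < N := lt_of_lt_of_le (by positivity) hN1
    exact_mod_cast this
  have : Nonempty (Fin N) := ⟨⟨0, hNpos⟩⟩
  have hone : ∀ S : Finset (Fin D → Fin N), S.card ≤ 1 →
      (S.card : ℝ) ≤ 1 * (2 : ℝ) ^ ((J : ℝ) * 0) := fun S hS => by
    rw [mul_zero, Real.rpow_zero, one_mul]; exact_mod_cast hS
  have hbound := sparse_level_bound W (σ := σg) (σ' := σd) (p' := pd) (q' := qd) (L' := Ld) hpg hqg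
    hL₁ hL.le hg hball hk₀ hκ hκb hdisj (B := B * (2 : ℝ) ^ ((J : ℝ) * (D / 2)))
    (γ := c * (2 : ℝ) ^ (-(J * (σg + D / 2 - D * wg))))
    (γ' := Ld * (2 : ℝ) ^ (-(J * (σd + D / 2 - D * wd))))
    hκB (by positivity) (by positivity) ?_ ?_ ?_ (n := n) ?_
  · refine le_trans (ENNReal.ofReal_le_ofReal (le_of_eq ?_)) hbound
    rw [show -((J : ℝ) * (σg + σd + D - D * wg - D * wd)) =
      -(J * (σg + D / 2 - D * wg)) + -(J * (σd + D / 2 - D * wd)) by ring, Real.rpow_add two_pos]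
    ring
  · calc c * (2 : ℝ) ^ (-(J * (σg + D / 2 - D * wg))) * (B * (2 : ℝ) ^ ((J : ℝ) * (D / 2)))
        = c * B * (2 : ℝ) ^ (-(J * (σg - D * wg))) := by
          rw [show -((J : ℝ) * (σg - D * wg)) = -(J * (σg + D / 2 - D * wg)) + J * (D / 2) by ring,
            Real.rpow_add two_pos]
          ring
      _ ≤ c * B * 1 := by
          gcongr
          -- Here `σg ≥ D/pg` enters: it keeps one large wavelet bounded uniformly in `J`.
          refine Real.rpow_le_one_of_one_le_of_nonpos one_le_two (neg_nonpos.2 ?_)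
          exact mul_nonneg (Nat.cast_nonneg _) (sub_nonneg.2 hσg)
      _ ≤ k₀ := by rwa [mul_one]
  · exact fun a S hS haS ha => besovNorm_waveletSum_le_of_card_le W hpg hqg hκ hc0.le le_rfl
      (by rwa [mul_one]) (by ring) ha haS (hone S hS)
  · exact fun a S hS haS ha => besovNorm_waveletSum_le_of_card_le W hpd hqd hκ hLd.le le_rfl
      (by rw [mul_one]) (by ring) ha haS (hone S hS)
  · refine (one_add_pow_le_exp (by positivity) n).trans ?_
    refine (Real.exp_le_exp.2 ?_).trans (hn.trans ?_)
    · gcongr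
      rw [div_le_iff₀ hk₀, show -((J : ℝ) * (2 * σg + D - 2 * D * wg)) =
        -(J * (σg + D / 2 - D * wg)) + -(J * (σg + D / 2 - D * wg)) by ring, Real.rpow_add two_pos]
      have : c ^ 2 ≤ τ * k₀ := by nlinarith
      calc (c * (2 : ℝ) ^ (-(J * (σg + D / 2 - D * wg)))) ^ 2
          = c ^ 2 * ((2 : ℝ) ^ (-(J * (σg + D / 2 - D * wg))) *
            (2 : ℝ) ^ (-(J * (σg + D / 2 - D * wg)))) := by ring
        _ ≤ τ * k₀ * ((2 : ℝ) ^ (-(J * (σg + D / 2 - D * wg))) *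
            (2 : ℝ) ^ (-(J * (σg + D / 2 - D * wg)))) := by gcongr
        _ = _ := by ring
    · rw [hcard, h2D]
      have : θ ^ D * (2 ^ J) ^ D ≤ (N : ℝ) ^ D := by rw [← mul_pow]; gcongr
      linarith

/-- Every `y ≥ 1` is within a constant factor of a power `2^{Js}` from below. -/
theorem exists_dyadic_level {s : ℝ} (hs : 0 < s) {y : ℝ} (hy : 1 ≤ y) :
    ∃ J : ℕ, y ≤ (2 : ℝ) ^ (J * s) ∧ (2 : ℝ) ^ (J * s) ≤ 2 ^ s * y := by
  have hy0 : 0 < y := by positivity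
  have hl : 0 ≤ Real.logb 2 y / s := div_nonneg (Real.logb_nonneg one_lt_two hy) hs.le
  refine ⟨⌈Real.logb 2 y / s⌉₊, ?_, ?_⟩
  · rw [← Real.logb_le_iff_le_rpow one_lt_two hy0, ← div_le_iff₀ hs]
    exact Nat.le_ceil _
  · rw [← Real.le_logb_iff_rpow_le one_lt_two (by positivity),
      Real.logb_mul (by positivity) hy0.ne', Real.logb_rpow two_pos (by norm_num)]
    have := (Nat.ceil_lt_add_one hl).le
    calc (⌈Real.logb 2 y / s⌉₊ : ℝ) * s ≤ (Real.logb 2 y / s + 1) * s := by gcongr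
      _ = s + Real.logb 2 y := by field_simp; ring

/-- Passage from dyadic levels to rates: `2^{-Jt}` against `y^{-t/s}` for `2^{Js}` of order `y`. -/
theorem rate_le_of_dyadic_level {s t y : ℝ} {J : ℕ} (hs : 0 < s) (ht : 0 ≤ t) (hy : 0 < y)
    (hJ : (2 : ℝ) ^ (J * s) ≤ 2 ^ s * y) :
    (2 : ℝ) ^ (-t) * y ^ (-(t / s)) ≤ (2 : ℝ) ^ (-(J * t)) := by
  have h1 := Real.rpow_le_rpow_of_nonpos (z := -(t / s)) (by positivity) hJ
    (neg_nonpos.2 (by positivity))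
  rw [Real.mul_rpow (by positivity) hy.le, ← Real.rpow_mul two_pos.le,
    ← Real.rpow_mul two_pos.le] at h1
  rwa [show s * -(t / s) = -t by field_simp, show (J : ℝ) * s * -(t / s) = -(J * t) by
    field_simp] at h1

theorem le_of_two_rpow_ge {s : ℝ} {J J₀ : ℕ} (hs : 0 < s)
    (h : (2 : ℝ) ^ (J₀ * s) ≤ (2 : ℝ) ^ (J * s)) : J₀ ≤ J := by
  rw [Real.rpow_le_rpow_left_iff one_lt_two, mul_le_mul_iff_left₀ hs] at h
  exact_mod_cast h

theorem dense_rate (hD : 0 < D) (hX : (interior X).Nonempty)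
    (hpg : 1 ≤ pg) (hqg : 1 ≤ qg) (hpd : 1 ≤ pd) (hqd : 1 ≤ qd) (hσg : 0 ≤ σg) (hσgr : σg < r)
    (hσd : 0 ≤ σd) (hLd : 0 < Ld) (hLg : ∃ L' < Lg, (densities W X σg pg qg L').Nonempty) :
    ∃ c : ℝ, 0 < c ∧ ∀ᶠ n : ℕ in atTop,
      ENNReal.ofReal (c * (n : ℝ) ^ (-((σg + σd) / (2 * σg + D)))) ≤
        minimaxRisk (discriminators W σd pd qd Ld) (densities W X σg pg qg Lg) n := by
  obtain ⟨C, hC, J₀, h⟩ := dense_bound_of_level W (σd := σd) hD hX hpg hqg hpd hqd hσg hσgr hLd hLg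
  have hs : 0 < 2 * σg + D := by positivity
  refine ⟨C * 2 ^ (-(σg + σd)), by positivity, ?_⟩
  filter_upwards [tendsto_natCast_atTop_atTop.eventually_ge_atTop ((2 : ℝ) ^ (J₀ * (2 * σg + D))),
    eventually_ge_atTop 1] with n hn1 hn2
  have hn3 : (1 : ℝ) ≤ n := by exact_mod_cast hn2
  obtain ⟨J, hJ1, hJ2⟩ := exists_dyadic_level hs hn3
  refine le_trans (ENNReal.ofReal_le_ofReal ?_) (h J (le_of_two_rpow_ge hs (hn1.trans hJ1)) n hJ1)
  rw [mul_assoc]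
  gcongr
  exact rate_le_of_dyadic_level hs (by positivity) (by positivity) hJ2

/-- A strictly larger power of `n` absorbs the logarithm and any constant. -/
theorem eventually_rpow_le_div_log {a b c : ℝ} (hab : a < b) (hc : 0 < c) :
    ∀ᶠ n : ℕ in atTop, (n : ℝ) ^ a ≤ c * (n / Real.log n) ^ b := by
  have h1 := (isLittleO_log_rpow_rpow_atTop b (sub_pos.2 hab)).bound hc
  filter_upwards [tendsto_natCast_atTop_atTop.eventually h1, eventually_ge_atTop 3] with n hn hn3
  have hn0 : (0 : ℝ) < n := by positivity
  have hn1 : (1 : ℝ) < n := by exact_mod_cast (by omega : 1 < n)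
  have hl := Real.log_pos hn1
  rw [Real.norm_of_nonneg (by positivity), Real.norm_of_nonneg (by positivity)] at hn
  rw [Real.div_rpow hn0.le hl.le, mul_div_assoc', le_div_iff₀ (by positivity)]
  calc (n : ℝ) ^ a * Real.log n ^ b ≤ n ^ a * (c * n ^ (b - a)) := by gcongr
    _ = c * n ^ b := by
      rw [mul_left_comm, ← Real.rpow_add hn0, add_sub_cancel]

theorem sparse_rate (hD : 0 < D) (hX : (interior X).Nonempty)
    (hpg : 1 ≤ pg) (hqg : 1 ≤ qg) (hpd : 1 ≤ pd) (hqd : 1 ≤ qd)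
    (hσg : (D : ℝ) * (pg⁻¹).toReal ≤ σg) (hσgr : σg < r)
    (hσd : 0 ≤ σd) (hLd : 0 < Ld) (hLg : ∃ L' < Lg, (densities W X σg pg qg L').Nonempty) :
    ∃ c : ℝ, 0 < c ∧ ∀ᶠ n : ℕ in atTop,
      ENNReal.ofReal (c * (Real.log n / n) ^
          ((σg + σd + D - D * (pg⁻¹).toReal - D * (pd⁻¹).toReal) /
            (2 * σg + D - 2 * D * (pg⁻¹).toReal))) ≤
        minimaxRisk (discriminators W σd pd qd Ld) (densities W X σg pg qg Lg) n := by
  have hD' : (0 : ℝ) < D := by exact_mod_cast hD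
  have hwd := toReal_inv_le_one hpd
  set s := 2 * σg + D - 2 * D * (pg⁻¹).toReal with hs_def
  have hs : 0 < s := by linarith
  -- For `2^{Js} ≥ n / log n` this `τ` bounds the exponential by `n^{D/(2s)}`, while the right side
  -- is at least `θ (n / log n)^{D/s}`. Halving the exponent leaves room for the logarithm and for
  -- `θ`.
  obtain ⟨C, θ, hC, hθ, J₀, h⟩ := sparse_bound_of_level W (σd := σd) hD hX hpg hqg hpd hqd hσg hσgr
    hLd hLg (τ := D / (2 * s)) (by positivity)
  set t := σg + σd + D - D * (pg⁻¹).toReal - D * (pd⁻¹).toReal with ht_def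
  -- Nonnegativity uses `σg ≥ D/pg`, `σd ≥ 0` and `1/pd ≤ 1`; it fixes the direction of the passage
  -- from levels to rates.
  have ht : 0 ≤ t := by nlinarith
  refine ⟨C * 2 ^ (-t), by positivity, ?_⟩
  have hlin : ∀ M : ℝ, 0 < M → ∀ᶠ n : ℕ in atTop, M ≤ n / Real.log n := by
    intro M hM
    filter_upwards [eventually_rpow_le_div_log (a := 1 / 2) (b := 1) (c := 1) (by norm_num)
      one_pos, ((tendsto_rpow_atTop (y := 1 / 2) (by norm_num)).comp
        tendsto_natCast_atTop_atTop).eventually_ge_atTop M] with n h1 h2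
    rw [one_mul, Real.rpow_one] at h1
    exact le_trans h2 h1
  filter_upwards [hlin _ (show (0 : ℝ) < 2 ^ (J₀ * s) by positivity), hlin 1 one_pos,
    eventually_rpow_le_div_log (a := D / (2 * s)) (b := D / s)
      (by gcongr; linarith) hθ, eventually_ge_atTop 2] with n hn1 hn2 hn3 hn4
  have hn0 : (0 : ℝ) < n := by positivity
  have hl : 0 < Real.log n := Real.log_pos (by exact_mod_cast hn4)
  obtain ⟨J, hJ1, hJ2⟩ := exists_dyadic_level hs hn2
  refine le_trans (ENNReal.ofReal_le_ofReal ?_)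
    (h J (le_of_two_rpow_ge hs (hn1.trans hJ1)) n ?_)
  · rw [mul_assoc]
    gcongr
    refine le_trans (le_of_eq ?_) (rate_le_of_dyadic_level hs ht (by positivity) hJ2)
    congr 1
    rw [Real.rpow_neg (x := n / Real.log n) (by positivity),
      ← Real.inv_rpow (x := n / Real.log n) (by positivity), inv_div]
  · calc Real.exp (n * (D / (2 * s) * (2 : ℝ) ^ (-(J * s))))
        ≤ Real.exp (n * (D / (2 * s) * (Real.log n / n))) := by
          gcongr
          rw [Real.rpow_neg two_pos.le, ← inv_div (n : ℝ)]
          gcongr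
      _ = (n : ℝ) ^ (D / (2 * s)) := by
          rw [Real.rpow_def_of_pos hn0]
          congr 1; field_simp
      _ ≤ θ * (n / Real.log n) ^ (D / s) := hn3
      _ ≤ θ * ((2 : ℝ) ^ (J * s)) ^ (D / s) := by gcongr
      _ = θ * (2 : ℝ) ^ ((J : ℝ) * D) := by
          rw [← Real.rpow_mul two_pos.le]
          congr 2; field_simp

end Rates

end

end BesovIPM

end

theorem theorem1 (D r : ℕ) (hD : 0 < D) (W : BesovIPM.WaveletMRA D r)
    (X : Set (BesovIPM.E D)) (hX : (interior X).Nonempty)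
    (σg σd : ℝ) (pg qg pd qd : ℝ≥0∞)
    (hpg : 1 ≤ pg) (hqg : 1 ≤ qg) (hpd : 1 ≤ pd) (hqd : 1 ≤ qd)
    (hσg : (D : ℝ) * (pg⁻¹).toReal ≤ σg) (hσgr : σg < r)
    (hσd : 0 ≤ σd) (hσdr : σd < r)
    (Lg Ld : ℝ) (hLd : 0 < Ld)
    (hLg : ∃ L' < Lg, (BesovIPM.densities W X σg pg qg L').Nonempty) :
    ∃ c : ℝ, 0 < c ∧ ∀ᶠ n : ℕ in atTop,
      ENNReal.ofReal (c * max
        ((n : ℝ) ^ (-((σg + σd) / (2 * σg + D))))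
        ((Real.log n / n) ^
          ((σg + σd + D - D * (pg⁻¹).toReal - D * (pd⁻¹).toReal) /
            (2 * σg + D - 2 * D * (pg⁻¹).toReal)))) ≤
      BesovIPM.minimaxRisk
        (BesovIPM.discriminators W σd pd qd Ld)
        (BesovIPM.densities W X σg pg qg Lg) n := by
  have hσg0 : 0 ≤ σg := le_trans (by positivity) hσg
  obtain ⟨c₁, hc₁, h₁⟩ :=
    BesovIPM.dense_rate W hD hX hpg hqg hpd hqd hσg0 hσgr hσd hLd hLg
  obtain ⟨c₂, hc₂, h₂⟩ :=
    BesovIPM.sparse_rate W hD hX hpg hqg hpd hqd hσg hσgr hσd hLd hLg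
  refine ⟨min c₁ c₂, lt_min hc₁ hc₂, ?_⟩
  filter_upwards [h₁, h₂] with n hn₁ hn₂
  rw [mul_max_of_nonneg _ _ (by positivity), ENNReal.ofReal_max]
  refine max_le (le_trans (ENNReal.ofReal_le_ofReal ?_) hn₁)
    (le_trans (ENNReal.ofReal_le_ofReal ?_) hn₂)
  · gcongr; exact min_le_left _ _
  · have : 0 ≤ Real.log n / n := div_nonneg (Real.log_natCast_nonneg n) (Nat.cast_nonneg n)
    gcongr; exact min_le_right _ _
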